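/- **Problem.** In $2$-batch coloring of interval graphs with known representation, two finite families (batches) $B_1,B_2$ of nonempty bounded real intervals (open, closed or semi-closed; repetitions allowed) are presented one after the other. When a batch arrives, its intervals are given explicitly, and a deterministic algorithm $A$ must irrevocably assign a color to each of them: the colors of $B_1$ depend on $B_1$ only, those of $B_2$ on $B_1$ and $B_2$. Overlapping intervals (nonempty intersection) must always get different colors. $A(\sigma)$ is the number of colors used on the input $\sigma=(B_1,B_2)$, and $\mathrm{OPT}(\sigma)$ is the chromatic number of the overlap graph of all intervals of $\sigma$. $A$ is $\rho$-competitive if for some constant $b$, $A(\sigma)\le\rho\,\mathrm{OPT}(\sigma)+b$ for all $\sigma$, and strictly $\rho$-competitive if this holds with $b=0$. The (strict) competitive ratio of $A$ is the infimum of all $\rho$ for which $A$ is (strictly) $\rho$-competitive; the optimal (strict) competitive ratio is the infimum of these over all algorithms. **Algorithm TwoBatches.** Let $\omega_1,\omega$ be the maximum clique sizes of the overlap graphs of $B_1$ and of $B_1\cup B_2$. The event points are the endpoints of first-batch intervals, with multiplicity, in a total order $T$ that refines $\le$; at one real number the order is: right endpoints not in their interval, left endpoints in their interval, right endpoints in their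 interval, left endpoints not in their interval (other ties are broken arbitrarily). *First batch.* Start with a stack containing $1,\dots,\omega_1$ with $1$ on top. Process the event points in the order $T$: at a left endpoint pop a color and give it to the interval; at a right endpoint push the color of the interval. *Second batch.* Add to the first batch one dummy clique of $\omega$ nested intervals to the left and one to the right of all input intervals; the order $T$ is extended to their endpoints, and their colors are those given by the stack rule with initial stack $1,\dots,\omega$ (which leaves the colors of the first batch unchanged). For each maximal clique of the (extended) first batch fix a clique point contained in all its intervals. Call two points equivalent if they have the same position (left, equal, right) relative to every clique point and the same position (left, inside, right) relative to every interval of both batches; fix a set $\mathcal P$ with one point from each class. Properly color $B_2$ with $\omega$ colors; the color classes (some possibly empty) are the initial chains of the single region $(-\infty,\infty)$. All first-batch intervals are unprocessed. In iteration $i$, a clique point is active if its maximal clique has size at least $\omega-i+1$. An event point counts as left or right of a clique point $x$ according to $T$, where $x$ is placed after the left endpoints and before the right endpoints at $x$ that belong to their intervals. With $d_p$ the number of second-batch intervals containing $p$, a set $S$ of second-batch intervals covers $p$ in iteration $i$ if at least $\min\{d_p,i\}$ intervals in $S$ contain $p$. For $i=1,\dots,\lfloor\omega/2\rfloor$: split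 all regions at all active clique points, restricting the chains to the new regions; each part inherits which first-batch intervals are processed. Then for each region $R$ with a nonempty chain: 1. Let $C_1$ be a chain of $R$ containing the leftmost left endpoint and $C_2$ any other chain of $R$. While some point of $\mathcal P\cap R$ is not covered by the already colored second-batch intervals together with $C_1\cup C_2$: let $p$ be the leftmost such point and $C_3$ a chain of $R$ containing $p$. If every $q\in\mathcal P\cap R$ with $q<p$ is contained in $C_3$ or in both $C_1$ and $C_2$, set $C_2:=C_3$. Otherwise let $q$ be the rightmost violating point and let $C\in\{C_1,C_2\}$ be a chain not containing $q$; do a crossover, i.e. $C$ and $C_3$ swap their sets of intervals lying entirely to the right of $q$. 2. Let $I_\ell$ and $I_r$ be the unprocessed first-batch intervals of the earliest and of the latest event point in $R$ associated with an unprocessed interval. Mark them as processed in $R$, color $C_1$ with the color of $I_\ell$ and $C_2$ with $\omega+i$, and remove $C_1$, $C_2$ from the chains of $R$. Finally, split the regions at the clique points active for $i=\lfloor\omega/2\rfloor+1$, and in each region that still has a nonempty chain color one such chain with the color of the unprocessed first-batch interval of the earliest event point in the region (among those of unprocessed intervals). **Theorem.** The arbitrary choices in TwoBatches can be made, and however they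 are made: (a) for every input $\sigma$, TwoBatches produces a proper coloring with at most $\lfloor\frac32\,\mathrm{OPT}(\sigma)\rfloor$ colors; (b) its strict competitive ratio and its competitive ratio are both $\frac32$. Moreover, no algorithm is $\rho$-competitive for any $\rho<\frac32$; hence the optimal competitive ratio and the optimal strict competitive ratio for the problem are both $\frac32$. -/

import Mathlib

noncomputable section

namespace BatchColoring

/-! ## Intervals, batches, overlap graphs -/

/-- A nonempty bounded interval of the real line; each endpoint may or may not belong to it
(so the interval is open, closed or semi-closed). -/
structure RealInterval where
  lo : ℝ
  hi : ℝ
  loClosed : Bool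
  hiClosed : Bool
  valid : lo < hi ∨ (lo = hi ∧ loClosed = true ∧ hiClosed = true)

/-- The points of an interval. -/
def RealInterval.pts (I : RealInterval) : Set ℝ :=
  {x | (I.lo < x ∨ (x = I.lo ∧ I.loClosed = true)) ∧ (x < I.hi ∨ (x = I.hi ∧ I.hiClosed = true))}

/-- The interval graph given by a family of intervals: distinct members of the family are adjacent
iff the intervals have a nonempty intersection.  (The same interval may occur several times.) -/
def overlapGraph {ι : Type} (J : ι → RealInterval) : SimpleGraph ι where
  Adj i j := i ≠ j ∧ ((J i).pts ∩ (J j).pts).Nonempty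
  symm := ⟨fun _ _ h => ⟨h.1.symm, by rw [Set.inter_comm]; exact h.2⟩⟩
  loopless := ⟨fun _ h => h.1 rfl⟩

/-- A batch: a finite indexed family of intervals. -/
structure Batch where
  size : ℕ
  interval : Fin size → RealInterval

/-- All intervals of an input consisting of two batches. -/
def allIntervals (B₁ B₂ : Batch) : Fin B₁.size ⊕ Fin B₂.size → RealInterval :=
  Sum.elim B₁.interval B₂.interval

/-- The optimal offline cost: the chromatic number of the interval graph of the whole input. -/
def opt (B₁ B₂ : Batch) : ℕ := (overlapGraph (allIntervals B₁ B₂)).chromaticNumber.toNat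

/-- The maximum clique size of the interval graph of the whole input. -/
def omega (B₁ B₂ : Batch) : ℕ := (overlapGraph (allIntervals B₁ B₂)).cliqueNum

/-! ## Algorithms for 2-batch coloring with known representation, and competitive ratios -/

/-- A deterministic 2-batch algorithm: the colors of the first batch depend on the first batch
only, the colors of the second batch depend on both batches. -/
structure Algorithm where
  first : (B₁ : Batch) → Fin B₁.size → ℕ
  second : (B₁ B₂ : Batch) → Fin B₂.size → ℕ

/-- The coloring of the whole input that is produced. -/
def Algorithm.coloring (A : Algorithm) (B₁ B₂ : Batch) : Fin B₁.size ⊕ Fin B₂.size → ℕ :=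
  Sum.elim (A.first B₁) (A.second B₁ B₂)

/-- The algorithm always produces a proper coloring of the whole interval graph. -/
def Algorithm.IsProper (A : Algorithm) : Prop :=
  ∀ B₁ B₂ : Batch, ∀ u v, (overlapGraph (allIntervals B₁ B₂)).Adj u v →
    A.coloring B₁ B₂ u ≠ A.coloring B₁ B₂ v

/-- The number of distinct colors used. -/
def Algorithm.cost (A : Algorithm) (B₁ B₂ : Batch) : ℕ :=
  (Finset.univ.image (A.coloring B₁ B₂)).card

def Algorithm.IsCompetitive (A : Algorithm) (ρ : ℝ) : Prop :=
  ∃ b : ℝ, ∀ B₁ B₂ : Batch, (A.cost B₁ B₂ : ℝ) ≤ ρ * (opt B₁ B₂ : ℝ) + b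

def Algorithm.IsStrictlyCompetitive (A : Algorithm) (ρ : ℝ) : Prop :=
  ∀ B₁ B₂ : Batch, (A.cost B₁ B₂ : ℝ) ≤ ρ * (opt B₁ B₂ : ℝ)

/-- The (asymptotic) competitive ratio; it is `⊤` if the algorithm is not competitive. -/
def Algorithm.competitiveRatio (A : Algorithm) : EReal :=
  sInf ((fun ρ : ℝ => (ρ : EReal)) '' {ρ : ℝ | A.IsCompetitive ρ})

/-- The strict competitive ratio; it is `⊤` if the algorithm is not strictly competitive. -/
def Algorithm.strictCompetitiveRatio (A : Algorithm) : EReal :=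
  sInf ((fun ρ : ℝ => (ρ : EReal)) '' {ρ : ℝ | A.IsStrictlyCompetitive ρ})

/-- The optimal competitive ratio: the infimum over all algorithms for the problem. -/
def optimalCompetitiveRatio : EReal :=
  sInf (Algorithm.competitiveRatio '' {A : Algorithm | A.IsProper})

/-- The optimal strict competitive ratio: the infimum over all algorithms for the problem. -/
def optimalStrictCompetitiveRatio : EReal :=
  sInf (Algorithm.strictCompetitiveRatio '' {A : Algorithm | A.IsProper})

/-! ## Event points and the stack-based coloring of the first batch -/

/-- Event points: `Sum.inl i` is the left endpoint and `Sum.inr i` the right endpoint of the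
interval with index `i`. -/
abbrev Event (ι : Type) : Type := ι ⊕ ι

/-- The interval an event point is associated with. -/
def Event.owner {ι : Type} : Event ι → ι := Sum.elim id id

/-- The position of an event point.  At one and the same real number, right endpoints not belonging
to their interval come first, then left endpoints belonging to their interval, then right endpoints
belonging to their interval, then left endpoints not belonging to their interval. -/
def Event.position {ι : Type} (J : ι → RealInterval) : Event ι → ℝ ×ₗ ℕ
  | Sum.inl i => toLex ((J i).lo, if (J i).loClosed = true then 1 else 3)
  | Sum.inr i => toLex ((J i).hi, if (J i).hiClosed = true then 2 else 0)

/-- `T` lists all event points, each once, in an admissible total order (ties between event points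
of equal position are broken arbitrarily). -/
def IsEventOrder {ι : Type} (J : ι → RealInterval) (T : List (Event ι)) : Prop :=
  T.Nodup ∧ (∀ e, e ∈ T) ∧ T.Pairwise fun e e' => e.position J ≤ e'.position J

open scoped Classical in
/-- One step of the first-batch algorithm on (stack of available colors, colors given so far):
at a left endpoint the color of the interval is popped, at a right endpoint it is pushed. -/
def stackStep {ι : Type} (s : List ℕ × (ι → ℕ)) : Event ι → List ℕ × (ι → ℕ)
  | Sum.inl i => (s.1.tail, Function.update s.2 i (s.1.headD 0))
  | Sum.inr i => (s.2 i :: s.1, s.2)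

/-- The stack-based coloring: initially the stack contains `1, …, w` with `1` on top, and the event
points are processed in the order `T`. -/
def stackColoring {ι : Type} (T : List (Event ι)) (w : ℕ) : ι → ℕ :=
  (T.foldl stackStep (List.range' 1 w, fun _ => 0)).2

/-! ## Dummy cliques

One clique of `w` intervals is put before, and one clique of `w` intervals is put after all
intervals of the input.  The intervals of such a clique are nested. -/

/-- A number such that all intervals of the input lie strictly between `-bound` and `bound`. -/
def bound (B₁ B₂ : Batch) : ℝ :=
  1 + ∑ v, (|(allIntervals B₁ B₂ v).lo| + |(allIntervals B₁ B₂ v).hi|)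

/-- The closed interval with the given center and radius. -/
def closedBall (a r : ℝ) (hr : 0 ≤ r) : RealInterval where
  lo := a - r
  hi := a + r
  loClosed := true
  hiClosed := true
  valid := by
    rcases hr.lt_or_eq with h | h
    · left; linarith
    · right; exact ⟨by linarith, rfl, rfl⟩

/-- Index type of the first batch with the dummy intervals:
left dummies, first-batch intervals, right dummies. -/
abbrev ExtIndex (B₁ B₂ : Batch) : Type :=
  Fin (omega B₁ B₂) ⊕ (Fin B₁.size ⊕ Fin (omega B₁ B₂))

/-- The first batch with the dummy intervals. -/
def extended (B₁ B₂ : Batch) : ExtIndex B₁ B₂ → RealInterval :=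
  Sum.elim
    (fun k => closedBall (-(bound B₁ B₂ + omega B₁ B₂)) ((omega B₁ B₂ : ℝ) - (k : ℕ))
      (sub_nonneg.2 (Nat.cast_le.2 k.2.le)))
    (Sum.elim B₁.interval
      (fun k => closedBall (bound B₁ B₂ + omega B₁ B₂) ((omega B₁ B₂ : ℝ) - (k : ℕ))
        (sub_nonneg.2 (Nat.cast_le.2 k.2.le))))

/-- The event points of a nested clique with `w` members in their order. -/
def nestedEvents (w : ℕ) : List (Event (Fin w)) :=
  (List.finRange w).map Sum.inl ++ (List.finRange w).reverse.map Sum.inr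

/-- The order of the event points of the first batch with dummies that extends the order `T` of the
event points of the first batch. -/
def extendedOrder (B₁ B₂ : Batch) (T : List (Event (Fin B₁.size))) :
    List (Event (ExtIndex B₁ B₂)) :=
  (nestedEvents (omega B₁ B₂)).map (Sum.map Sum.inl Sum.inl) ++
    T.map (Sum.map (Sum.inr ∘ Sum.inl) (Sum.inr ∘ Sum.inl)) ++
    (nestedEvents (omega B₁ B₂)).map (Sum.map (Sum.inr ∘ Sum.inr) (Sum.inr ∘ Sum.inr))

/-! ## Coloring the second batch

Throughout, `J` is the first batch (with the dummy intervals) and `K` is the second batch. -/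

section SecondBatch

variable {ι κ : Type} [Fintype ι] [Fintype κ]

/-- Maximal cliques of the first batch. -/
def IsMaximalClique (J : ι → RealInterval) (C : Finset ι) : Prop :=
  Maximal (fun s : Finset ι => (overlapGraph J).IsClique (s : Set ι)) C

/-- Both points belong to the interval, or both are on the same side of it. -/
def SameSide (I : RealInterval) (x y : ℝ) : Prop :=
  (x ∈ I.pts ∧ y ∈ I.pts) ∨ (∀ z ∈ I.pts, x < z ∧ y < z) ∨ (∀ z ∈ I.pts, z < x ∧ z < y)

/-- The equivalence of points used for the choice of representative points: same position relative
to every clique point and relative to every interval of both batches. -/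
def PointEquiv (J : ι → RealInterval) (K : κ → RealInterval) (cliquePoint : Finset ι → ℝ)
    (x y : ℝ) : Prop :=
  (∀ C, IsMaximalClique J C →
    ((x < cliquePoint C ↔ y < cliquePoint C) ∧ (cliquePoint C < x ↔ cliquePoint C < y))) ∧
  (∀ i, SameSide (J i) x y) ∧ (∀ k, SameSide (K k) x y)

/-- A region `[lo, hi]` with its chains, the set of chains still to be colored (chains are referred
to by numbers; chain number `l` is `chain l`) and the first-batch intervals whose part in the region
is unprocessed. -/
structure Region (ι κ : Type) where
  lo : EReal
  hi : EReal
  labels : Finset ℕ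
  chain : ℕ → Finset κ
  unprocessed : Finset ι

/-- The point lies in the region. -/
def Region.Has (R : Region ι κ) (x : ℝ) : Prop := R.lo ≤ (x : EReal) ∧ (x : EReal) ≤ R.hi

/-- The event point lies in the region, that is, it is to the right of the left boundary point and
to the left of the right boundary point.  A left endpoint is to the right of a point iff all points
of its interval are; a right endpoint is to the right of a point unless all points of its interval
are to the left of that point; and symmetrically. -/
def Region.HasEvent (J : ι → RealInterval) (R : Region ι κ) : Event ι → Prop
  | Sum.inl i => (∀ x ∈ (J i).pts, R.lo < (x : EReal)) ∧ (∃ x ∈ (J i).pts, (x : EReal) ≤ R.hi)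
  | Sum.inr i => (∃ x ∈ (J i).pts, R.lo ≤ (x : EReal)) ∧ (∀ x ∈ (J i).pts, (x : EReal) < R.hi)

/-- Some interval of the set contains the point. -/
def Contains (K : κ → RealInterval) (S : Finset κ) (x : ℝ) : Prop := ∃ k ∈ S, x ∈ (K k).pts

open scoped Classical in
/-- With `d` the number of second-batch intervals containing `x`, at least `min d i` of the
intervals in `S` contain `x`. -/
def Covered (K : κ → RealInterval) (i : ℕ) (S : Finset κ) (x : ℝ) : Prop :=
  min (Finset.univ.filter fun k => x ∈ (K k).pts).card i ≤ (S.filter fun k => x ∈ (K k).pts).card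

/-- The arbitrary choices made while the second batch is colored.  `pick i R h s` is the element
picked from a nonempty set `s` of (numbers of) chains in iteration `i`, when `R` is the current
region and `h` the list of the chains referred to at that moment. -/
structure SecondChoices (J : ι → RealInterval) (K : κ → RealInterval) (w : ℕ) where
  cliquePoint : Finset ι → ℝ
  cliquePoint_mem : ∀ C, IsMaximalClique J C → ∀ i ∈ C, cliquePoint C ∈ (J i).pts
  representatives : Finset ℝ
  representatives_spec :
    ∀ x : ℝ, ∃! p, p ∈ representatives ∧ PointEquiv J K cliquePoint x p
  initialChain : κ → ℕ
  initialChain_lt : ∀ k, initialChain k < w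
  initialChain_proper :
    ∀ k k', (overlapGraph K).Adj k k' → initialChain k ≠ initialChain k'
  pick : ℕ → Region ι κ → List ℕ → Finset ℕ → ℕ
  pick_mem : ∀ i R h s, s.Nonempty → pick i R h s ∈ s

open scoped Classical in
/-- `while guard do body`, started in the state `s` (the value is `s` if the loop does not
terminate). -/
def whileDo {σ : Type} (guard : σ → Prop) (body : σ → σ) (s : σ) : σ :=
  if h : ∃ n, ¬ guard (body^[n] s) then body^[Nat.find h] s else s

variable {J : ι → RealInterval} {K : κ → RealInterval} {w : ℕ}

open scoped Classical in
/-- The active clique points in iteration `i`: those of the maximal cliques of size at least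
`w - i + 1`. -/
def activePoints (ch : SecondChoices J K w) (i : ℕ) : Finset ℝ :=
  (Finset.univ.filter fun C : Finset ι =>
    IsMaximalClique J C ∧ w + 1 ≤ C.card + i).image ch.cliquePoint

open scoped Classical in
/-- Restriction of a region (with its chains) to the part `[lo, hi]`. -/
def Region.restrict (K : κ → RealInterval) (R : Region ι κ) (lo hi : EReal) : Region ι κ where
  lo := lo
  hi := hi
  labels := R.labels
  chain l := (R.chain l).filter fun k => ∃ x ∈ (K k).pts, lo ≤ (x : EReal) ∧ (x : EReal) ≤ hi
  unprocessed := R.unprocessed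

/-- Split a region at an increasing list of interior points. -/
def Region.splitAt (K : κ → RealInterval) (R : Region ι κ) : EReal → List ℝ → List (Region ι κ)
  | lo, [] => [R.restrict K lo R.hi]
  | lo, a :: as => R.restrict K lo (a : EReal) :: Region.splitAt K R (a : EReal) as

open scoped Classical in
/-- Split all regions at all clique points that are active in iteration `i`. -/
def splitRegions (ch : SecondChoices J K w) (i : ℕ) (Rs : List (Region ι κ)) :
    List (Region ι κ) :=
  Rs.flatMap fun R => R.splitAt K R.lo
    (((activePoints ch i).filter fun a : ℝ => R.lo < (a : EReal) ∧ (a : EReal) < R.hi).sort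
      (· ≤ ·))

open scoped Classical in
/-- The representative points in a region. -/
def regionPoints (ch : SecondChoices J K w) (R : Region ι κ) : Finset ℝ :=
  ch.representatives.filter R.Has

/-- The local variables of the chain creation procedure: the region with its current chains, and
the numbers of the first and the second selected chain. -/
structure ChainState (ι κ : Type) where
  region : Region ι κ
  c₁ : ℕ
  c₂ : ℕ

open scoped Classical in
/-- Selection of the first two chains: one that contains the leftmost left endpoint, and any
other one. -/
def initialChainState (ch : SecondChoices J K w) (i : ℕ) (R : Region ι κ) : ChainState ι κ :=
  let c₁ := ch.pick i R [] (R.labels.filter fun l =>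
    ∃ k ∈ R.chain l, ∀ l' ∈ R.labels, ∀ k' ∈ R.chain l', (K k).lo ≤ (K k').lo)
  let c₂ := ch.pick i R [c₁] (R.labels.erase c₁)
  ⟨R, c₁, c₂⟩

open scoped Classical in
/-- The representative points of the region that are not covered by the colored intervals and the
two selected chains. -/
def uncovered (ch : SecondChoices J K w) (i : ℕ) (colored : Finset κ) (s : ChainState ι κ) :
    Finset ℝ :=
  (regionPoints ch s.region).filter fun x =>
    ¬ Covered K i (colored ∪ s.region.chain s.c₁ ∪ s.region.chain s.c₂) x

open scoped Classical in
/-- Crossover of the chains number `a` and `b` at the point `q`: they swap their tails, i.e. their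
sets of intervals that start to the right of `q`. -/
def crossover (K : κ → RealInterval) (R : Region ι κ) (a b : ℕ) (q : ℝ) : Region ι κ :=
  let tail : ℕ → Finset κ := fun l => (R.chain l).filter fun k => ∀ x ∈ (K k).pts, q < x
  { R with
    chain := Function.update
      (Function.update R.chain a ((R.chain a \ tail a) ∪ tail b))
      b ((R.chain b \ tail b) ∪ tail a) }

open scoped Classical in
/-- The body of the loop of the chain creation procedure.  With `p` the leftmost uncovered point
and `c₃` a chain containing `p`: if every representative point to the left of `p` is in chain `c₃`
or in both selected chains, then chain `c₃` replaces the second selected chain; otherwise, with `q`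
the rightmost point violating this, there is a crossover at `q` of chain `c₃` and a selected chain
not containing `q`. -/
def chainStep (ch : SecondChoices J K w) (i : ℕ) (colored : Finset κ) (s : ChainState ι κ) :
    ChainState ι κ :=
  if h : (uncovered ch i colored s).Nonempty then
    let R := s.region
    let p := (uncovered ch i colored s).min' h
    let c₃ := ch.pick i R [s.c₁, s.c₂] (R.labels.filter fun l => Contains K (R.chain l) p)
    let violating := (regionPoints ch R).filter fun q => q < p ∧
      ¬ (Contains K (R.chain c₃) q ∨
        (Contains K (R.chain s.c₁) q ∧ Contains K (R.chain s.c₂) q))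
    if hv : violating.Nonempty then
      let q := violating.max' hv
      let c := ch.pick i R [s.c₁, s.c₂, c₃]
        (({s.c₁, s.c₂} : Finset ℕ).filter fun l => ¬ Contains K (R.chain l) q)
      { s with region := crossover K R c c₃ q }
    else { s with c₂ := c₃ }
  else s

/-- The chain creation procedure. -/
def createChains (ch : SecondChoices J K w) (i : ℕ) (colored : Finset κ) (R : Region ι κ) :
    ChainState ι κ :=
  whileDo (fun s => (uncovered ch i colored s).Nonempty) (chainStep ch i colored)
    (initialChainState ch i R)

open scoped Classical in
/-- The event points in the region associated with unprocessed intervals, in the order `T`. -/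
def unprocessedEvents (J : ι → RealInterval) (T : List (Event ι)) (R : Region ι κ) :
    List (Event ι) :=
  T.filter fun e => decide (R.HasEvent J e ∧ e.owner ∈ R.unprocessed)

/-- The unprocessed first-batch interval of the earliest event point in the region. -/
def earliest (J : ι → RealInterval) (T : List (Event ι)) (R : Region ι κ) : Option ι :=
  (unprocessedEvents J T R).head?.map Event.owner

/-- The unprocessed first-batch interval of the latest event point in the region. -/
def latest (J : ι → RealInterval) (T : List (Event ι)) (R : Region ι κ) : Option ι :=
  (unprocessedEvents J T R).getLast?.map Event.owner

/-- The region has a nonempty chain that is not yet colored. -/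
def Region.HasNonemptyChain (R : Region ι κ) : Prop := ∃ l ∈ R.labels, (R.chain l).Nonempty

open scoped Classical in
/-- Iteration `i` in one region: two chains are created; the first gets the color of the unprocessed
first-batch interval of the earliest event point, the second gets the color `w + i`.  The colors of
second-batch intervals so far are in `col` (`none`: not colored).  `c` is the coloring of the first
batch. -/
def colorTwoChains (ch : SecondChoices J K w) (T : List (Event ι)) (c : ι → ℕ) (i : ℕ)
    (R : Region ι κ) (col : κ → Option ℕ) : Region ι κ × (κ → Option ℕ) :=
  if R.HasNonemptyChain then
    let s := createChains ch i (Finset.univ.filter fun k => (col k).isSome = true) R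
    let Iₗ := earliest J T s.region
    let Iᵣ := latest J T s.region
    ({ s.region with
        labels := (s.region.labels.erase s.c₁).erase s.c₂
        unprocessed := s.region.unprocessed.filter fun j => Iₗ ≠ some j ∧ Iᵣ ≠ some j },
      fun k =>
        if k ∈ s.region.chain s.c₁ then some ((Iₗ.map c).getD 0)
        else if k ∈ s.region.chain s.c₂ then some (w + i)
        else col k)
  else (R, col)

open scoped Classical in
/-- The last step in one region: a remaining nonempty chain gets the color of the unprocessed
first-batch interval of the earliest event point. -/
def colorLastChain (ch : SecondChoices J K w) (T : List (Event ι)) (c : ι → ℕ) (i : ℕ)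
    (R : Region ι κ) (col : κ → Option ℕ) : Region ι κ × (κ → Option ℕ) :=
  if R.HasNonemptyChain then
    let l := ch.pick i R [] (R.labels.filter fun l => (R.chain l).Nonempty)
    (R, fun k => if k ∈ R.chain l then some (((earliest J T R).map c).getD 0) else col k)
  else (R, col)

/-- `for each region R do body`. -/
def forRegions (body : Region ι κ → (κ → Option ℕ) → Region ι κ × (κ → Option ℕ)) :
    List (Region ι κ) → (κ → Option ℕ) → List (Region ι κ) × (κ → Option ℕ)
  | [], col => ([], col)
  | R :: Rs, col =>
    let r := body R col
    let rs := forRegions body Rs r.2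
    (r.1 :: rs.1, rs.2)

open scoped Classical in
/-- The single region `(-∞, ∞)` with the color classes of the initial coloring as chains. -/
def initialRegion (ch : SecondChoices J K w) : Region ι κ where
  lo := ⊥
  hi := ⊤
  labels := Finset.range w
  chain l := Finset.univ.filter fun k => ch.initialChain k = l
  unprocessed := Finset.univ

/-- Iteration `i` of the main loop. -/
def iteration (ch : SecondChoices J K w) (T : List (Event ι)) (c : ι → ℕ)
    (st : List (Region ι κ) × (κ → Option ℕ)) (i : ℕ) : List (Region ι κ) × (κ → Option ℕ) :=
  forRegions (colorTwoChains ch T c i) (splitRegions ch i st.1) st.2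

/-- The second-batch algorithm: iterations `1, …, ⌊w/2⌋`, and then the last step, before which the
regions are split once more. -/
def secondColoring (ch : SecondChoices J K w) (T : List (Event ι)) (c : ι → ℕ) (k : κ) : ℕ :=
  let st := (List.range' 1 (w / 2)).foldl (iteration ch T c) ([initialRegion ch], fun _ => none)
  let fin := forRegions (colorLastChain ch T c (w / 2 + 1))
    (splitRegions ch (w / 2 + 1) st.1) st.2
  (fin.2 k).getD 0

end SecondBatch

/-! ## The algorithm TwoBatches -/

/-- All arbitrary choices of the algorithm TwoBatches. -/
structure TwoBatchesChoices where
  order : (B₁ : Batch) → List (Event (Fin B₁.size))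
  order_spec : ∀ B₁, IsEventOrder B₁.interval (order B₁)
  second : (B₁ B₂ : Batch) → SecondChoices (extended B₁ B₂) B₂.interval (omega B₁ B₂)

/-- The algorithm TwoBatches, for given arbitrary choices. -/
def twoBatches (ch : TwoBatchesChoices) : Algorithm where
  first B₁ := stackColoring (ch.order B₁) (overlapGraph B₁.interval).cliqueNum
  second B₁ B₂ :=
    let T := extendedOrder B₁ B₂ (ch.order B₁)
    secondColoring (ch.second B₁ B₂) T (stackColoring T (omega B₁ B₂))

/-- The algorithm is TwoBatches, with its arbitrary choices made in some way. -/
def IsTwoBatches (A : Algorithm) : Prop := ∃ ch : TwoBatchesChoices, A = twoBatches ch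

end BatchColoring

end

/-!
**Upper bound.** Let `w` be the clique number of the whole input.  The dummy cliques change
neither the colors of the first batch (`stackColoring_extended`) nor the bound `w` on the number
of intervals at a point (`admissible_extended`), so one may assume that the second batch lies
between two maximal first-batch cliques of size `w`.

The loop invariant (`RegionInvariant`, `PartialProper`) says that after `n` iterations each point
is covered at least `n` times, or as often as possible, by colored second-batch intervals, that
the uncolored ones lie in the interior of their regions, and that in a region with uncolored
intervals there remain `w - 2 * n` chains and exactly `w - n` colors of `1, …, w` that are not
processed.  If a point lies in an uncolored interval, then it is in more than `n` intervals of the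
second batch and hence in fewer than `w - n` of the first (`RegionInvariant.depth_lt`).  Therefore
uncolored intervals avoid all clique points active in iteration `n + 1`
(`RegionInvariant.cliquePoint_notMem`), splitting the regions there cuts no uncolored interval,
and at such a clique point all unprocessed colors are in use by the first batch
(`RegionInvariant.restrict`).

Consider now a region between two such clique points.  The heart of the proof is the behaviour of
the stack there (`exists_extreme_intervals`).  At the left boundary no unprocessed color is on the
stack.  The first event of an unprocessed interval therefore pushes its color, which from then on
is the deepest unprocessed color on the stack.  It is popped only when no other unprocessed color
remains there, and then at least `w - n` first-batch intervals are open; they form a clique, whose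
clique point would be active and so cannot be inside the region.  This happens at the last event
of an unprocessed interval, which is the left endpoint of an interval that receives the same
color.  Hence the earliest and the latest unprocessed interval share one color, and this color is
on the stack, that is, unused by the first batch, at all points at which uncolored intervals can
be.  Giving it to one chain, and the new color `w + n + 1` to another one, keeps the coloring
proper (`colorTwoChains_spec`).  That two chains suffice to cover each point once more is achieved
by the crossovers: each step of the chain creation moves the leftmost uncovered point to the right
(`chainStep_spec`, `createChains_spec`).  After `⌊w / 2⌋` iterations at most one chain per region
is left, and it receives an unprocessed color (`colorLastChain_spec`).  Altogether the colors are
among `1, …, w + ⌊w / 2⌋`, and `w` is at most the chromatic number (`omega_le_opt`).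

**Lower bound.** The adversary presents a long row of disjoint cliques of size `n`, each
consisting of `n` copies of one point.  If fewer than `3 * n` colors are used, then two of the
cliques have the same set of `n` colors, and the second batch bridges the gap between them by `n`
copies each of two closed intervals sharing one point, the first of which meets the one clique and
the second the other one.  All of the bridge intervals overlap and must avoid these `n` colors, so
that `3 * n` colors are needed (`le_cost_bridge`), although the chromatic number is at
most `2 * n` (`opt_bridge_le`).
-/

namespace BatchColoring

variable {ι κ : Type}

/-! ### Intervals and event points on the line -/

theorem RealInterval.pts_nonempty (I : RealInterval) : I.pts.Nonempty := by
  rcases I.valid with h | ⟨h, h1, h2⟩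
  · exact ⟨(I.lo + I.hi) / 2, Or.inl (by linarith), Or.inl (by linarith)⟩
  · exact ⟨I.lo, Or.inr ⟨rfl, h1⟩, Or.inr ⟨h, h2⟩⟩

theorem RealInterval.mem_of_le_of_le {I : RealInterval} {x y z : ℝ} (hx : x ∈ I.pts)
    (hz : z ∈ I.pts) (hxy : x ≤ y) (hyz : y ≤ z) : y ∈ I.pts := by
  refine ⟨?_, ?_⟩
  · rcases hx.1 with h | ⟨h, h'⟩
    · exact Or.inl (h.trans_le hxy)
    · rcases hxy.lt_or_eq with h1 | h1
      · exact Or.inl (h ▸ h1)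
      · exact Or.inr ⟨by rw [← h1, h], h'⟩
  · rcases hz.2 with h | ⟨h, h'⟩
    · exact Or.inl (hyz.trans_lt h)
    · rcases hyz.lt_or_eq with h1 | h1
      · exact Or.inl (h ▸ h1)
      · exact Or.inr ⟨by rw [h1, h], h'⟩

theorem RealInterval.convex_pts (I : RealInterval) : Convex ℝ I.pts := by
  apply Set.OrdConnected.convex
  exact ⟨fun x hx z hz y hy => RealInterval.mem_of_le_of_le hx hz hy.1 hy.2⟩

/-- A point outside an interval is on one side of it. -/
theorem RealInterval.forall_lt_or_forall_gt {I : RealInterval} {x : ℝ} (hx : x ∉ I.pts) :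
    (∀ z ∈ I.pts, x < z) ∨ (∀ z ∈ I.pts, z < x) := by
  by_contra! h
  obtain ⟨⟨y, hy, hyx⟩, z, hz, hzx⟩ := h
  exact hx (RealInterval.mem_of_le_of_le hy hz hyx hzx)

theorem RealInterval.forall_gt_of_notMem {I : RealInterval} {q x : ℝ} (hq : q ∉ I.pts)
    (hx : x ∈ I.pts) (h : q < x) : ∀ z ∈ I.pts, q < z := by
  rcases RealInterval.forall_lt_or_forall_gt hq with h1 | h1
  · exact h1
  · exact absurd (h1 x hx) h.not_gt

theorem RealInterval.forall_lt_of_notMem {I : RealInterval} {q x : ℝ} (hq : q ∉ I.pts)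
    (hx : x ∈ I.pts) (h : x < q) : ∀ z ∈ I.pts, z < q := by
  rcases RealInterval.forall_lt_or_forall_gt hq with h1 | h1
  · exact absurd (h1 x hx) h.not_gt
  · exact h1

/-- The event point comes before the point `x` of the line in the order of event points: `x` is
placed after the left endpoints and before the right endpoints at `x` that belong to their
intervals. -/
def Event.Before (J : ι → RealInterval) (x : ℝ) (e : Event ι) : Prop :=
  e.position J ≤ toLex (x, 1)

theorem Event.before_inl {J : ι → RealInterval} {x : ℝ} {i : ι} :
    Event.Before J x (Sum.inl i) ↔ ∃ y ∈ (J i).pts, y ≤ x := by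
  simp only [Event.Before, Event.position, Prod.Lex.toLex_le_toLex]
  constructor
  · rintro (h | ⟨h, h1⟩)
    · rcases (J i).valid with hv | ⟨hv, hv1, hv2⟩
      · obtain ⟨y, hy1, hy2⟩ := exists_between (lt_min h hv)
        exact ⟨y, ⟨Or.inl hy1, Or.inl (hy2.trans_le (min_le_right _ _))⟩,
          (hy2.trans_le (min_le_left _ _)).le⟩
      · exact ⟨(J i).lo, ⟨Or.inr ⟨rfl, hv1⟩, Or.inr ⟨hv, hv2⟩⟩, h.le⟩
    · have hc : (J i).loClosed = true := by by_contra hc; simp [hc] at h1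
      refine ⟨(J i).lo, ⟨Or.inr ⟨rfl, hc⟩, ?_⟩, h.le⟩
      rcases (J i).valid with hv | ⟨hv, hv1, hv2⟩
      · exact Or.inl hv
      · exact Or.inr ⟨hv, hv2⟩
  · rintro ⟨y, hy, hyx⟩
    rcases hy.1 with h | ⟨h, hc⟩
    · exact Or.inl (h.trans_le hyx)
    · rw [h] at hyx
      rcases hyx.lt_or_eq with h2 | h2
      · exact Or.inl h2
      · exact Or.inr ⟨h2, by simp [hc]⟩

theorem Event.before_inr {J : ι → RealInterval} {x : ℝ} {i : ι} :
    Event.Before J x (Sum.inr i) ↔ ∀ y ∈ (J i).pts, y < x := by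
  simp only [Event.Before, Event.position, Prod.Lex.toLex_le_toLex]
  constructor
  · rintro (h | ⟨h, h1⟩) y hy
    · rcases hy.2 with h2 | h2
      · exact h2.trans h
      · rw [h2.1]; exact h
    · have hc : (J i).hiClosed ≠ true := by intro hc; simp [hc] at h1
      rcases hy.2 with h2 | h2
      · exact h ▸ h2
      · exact absurd h2.2 hc
  · intro hy
    by_contra! hcon
    obtain ⟨h1, h2⟩ := hcon
    rcases h1.lt_or_eq with h | h
    · rcases (J i).valid with hv | ⟨hv, hv1, hv2⟩
      · obtain ⟨y, hy1, hy2⟩ := exists_between (max_lt h hv)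
        have := hy y ⟨Or.inl ((le_max_right _ _).trans_lt hy1), Or.inl hy2⟩
        exact absurd ((le_max_left _ _).trans_lt hy1) this.not_gt
      · have := hy (J i).lo ⟨Or.inr ⟨rfl, hv1⟩, Or.inr ⟨hv, hv2⟩⟩
        linarith
    · have h3 := h2 h.symm
      have hc : (J i).hiClosed = true := by by_contra hc; simp [hc] at h3
      have : (J i).hi < x := by
        refine hy (J i).hi ⟨?_, Or.inr ⟨rfl, hc⟩⟩
        rcases (J i).valid with hv | ⟨hv, hv1, hv2⟩
        · exact Or.inl hv
        · exact Or.inr ⟨hv.symm, hv1⟩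
      linarith

theorem Event.Before.mono {J : ι → RealInterval} {x : ℝ} {e e' : Event ι}
    (h : e.position J ≤ e'.position J) (h' : Event.Before J x e') : Event.Before J x e :=
  le_trans h h'

theorem Event.Before.trans_le {J : ι → RealInterval} {x y : ℝ} {e : Event ι}
    (h : Event.Before J x e) (hxy : x ≤ y) : Event.Before J y e := by
  refine le_trans h ?_
  rw [Prod.Lex.toLex_le_toLex]
  rcases hxy.lt_or_eq with h | h
  · exact Or.inl h
  · exact Or.inr ⟨h, le_rfl⟩

/-- With the point placed in the order of event points as above, an interval contains the point iff
its left endpoint comes before it and its right endpoint does not. -/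
theorem Event.mem_pts_iff {J : ι → RealInterval} {x : ℝ} {i : ι} :
    x ∈ (J i).pts ↔ Event.Before J x (Sum.inl i) ∧ ¬ Event.Before J x (Sum.inr i) := by
  rw [Event.before_inl, Event.before_inr]
  push Not
  constructor
  · intro h
    exact ⟨⟨x, h, le_rfl⟩, ⟨x, h, le_rfl⟩⟩
  · rintro ⟨⟨y, hy, hyx⟩, ⟨z, hz, hzx⟩⟩
    exact RealInterval.mem_of_le_of_le hy hz hyx hzx

theorem Event.position_inl_le_inr {J : ι → RealInterval} {i j : ι} :
    Event.position J (Sum.inl i) ≤ Event.position J (Sum.inr j) ↔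
      (J i).lo < (J j).hi ∨ ((J i).lo = (J j).hi ∧ (J i).loClosed = true ∧
        (J j).hiClosed = true) := by
  simp only [Event.position, Prod.Lex.toLex_le_toLex]
  by_cases h1 : (J i).loClosed = true <;> by_cases h2 : (J j).hiClosed = true <;> simp [h1, h2]

theorem Event.position_inl_lt_inr (J : ι → RealInterval) (i : ι) :
    Event.position J (Sum.inl i) < Event.position J (Sum.inr i) := by
  refine lt_of_le_of_ne (Event.position_inl_le_inr.2 (J i).valid) ?_
  intro h
  have h2 : (if (J i).loClosed = true then 1 else 3) = (if (J i).hiClosed = true then 2 else 0) :=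
    congrArg (fun z => (ofLex z).2) h
  split_ifs at h2 <;> omega

/-- Intervals overlap if the left endpoint of each of them precedes the right endpoint of the
other. -/
theorem Event.inter_nonempty {J : ι → RealInterval} {i j : ι}
    (h1 : Event.position J (Sum.inl i) ≤ Event.position J (Sum.inr j))
    (h2 : Event.position J (Sum.inl j) ≤ Event.position J (Sum.inr i)) :
    ((J i).pts ∩ (J j).pts).Nonempty := by
  rw [Event.position_inl_le_inr] at h1 h2
  have hi := (J i).valid
  have hj := (J j).valid
  rcases le_total (J i).lo (J j).lo with hl | hl <;> rcases le_total (J i).hi (J j).hi with hh | hh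
  · rcases h2 with h | ⟨h, ha, hb⟩
    · exact ⟨((J j).lo + (J i).hi) / 2, ⟨Or.inl (by linarith), Or.inl (by linarith)⟩,
        Or.inl (by linarith), Or.inl (by linarith)⟩
    · refine ⟨(J j).lo, ⟨?_, Or.inr ⟨h, hb⟩⟩, Or.inr ⟨rfl, ha⟩, ?_⟩
      · rcases hl.lt_or_eq with h3 | h3
        · exact Or.inl h3
        · rcases hi with h4 | h4
          · exact absurd (h4.trans_eq h.symm) (by rw [h3]; exact lt_irrefl _)
          · exact Or.inr ⟨h3.symm, h4.2.1⟩
      · rcases hj with h4 | h4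
        · exact Or.inl h4
        · exact Or.inr ⟨h4.1, h4.2.2⟩
  · rcases hj with h | ⟨h, ha, hb⟩
    · exact ⟨((J j).lo + (J j).hi) / 2, ⟨Or.inl (by linarith), Or.inl (by linarith)⟩,
        Or.inl (by linarith), Or.inl (by linarith)⟩
    · refine ⟨(J j).lo, ⟨?_, ?_⟩, Or.inr ⟨rfl, ha⟩, Or.inr ⟨h, hb⟩⟩
      · rcases hl.lt_or_eq with h3 | h3
        · exact Or.inl h3
        · rcases h1 with h4 | h4
          · linarith
          · exact Or.inr ⟨h3.symm, h4.2.1⟩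
      · rcases h2 with h4 | h4
        · exact Or.inl h4
        · exact Or.inr ⟨h4.1, h4.2.2⟩
  · rcases hi with h | ⟨h, ha, hb⟩
    · exact ⟨((J i).lo + (J i).hi) / 2, ⟨Or.inl (by linarith), Or.inl (by linarith)⟩,
        Or.inl (by linarith), Or.inl (by linarith)⟩
    · refine ⟨(J i).lo, ⟨Or.inr ⟨rfl, ha⟩, Or.inr ⟨h, hb⟩⟩, ?_, ?_⟩
      · rcases hl.lt_or_eq with h3 | h3
        · exact Or.inl h3
        · rcases h2 with h4 | h4
          · linarith
          · exact Or.inr ⟨h3.symm, h4.2.1⟩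
      · rcases h1 with h4 | h4
        · exact Or.inl h4
        · exact Or.inr ⟨h4.1, h4.2.2⟩
  · rcases h1 with h | ⟨h, ha, hb⟩
    · exact ⟨((J i).lo + (J j).hi) / 2, ⟨Or.inl (by linarith), Or.inl (by linarith)⟩,
        Or.inl (by linarith), Or.inl (by linarith)⟩
    · refine ⟨(J i).lo, ⟨Or.inr ⟨rfl, ha⟩, ?_⟩, ?_, Or.inr ⟨h, hb⟩⟩
      · rcases hi with h4 | h4
        · exact Or.inl h4
        · exact Or.inr ⟨h4.1, h4.2.2⟩
      · rcases hl.lt_or_eq with h3 | h3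
        · exact Or.inl h3
        · rcases hj with h4 | h4
          · linarith
          · exact Or.inr ⟨h3.symm, h4.2.1⟩

/-! ### Cliques of overlap graphs -/

theorem isClique_of_mem {J : ι → RealInterval} {x : ℝ} {s : Set ι}
    (h : ∀ i ∈ s, x ∈ (J i).pts) : (overlapGraph J).IsClique s :=
  fun i hi j hj hij => ⟨hij, x, h i hi, h j hj⟩

theorem exists_isMaximalClique_superset [Fintype ι] {J : ι → RealInterval} {s : Finset ι}
    (hs : (overlapGraph J).IsClique (s : Set ι)) : ∃ C, IsMaximalClique J C ∧ s ⊆ C := by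
  obtain ⟨C, hC, hmax⟩ := (Set.toFinite
    {t : Finset ι | (overlapGraph J).IsClique (t : Set ι)}).exists_le_maximal hs
  exact ⟨C, hmax, hC⟩

/-- A maximal clique consists of all intervals that contain its clique point. -/
theorem IsMaximalClique.mem_iff [Fintype ι] {J : ι → RealInterval} {C : Finset ι}
    (hC : IsMaximalClique J C) {x : ℝ} (hx : ∀ i ∈ C, x ∈ (J i).pts) {i : ι} :
    i ∈ C ↔ x ∈ (J i).pts := by
  classical
  refine ⟨hx i, fun hi => ?_⟩
  have : (overlapGraph J).IsClique ((insert i C : Finset ι) : Set ι) := by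
    apply isClique_of_mem (x := x)
    intro j hj
    rcases Finset.mem_insert.1 (Finset.mem_coe.1 hj) with rfl | h
    · exact hi
    · exact hx j h
  exact hC.2 this (Finset.subset_insert i C) (Finset.mem_insert_self i C)

/-- Helly's theorem on the line for cliques of an overlap graph. -/
theorem exists_common_point {J : ι → RealInterval} {s : Finset ι}
    (hs : (overlapGraph J).IsClique (s : Set ι)) : ∃ x, ∀ i ∈ s, x ∈ (J i).pts := by
  classical
  have h := Convex.helly_theorem' (𝕜 := ℝ) (E := ℝ) (F := fun i => (J i).pts) (s := s)
    (fun i _ => (J i).convex_pts) (by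
      intro t ht hcard
      rw [Module.finrank_self] at hcard
      rcases Nat.lt_or_ge t.card 2 with h2 | h2
      · have h3 := Finset.card_le_one.1 (Nat.lt_succ_iff.1 h2)
        rcases t.eq_empty_or_nonempty with rfl | ⟨i, hi⟩
        · simp
        · obtain ⟨x, hx⟩ := (J i).pts_nonempty
          exact ⟨x, by
            simp only [Set.mem_iInter]
            intro k hk
            rw [h3 k hk i hi]; exact hx⟩
      · obtain ⟨i, j, hij, rfl⟩ := Finset.card_eq_two.1 (le_antisymm hcard h2)
        obtain ⟨x, hx⟩ := (hs (ht (by simp)) (ht (by simp)) hij).2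
        exact ⟨x, by simpa using hx⟩)
  obtain ⟨x, hx⟩ := h
  exact ⟨x, by simpa using hx⟩

/-! ### The stack -/

/-- The interval is open after the events in `L`: its left endpoint has been processed and its
right endpoint has not. -/
def OpenAt (L : List (Event ι)) (i : ι) : Prop := Sum.inl i ∈ L ∧ Sum.inr i ∉ L

/-- The stack and the colors given so far after the events in `L`. -/
noncomputable def stackState (w : ℕ) (L : List (Event ι)) : List ℕ × (ι → ℕ) :=
  L.foldl stackStep (List.range' 1 w, fun _ => 0)

theorem stackState_concat (w : ℕ) (L : List (Event ι)) (e : Event ι) :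
    stackState w (L ++ [e]) = stackStep (stackState w L) e := by
  simp [stackState]

/-- In an event order, the left endpoint of an interval precedes its right endpoint. -/
theorem IsEventOrder.inl_mem_of_inr {J : ι → RealInterval} {T : List (Event ι)}
    (hT : IsEventOrder J T) {L : List (Event ι)} {i : ι} (hL : L <+: T) (hi : Sum.inr i ∈ L) :
    Sum.inl i ∈ L := by
  obtain ⟨R, rfl⟩ := hL
  rcases List.mem_append.1 (hT.2.1 (Sum.inl i)) with h | h
  · exact h
  · exact absurd ((List.pairwise_append.1 hT.2.2).2.2 _ hi _ h)
      (Event.position_inl_lt_inr J i).not_ge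

/-- Intervals that are open simultaneously form a clique. -/
theorem IsEventOrder.isClique_openAt {J : ι → RealInterval} {T : List (Event ι)}
    (hT : IsEventOrder J T) {L : List (Event ι)} (hL : L <+: T) :
    (overlapGraph J).IsClique {i | OpenAt L i} := by
  intro i hi j hj hij
  obtain ⟨R, rfl⟩ := hL
  have key : ∀ i j, OpenAt L i → OpenAt L j →
      Event.position J (Sum.inl i) ≤ Event.position J (Sum.inr j) := by
    intro i j hi hj
    have h := (List.mem_append.1 (hT.2.1 (Sum.inr j))).resolve_left hj.2
    exact (List.pairwise_append.1 hT.2.2).2.2 _ hi.1 _ h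
  exact ⟨hij, Event.inter_nonempty (key i j hi hj) (key j i hj hi)⟩

/-- The invariant of the stack algorithm: the stack has no repetitions, and the colors `1, …, w`
are split into those on the stack and those of the open intervals, which are distinct. -/
structure StackInvariant (w : ℕ) (L : List (Event ι)) : Prop where
  nodup : (stackState w L).1.Nodup
  range : ∀ f ∈ (stackState w L).1, 1 ≤ f ∧ f ≤ w
  mem_or : ∀ f, 1 ≤ f → f ≤ w →
    f ∈ (stackState w L).1 ∨ ∃ i, OpenAt L i ∧ (stackState w L).2 i = f
  notMem : ∀ i, OpenAt L i → (stackState w L).2 i ∉ (stackState w L).1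
  inj : ∀ i j, OpenAt L i → OpenAt L j → (stackState w L).2 i = (stackState w L).2 j → i = j
  color_range : ∀ i, Sum.inl i ∈ L → 1 ≤ (stackState w L).2 i ∧ (stackState w L).2 i ≤ w

/-- There is a color for each interval: if the stack were empty at its left endpoint, then the `w`
open intervals and the new one would form a clique. -/
theorem stack_ne_nil [Fintype ι] {J : ι → RealInterval} {T : List (Event ι)}
    (hT : IsEventOrder J T) {w : ℕ}
    (hw : ∀ s : Finset ι, (overlapGraph J).IsClique (s : Set ι) → s.card ≤ w)
    {L : List (Event ι)} {i : ι} (hL : L ++ [Sum.inl i] <+: T) (hinv : StackInvariant w L) :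
    (stackState w L).1 ≠ [] := by
  classical
  intro hnil
  have hnd : (L ++ [Sum.inl i]).Nodup := hT.1.sublist hL.sublist
  have hiL : Sum.inl i ∉ L := by
    intro h
    exact (List.nodup_append.1 hnd).2.2 _ h _ (List.mem_singleton_self _) rfl
  have hLT : L <+: T := (List.prefix_append _ _).trans hL
  have hir : (Sum.inr i : Event ι) ∉ L := fun h => hiL (hT.inl_mem_of_inr hLT h)
  -- the open intervals, among them `i`, have all colors and form a clique
  have h1 : (Finset.Icc 1 w).card ≤ (Finset.univ.filter fun j => OpenAt L j).card := by
    refine Finset.card_le_card_of_surjOn (stackState w L).2 ?_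
    intro f hf
    have hf := Finset.mem_Icc.1 (Finset.mem_coe.1 hf)
    rcases hinv.mem_or f hf.1 hf.2 with h | ⟨j, hj, hjf⟩
    · rw [hnil] at h; simp at h
    · exact ⟨j, by simpa using hj, hjf⟩
  have h2 : (Finset.univ.filter fun j => OpenAt (L ++ [Sum.inl i]) j).card ≤ w := by
    apply hw
    have := hT.isClique_openAt hL
    simpa using this
  have h3 : insert i (Finset.univ.filter fun j => OpenAt L j) ⊆
      (Finset.univ.filter fun j => OpenAt (L ++ [Sum.inl i]) j) := by
    intro j hj
    rcases Finset.mem_insert.1 hj with rfl | hj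
    · simp [OpenAt, hir]
    · have hj := (Finset.mem_filter.1 hj).2
      simp [OpenAt, hj.1, hj.2]
  have h4 := Finset.card_le_card h3
  rw [Finset.card_insert_of_notMem (fun h => hiL (Finset.mem_filter.1 h).2.1)] at h4
  rw [Nat.card_Icc] at h1
  omega

theorem stackInvariant_of_prefix [Fintype ι] {J : ι → RealInterval} {T : List (Event ι)}
    (hT : IsEventOrder J T) {w : ℕ}
    (hw : ∀ s : Finset ι, (overlapGraph J).IsClique (s : Set ι) → s.card ≤ w)
    {L : List (Event ι)} : L <+: T → StackInvariant w L := by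
  classical
  induction L using List.reverseRecOn with
  | nil =>
    intro _
    refine ⟨?_, ?_, ?_, ?_, ?_, ?_⟩ <;>
      simp [stackState, OpenAt, List.nodup_range', List.mem_range'_1]
    all_goals intros; omega
  | append_singleton L e ih =>
    intro hL
    have hLT : L <+: T := (List.prefix_append _ _).trans hL
    have hinv := ih hLT
    have hnd : (L ++ [e]).Nodup := hT.1.sublist hL.sublist
    have heL : e ∉ L := fun h =>
      (List.nodup_append.1 hnd).2.2 _ h _ (List.mem_singleton_self _) rfl
    rcases e with i | i
    · have hne := stack_ne_nil hT hw hL hinv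
      have hir : (Sum.inr i : Event ι) ∉ L := fun h => heL (hT.inl_mem_of_inr hLT h)
      obtain ⟨f, S, hS⟩ := List.exists_cons_of_ne_nil hne
      have hst : stackState w (L ++ [Sum.inl i]) =
          (S, Function.update (stackState w L).2 i f) := by
        rw [stackState_concat]; simp [stackStep, hS]
      have hopen : ∀ j, OpenAt (L ++ [Sum.inl i]) j → j ≠ i → OpenAt L j := by
        intro j hj hji
        have h1 := hj.1
        have h2 := hj.2
        simp only [List.mem_append, List.mem_singleton, Sum.inl.injEq, hji, or_false] at h1
        exact ⟨h1, fun h => h2 (by simp [h])⟩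
      have h1 := hinv.nodup
      rw [hS, List.nodup_cons] at h1
      have hrange := hinv.range
      rw [hS] at hrange
      have hnm := hinv.notMem
      rw [hS] at hnm
      refine ⟨?_, ?_, ?_, ?_, ?_, ?_⟩ <;> rw [hst]
      · exact h1.2
      · exact fun g hg => hrange g (List.mem_cons_of_mem _ hg)
      · intro g hg1 hg2
        rcases hinv.mem_or g hg1 hg2 with h | ⟨j, hj, hjg⟩
        · rw [hS] at h
          rcases List.mem_cons.1 h with rfl | h
          · exact Or.inr ⟨i, ⟨by simp, by simp [hir]⟩, by simp⟩
          · exact Or.inl h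
        · refine Or.inr ⟨j, ⟨by simp [hj.1], by simp [hj.2]⟩, ?_⟩
          have : j ≠ i := by rintro rfl; exact heL hj.1
          simp [this, hjg]
      · intro j hj
        by_cases hji : j = i
        · subst hji; simpa using h1.1
        · simp only [Function.update_of_ne hji]
          exact fun h => hnm j (hopen j hj hji) (List.mem_cons_of_mem _ h)
      · intro j k hj hk hjk
        by_cases hji : j = i <;> by_cases hki : k = i
        · rw [hji, hki]
        · subst hji
          simp only [Function.update_self, Function.update_of_ne hki] at hjk
          exact absurd (by rw [← hjk]; exact List.mem_cons_self) (hnm k (hopen k hk hki))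
        · subst hki
          simp only [Function.update_self, Function.update_of_ne hji] at hjk
          exact absurd (by rw [hjk]; exact List.mem_cons_self) (hnm j (hopen j hj hji))
        · simp only [Function.update_of_ne hji, Function.update_of_ne hki] at hjk
          exact hinv.inj j k (hopen j hj hji) (hopen k hk hki) hjk
      · intro j hj
        by_cases hji : j = i
        · subst hji; simpa using hrange f List.mem_cons_self
        · simp only [Function.update_of_ne hji]
          refine hinv.color_range j ?_
          simpa [hji] using hj
    · have hil : Sum.inl i ∈ L := by
        have := hT.inl_mem_of_inr hL (i := i) (by simp)
        simpa using this
      have hio : OpenAt L i := ⟨hil, heL⟩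
      have hst : stackState w (L ++ [Sum.inr i]) =
          ((stackState w L).2 i :: (stackState w L).1, (stackState w L).2) := by
        rw [stackState_concat]; rfl
      have hopen : ∀ j, OpenAt (L ++ [Sum.inr i]) j → OpenAt L j ∧ j ≠ i := by
        intro j hj
        refine ⟨⟨by simpa using hj.1, fun h => hj.2 (by simp [h])⟩, ?_⟩
        rintro rfl
        exact hj.2 (by simp)
      refine ⟨?_, ?_, ?_, ?_, ?_, ?_⟩ <;> rw [hst]
      · exact List.nodup_cons.2 ⟨hinv.notMem i hio, hinv.nodup⟩
      · intro f hf
        rcases List.mem_cons.1 hf with rfl | hf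
        · exact hinv.color_range i hil
        · exact hinv.range f hf
      · intro f hf1 hf2
        rcases hinv.mem_or f hf1 hf2 with h | ⟨j, hj, hjf⟩
        · exact Or.inl (List.mem_cons_of_mem _ h)
        · by_cases hji : j = i
          · subst hji; exact Or.inl (by simp [hjf])
          · exact Or.inr ⟨j, ⟨by simp [hj.1], by simp [hj.2, hji]⟩, hjf⟩
      · intro j hj h
        rcases List.mem_cons.1 h with h | h
        · exact (hopen j hj).2 (hinv.inj _ _ (hopen j hj).1 hio h)
        · exact hinv.notMem j (hopen j hj).1 h
      · intro j k hj hk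
        exact hinv.inj j k (hopen j hj).1 (hopen k hk).1
      · intro j hj
        exact hinv.color_range j (by simpa using hj)

theorem foldl_stackStep_snd_of_notMem (M : List (Event ι)) (s : List ℕ × (ι → ℕ)) {i : ι}
    (hi : Sum.inl i ∉ M) : (M.foldl stackStep s).2 i = s.2 i := by
  induction M generalizing s with
  | nil => rfl
  | cons e M ih =>
    rw [List.foldl_cons, ih _ (fun h => hi (List.mem_cons_of_mem _ h))]
    rcases e with j | j
    · have : i ≠ j := by rintro rfl; exact hi List.mem_cons_self
      simp [stackStep, this]
    · rfl

/-- The color of an interval does not change after its left endpoint. -/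
theorem stackColoring_eq_of_prefix {T L : List (Event ι)} (hT : T.Nodup) (hL : L <+: T) (w : ℕ)
    {i : ι} (hi : Sum.inl i ∈ L) : stackColoring T w i = (stackState w L).2 i := by
  obtain ⟨R, rfl⟩ := hL
  have : Sum.inl i ∉ R := fun h => (List.nodup_append.1 hT).2.2 _ hi _ h rfl
  rw [stackColoring, List.foldl_append, foldl_stackStep_snd_of_notMem _ _ this]
  rfl

/-- What is used of the stack algorithm: `c` is the coloring, `st L` is the stack after the
events in `L`. -/
structure StackRun (T : List (Event ι)) (w : ℕ) (c : ι → ℕ) (st : List (Event ι) → List ℕ) :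
    Prop where
  mem_or : ∀ L, L <+: T → ∀ f, 1 ≤ f → f ≤ w → f ∈ st L ∨ ∃ i, OpenAt L i ∧ c i = f
  notMem : ∀ L, L <+: T → ∀ i, OpenAt L i → c i ∉ st L
  inj : ∀ L, L <+: T → ∀ i j, OpenAt L i → OpenAt L j → c i = c j → i = j
  color_range : ∀ i, 1 ≤ c i ∧ c i ≤ w
  pop : ∀ L i, L ++ [Sum.inl i] <+: T → st L = c i :: st (L ++ [Sum.inl i])
  push : ∀ L i, L ++ [Sum.inr i] <+: T → st (L ++ [Sum.inr i]) = c i :: st L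

theorem stackRun [Fintype ι] {J : ι → RealInterval} {T : List (Event ι)}
    (hT : IsEventOrder J T) {w : ℕ}
    (hw : ∀ s : Finset ι, (overlapGraph J).IsClique (s : Set ι) → s.card ≤ w) :
    StackRun T w (stackColoring T w) fun L => (stackState w L).1 := by
  have hinv : ∀ {L : List (Event ι)}, L <+: T → StackInvariant w L :=
    fun hL => stackInvariant_of_prefix hT hw hL
  refine ⟨fun L hL f h1 h2 => ?_, fun L hL i hi => ?_, fun L hL i j hi hj h => ?_,
    fun i => ?_, fun L i hL => ?_, fun L i hL => ?_⟩
  · rcases (hinv hL).mem_or f h1 h2 with h | ⟨i, hi, hif⟩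
    · exact Or.inl h
    · exact Or.inr ⟨i, hi, by rw [stackColoring_eq_of_prefix hT.1 hL w hi.1, hif]⟩
  · rw [stackColoring_eq_of_prefix hT.1 hL w hi.1]
    exact (hinv hL).notMem i hi
  · rw [stackColoring_eq_of_prefix hT.1 hL w hi.1,
      stackColoring_eq_of_prefix hT.1 hL w hj.1] at h
    exact (hinv hL).inj i j hi hj h
  · exact (hinv (List.prefix_refl T)).color_range i (hT.2.1 _)
  · have hne := stack_ne_nil hT hw hL (hinv ((List.prefix_append _ _).trans hL))
    obtain ⟨f, S, hS⟩ := List.exists_cons_of_ne_nil hne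
    rw [stackColoring_eq_of_prefix hT.1 hL w (by simp), stackState_concat]
    simp [stackStep, hS]
  · have hil : Sum.inl i ∈ L := by
      have := hT.inl_mem_of_inr hL (i := i) (by simp)
      simpa using this
    rw [stackColoring_eq_of_prefix hT.1 ((List.prefix_append _ _).trans hL) w hil,
      stackState_concat]
    rfl

/-! ### The first and the last event in a region -/

theorem prefix_of_notMem {α : Type} {L W Z : List α} {e : α} (hL : L <+: W ++ e :: Z)
    (he : e ∉ L) : L <+: W := by
  have h1 : W ++ [e] <+: W ++ e :: Z := ⟨Z, by simp⟩
  rcases List.prefix_or_prefix_of_prefix hL h1 with h | h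
  · rcases List.prefix_concat_iff.1 h with rfl | h
    · exact absurd (by simp) he
    · exact h
  · exact absurd (h.subset (by simp)) he

theorem prefix_of_mem {α : Type} {L W Z : List α} {e : α} (hnd : (W ++ e :: Z).Nodup)
    (hL : L <+: W ++ e :: Z) (he : e ∈ L) : W ++ [e] <+: L := by
  have h1 : W ++ [e] <+: W ++ e :: Z := ⟨Z, by simp⟩
  rcases List.prefix_or_prefix_of_prefix hL h1 with h | h
  · rcases List.prefix_concat_iff.1 h with rfl | h
    · exact List.prefix_refl _
    · exact absurd rfl ((List.nodup_append.1 hnd).2.2 _ (h.subset he) _ List.mem_cons_self)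
  · exact h

theorem filter_prefix_of_pairwise {α : Type} {r : α → α → Prop} {p : α → Bool} {T : List α}
    (hT : T.Pairwise r) (hp : ∀ e e', r e e' → p e' = true → p e = true) :
    T.filter p <+: T := by
  induction T with
  | nil => simp
  | cons e T ih =>
    rw [List.pairwise_cons] at hT
    by_cases he : p e = true
    · rw [List.filter_cons_of_pos he]
      exact (List.prefix_cons_inj e).2 (ih hT.2)
    · rw [List.filter_cons_of_neg he]
      have : T.filter p = [] := by
        rw [List.filter_eq_nil_iff]
        exact fun e' he' h => he (hp e e' (hT.1 e' he') h)
      rw [this]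
      exact List.nil_prefix

open scoped Classical in
/-- The events before a point. -/
noncomputable def eventsBefore (J : ι → RealInterval) (T : List (Event ι)) (x : ℝ) :
    List (Event ι) :=
  T.filter fun e => decide (Event.Before J x e)

section

variable {J : ι → RealInterval} {T : List (Event ι)} (hT : IsEventOrder J T)
include hT

theorem IsEventOrder.eventsBefore_prefix (x : ℝ) : eventsBefore J T x <+: T := by
  apply filter_prefix_of_pairwise hT.2.2
  intro e e' h h'
  simp only [decide_eq_true_eq] at h' ⊢
  exact h'.mono h

theorem IsEventOrder.mem_eventsBefore {x : ℝ} {e : Event ι} :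
    e ∈ eventsBefore J T x ↔ Event.Before J x e := by
  simp [eventsBefore, hT.2.1 e]

theorem IsEventOrder.openAt_eventsBefore {x : ℝ} {i : ι} :
    OpenAt (eventsBefore J T x) i ↔ x ∈ (J i).pts := by
  rw [OpenAt, hT.mem_eventsBefore, hT.mem_eventsBefore, Event.mem_pts_iff]

theorem IsEventOrder.position_le {L : List (Event ι)} (hL : L <+: T) {e e' : Event ι}
    (he : e ∈ L) (he' : e' ∉ L) : e.position J ≤ e'.position J := by
  obtain ⟨R, rfl⟩ := hL
  exact (List.pairwise_append.1 hT.2.2).2.2 _ he _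
    ((List.mem_append.1 (hT.2.1 e')).resolve_left he')

end

/-- Suppose that `g` is the deepest color of `F` on the stack, that no color of `F` is on the stack
after the events in `N`, and that this situation does not occur earlier unless no further event in
`N` belongs to an interval with a color of `F`.  Then the last event in `N` of such an interval
is a left endpoint at which `g` is popped, and until then `g` remains on the stack. -/
theorem StackRun.exists_pop_of_deepest {T : List (Event ι)} {w : ℕ} {c : ι → ℕ}
    {st : List (Event ι) → List ℕ} (hS : StackRun T w c st) {F : Finset ℕ} {g : ℕ} (hg : g ∈ F)
    {N : List (Event ι)} : ∀ {L : List (Event ι)} {X Y : List ℕ}, L ++ N <+: T →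
      st L = X ++ g :: Y → (∀ y ∈ Y, y ∉ F) → (∀ f ∈ F, f ∉ st (L ++ N)) →
      (∀ N' N'', N = N' ++ N'' → (∀ f ∈ F, f ∉ st (L ++ N')) →
        ∀ e : Event ι, e ∈ N'' → c e.owner ∉ F) →
      ∃ N₁ j N₂, N = N₁ ++ Sum.inl j :: N₂ ∧ c j = g ∧
        (∀ e : Event ι, e ∈ N₂ → c e.owner ∉ F) ∧ ∀ N', N' <+: N₁ → g ∈ st (L ++ N') := by
  induction N with
  | nil =>
    intro L X Y _ hst _ hno _
    exact absurd (by rw [List.append_nil, hst]; simp) (hno g hg)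
  | cons e N ih =>
    intro L X Y hL hst hY hno H
    have hLe : L ++ [e] <+: T := (List.prefix_append _ N).trans (by simpa using hL)
    have hmem : g ∈ st L := by rw [hst]; simp
    -- if `g` stays on the stack, the induction hypothesis applies
    have step : ∀ X', st (L ++ [e]) = X' ++ g :: Y →
        ∃ N₁ j N₂, e :: N = N₁ ++ Sum.inl j :: N₂ ∧ c j = g ∧
          (∀ e : Event ι, e ∈ N₂ → c e.owner ∉ F) ∧ ∀ N', N' <+: N₁ → g ∈ st (L ++ N') := by
      intro X' hX'
      obtain ⟨N₁, j, N₂, h1, h2, h3, h4⟩ := ih (L := L ++ [e]) (by simpa using hL) hX' hY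
        (by simpa using hno) (by
          intro N' N'' hN
          have := H (e :: N') N'' (by rw [hN]; rfl)
          simpa using this)
      refine ⟨e :: N₁, j, N₂, by rw [h1]; rfl, h2, h3, ?_⟩
      intro N' hN'
      cases N' with
      | nil => simpa using hmem
      | cons e' N' =>
        obtain ⟨rfl, h5⟩ := List.cons_prefix_cons.1 hN'
        simpa using h4 N' h5
    rcases e with i | i
    · have hpop := hS.pop L i hLe
      cases X with
      | nil =>
        rw [hst, List.nil_append, List.cons.injEq] at hpop
        refine ⟨[], i, N, rfl, hpop.1.symm, ?_, ?_⟩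
        · refine H [Sum.inl i] N rfl ?_
          rw [← hpop.2]
          exact fun f hf h => hY f h hf
        · intro N' hN'
          rw [List.prefix_nil.1 hN']
          simpa using hmem
      | cons x X =>
        rw [hst, List.cons_append, List.cons.injEq] at hpop
        exact step X hpop.2.symm
    · exact step (c i :: X) (by rw [hS.push L i hLe, hst]; rfl)

open scoped Classical in
/-- Let `F` be a set of colors all of which are used by first-batch intervals at `a` and at `b`,
and suppose that the clique points of the maximal cliques with at least `|F|` members are not
strictly between `a` and `b`.  Then the first event between `a` and `b` that belongs to an interval
with a color of `F` is a right endpoint, the last such event is a left endpoint, both intervals have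
the same color, no other interval meeting `[a, b]` has this color, and the color is not used by
first-batch intervals at points of `[a, b]` contained in less than `|F|` of them.

The reason is that the color pushed by the first event is the deepest color of `F` on the stack
until the stack contains no color of `F` again, and then `|F|` intervals are open, which form a
clique. -/
theorem exists_extreme_intervals [Fintype ι] {J : ι → RealInterval} {T : List (Event ι)} {w : ℕ}
    {c : ι → ℕ} {st : List (Event ι) → List ℕ} (hT : IsEventOrder J T) (hS : StackRun T w c st)
    {cp : Finset ι → ℝ} (hcp : ∀ C, IsMaximalClique J C → ∀ i ∈ C, cp C ∈ (J i).pts)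
    {F : Finset ℕ} (hF : ∀ f ∈ F, 1 ≤ f ∧ f ≤ w) {a b x₀ : ℝ} (ha₀ : a ≤ x₀) (hb₀ : x₀ ≤ b)
    (hx₀ : (Finset.univ.filter fun i => x₀ ∈ (J i).pts).card < F.card)
    (hFa : ∀ f ∈ F, ∃ i, c i = f ∧ a ∈ (J i).pts) (hFb : ∀ f ∈ F, ∃ i, c i = f ∧ b ∈ (J i).pts)
    (hclique : ∀ C, IsMaximalClique J C → F.card ≤ C.card → cp C ≤ a ∨ b ≤ cp C)
    {E : List (Event ι)}
    (hE : E = T.filter fun e =>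
      decide (¬ Event.Before J a e ∧ Event.Before J b e ∧ c e.owner ∈ F)) :
    ∃ j j', E.head? = some (Sum.inr j) ∧ E.getLast? = some (Sum.inl j') ∧ c j ∈ F ∧ c j' = c j ∧
      (∀ i, (∃ x ∈ (J i).pts, a ≤ x ∧ x ≤ b) → c i = c j → i = j ∨ i = j') ∧
      ∀ x, a ≤ x → x ≤ b → (Finset.univ.filter fun i => x ∈ (J i).pts).card < F.card →
        ∀ i, x ∈ (J i).pts → c i ≠ c j := by
  have hA := hT.eventsBefore_prefix a
  have hB := hT.eventsBefore_prefix b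
  have inj_at : ∀ x i i', x ∈ (J i).pts → x ∈ (J i').pts → c i = c i' → i = i' :=
    fun x i i' hi hi' => hS.inj _ (hT.eventsBefore_prefix x) i i'
      (hT.openAt_eventsBefore.2 hi) (hT.openAt_eventsBefore.2 hi')
  -- a point whose intervals have all colors of `F` is in at least `|F|` intervals
  have hcount : ∀ x, (∀ f ∈ F, ∃ i, c i = f ∧ x ∈ (J i).pts) →
      F.card ≤ (Finset.univ.filter fun i => x ∈ (J i).pts).card := by
    intro x hx
    refine Finset.card_le_card_of_surjOn c ?_
    intro f hf
    obtain ⟨i, hi, hxi⟩ := hx f hf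
    exact ⟨i, by simpa using hxi, hi⟩
  -- hence, at a point of small depth, an interval at `a` with a color of `F` has already ended
  have hcountA : ∀ x, a ≤ x → x ≤ b →
      (Finset.univ.filter fun i => x ∈ (J i).pts).card < F.card →
      ∃ e, Event.Before J x e ∧ ¬ Event.Before J a e ∧ c e.owner ∈ F := by
    intro x hax hxb hx
    by_contra! hcon
    refine hx.not_ge (hcount x fun f hf => ?_)
    obtain ⟨i, hi, hia⟩ := hFa f hf
    refine ⟨i, hi, ?_⟩
    rw [Event.mem_pts_iff] at hia ⊢
    exact ⟨hia.1.trans_le hax, fun h => hcon (Sum.inr i) h hia.2 (by rw [← hi] at hf; exact hf)⟩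
  -- and an interval at `b` with a color of `F` has not yet begun
  have hcountB : ∀ x, a ≤ x → x ≤ b →
      (Finset.univ.filter fun i => x ∈ (J i).pts).card < F.card →
      ∃ e, ¬ Event.Before J x e ∧ Event.Before J b e ∧ c e.owner ∈ F := by
    intro x hax hxb hx
    by_contra! hcon
    refine hx.not_ge (hcount x fun f hf => ?_)
    obtain ⟨i, hi, hib⟩ := hFb f hf
    refine ⟨i, hi, ?_⟩
    rw [Event.mem_pts_iff] at hib ⊢
    refine ⟨?_, fun h => hib.2 (h.trans_le hxb)⟩
    by_contra h
    exact hcon (Sum.inl i) h hib.1 (by rw [← hi] at hf; exact hf)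
  set q : Event ι → Prop := fun e =>
    ¬ Event.Before J a e ∧ Event.Before J b e ∧ c e.owner ∈ F with hq
  -- the first event
  obtain ⟨e₀, he₀⟩ : ∃ e₀, E.head? = some e₀ := by
    obtain ⟨e, h1, h2, h3⟩ := hcountA x₀ ha₀ hb₀ hx₀
    have : e ∈ E := by
      rw [hE, List.mem_filter]
      exact ⟨hT.2.1 e, by simpa [hq] using ⟨h2, h1.trans_le hb₀, h3⟩⟩
    exact ⟨E.head (List.ne_nil_of_mem this), List.head?_eq_some_head _⟩
  have he₀' := he₀
  rw [hE, List.head?_filter, List.find?_eq_some_iff_append] at he₀'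
  obtain ⟨hq₀, U, V, hTU, hU⟩ := he₀'
  have hq₀ : q e₀ := by simpa using hq₀
  have hU : ∀ e ∈ U, ¬ q e := fun e he => by
    simpa only [Bool.not_eq_true', decide_eq_false_iff_not] using hU e he
  have hUT : U <+: T := ⟨_, hTU.symm⟩
  have hUe : U ++ [e₀] <+: T := ⟨V, by rw [hTU]; simp⟩
  have hnd : (U ++ e₀ :: V).Nodup := hTU ▸ hT.1
  have he₀U : e₀ ∉ U := fun h => (List.nodup_append.1 hnd).2.2 _ h _ List.mem_cons_self rfl
  -- the intervals at `a` with a color of `F` are still open before the first event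
  have hopenU : ∀ i, a ∈ (J i).pts → c i ∈ F → OpenAt U i := by
    intro i hi hf
    rw [Event.mem_pts_iff] at hi
    constructor
    · by_contra h
      rw [hTU] at hT hUT
      rcases List.mem_append.1 (hT.2.1 (Sum.inl i)) with h1 | h1
      · exact h h1
      · rcases List.mem_cons.1 h1 with h1 | h1
        · exact hq₀.1 (h1 ▸ hi.1)
        · exact hq₀.1 (hi.1.mono ((List.pairwise_cons.1
            (List.pairwise_append.1 hT.2.2).2.1).1 _ h1))
    · intro h
      refine hU _ h ⟨hi.2, hq₀.2.1.mono (hT.position_le hUT h he₀U), hf⟩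
  -- so no color of `F` is on the stack, and the first event cannot be a left endpoint
  have hnoU : ∀ f ∈ F, f ∉ st U := by
    intro f hf
    obtain ⟨i, rfl, hia⟩ := hFa f hf
    exact hS.notMem U hUT i (hopenU i hia hf)
  obtain ⟨j, rfl⟩ : ∃ j, e₀ = Sum.inr j := by
    rcases e₀ with j | j
    · refine absurd ?_ (hnoU (c j) hq₀.2.2)
      rw [hS.pop U j hUe]
      exact List.mem_cons_self
    · exact ⟨j, rfl⟩
  have hjF : c j ∈ F := hq₀.2.2
  have hja : a ∈ (J j).pts := by
    obtain ⟨i, hi, hia⟩ := hFa (c j) hjF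
    have h1 : OpenAt U j := by
      refine ⟨?_, he₀U⟩
      simpa using hT.inl_mem_of_inr hUe (i := j) (by simp)
    rw [← hS.inj U hUT i j (hopenU i hia (hi ▸ hjF)) h1 hi]
    exact hia
  have hnoB : ∀ f ∈ F, f ∉ st (eventsBefore J T b) := by
    intro f hf
    obtain ⟨i, rfl, hib⟩ := hFb f hf
    exact hS.notMem _ hB i (hT.openAt_eventsBefore.2 hib)
  -- once there is no color of `F` on the stack, there are no more events
  have H : ∀ L, L <+: T → Sum.inr j ∈ L → (∀ e ∈ L, Event.Before J b e) → (∀ f ∈ F, f ∉ st L) →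
      ∀ e, Event.Before J b e → c e.owner ∈ F → e ∈ L := by
    intro L hL hjL hLb hno
    have hact : ∀ f ∈ F, ∃ i, OpenAt L i ∧ c i = f := by
      intro f hf
      exact (hS.mem_or L hL f (hF f hf).1 (hF f hf).2).resolve_left (hno f hf)
    obtain ⟨C, hC, hsub⟩ := exists_isMaximalClique_superset (J := J)
      (s := Finset.univ.filter (OpenAt L)) (by simpa using hT.isClique_openAt hL)
    have hcard : F.card ≤ C.card := by
      refine le_trans ?_ (Finset.card_le_card hsub)
      refine Finset.card_le_card_of_surjOn c ?_
      intro f hf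
      obtain ⟨i, hi, hif⟩ := hact f hf
      exact ⟨i, by simpa using hi, hif⟩
    have hcpo : ∀ i, OpenAt L i → cp C ∈ (J i).pts :=
      fun i hi => hcp C hC i (hsub (by simpa using hi))
    rcases hclique C hC hcard with hy | hy
    · -- the clique point is not to the left of `a`, since the interval of the first event has ended
      exfalso
      obtain ⟨i, hi, hij⟩ := hact (c j) hjF
      have hia : a ∈ (J i).pts := by
        rw [Event.mem_pts_iff, Event.before_inl]
        exact ⟨⟨_, hcpo i hi, hy⟩, fun h => hq₀.1 (h.mono (hT.position_le hL hjL hi.2))⟩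
      have := inj_at a i j hia hja hij
      subst this
      exact hi.2 hjL
    · -- the clique point is to the right of `b`, so that the open intervals extend beyond `b`
      intro e heb heF
      by_contra heL
      obtain ⟨i', hi', hii'⟩ := hact _ heF
      have hib : b ∈ (J i').pts := by
        rw [Event.mem_pts_iff]
        refine ⟨hLb _ hi'.1, ?_⟩
        rw [Event.before_inr]
        exact fun h => (h _ (hcpo i' hi')).not_ge hy
      -- the interval of a further event would be new, but its color is in use up to `b`
      have hnew : ∀ i, Sum.inl i ∉ L → Event.Before J b (Sum.inl i) → c i' ≠ c i := by
        intro i hiL hib' hcc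
        obtain ⟨L', R, hLR⟩ := List.append_of_mem (hT.2.1 (Sum.inl i))
        have hL1 : L' ++ [Sum.inl i] <+: T := ⟨R, by rw [hLR]; simp⟩
        have hLL' : L <+: L' := prefix_of_notMem (hLR ▸ hL) hiL
        have h1 : OpenAt (L' ++ [Sum.inl i]) i := by
          refine ⟨by simp, fun h => ?_⟩
          have h2 : Sum.inl i ∈ L' :=
            hT.inl_mem_of_inr ((List.prefix_append _ _).trans hL1) (by simpa using h)
          exact (List.nodup_append.1 (hLR ▸ hT.1)).2.2 _ h2 _ List.mem_cons_self rfl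
        have h2 : OpenAt (L' ++ [Sum.inl i]) i' := by
          refine ⟨by simp [hLL'.subset hi'.1], fun h => ?_⟩
          have h3 : Sum.inr i' ∈ L' := by simpa using h
          refine (Event.mem_pts_iff.1 hib).2 (hib'.mono ?_)
          refine hT.position_le ((List.prefix_append _ _).trans hL1) h3 fun h4 => ?_
          exact (List.nodup_append.1 (hLR ▸ hT.1)).2.2 _ h4 _ List.mem_cons_self rfl
        have := hS.inj _ hL1 _ _ h2 h1 hcc
        exact hiL (this ▸ hi'.1)
      rcases e with i | i
      · exact hnew i heL heb hii'
      · by_cases hil : Sum.inl i ∈ L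
        · have := hS.inj L hL i' i hi' ⟨hil, heL⟩ hii'
          subst this
          exact (Event.mem_pts_iff.1 hib).2 heb
        · exact hnew i hil (heb.mono (Event.position_inl_lt_inr J i).le) hii'
  obtain ⟨N, hN⟩ : U ++ [Sum.inr j] <+: eventsBefore J T b :=
    prefix_of_mem hnd (hTU ▸ hB) (hT.mem_eventsBefore.2 hq₀.2.1)
  obtain ⟨N₁, j', N₂, hN12, hcj', hN₂, hdeep⟩ := hS.exists_pop_of_deepest (F := F) (g := c j) hjF
    (N := N) (L := U ++ [Sum.inr j]) (X := []) (Y := st U) (hN ▸ hB)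
    (by rw [hS.push U j hUe]; rfl) (fun y hy hyF => hnoU y hyF hy) (by rw [hN]; exact hnoB) (by
      intro N' N'' hNN hno e he heF
      have hp : U ++ [Sum.inr j] ++ N' <+: eventsBefore J T b := by
        rw [← hN, hNN]; exact ⟨N'', by simp⟩
      have hbe : Event.Before J b e := by
        rw [← hT.mem_eventsBefore, ← hN, hNN]; simp [he]
      have h1 := H _ (hp.trans hB) (by simp) (fun e he => hT.mem_eventsBefore.1 (hp.subset he))
        hno e hbe heF
      have h2 : (eventsBefore J T b).Nodup := hT.1.sublist hB.sublist
      rw [← hN, hNN, ← List.append_assoc] at h2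
      exact (List.nodup_append.1 h2).2.2 _ h1 _ he rfl)
  obtain ⟨B', hB'⟩ := hB
  have hTW : T = (U ++ Sum.inr j :: N₁) ++ Sum.inl j' :: (N₂ ++ B') := by
    rw [← hB', ← hN, hN12]; simp
  have hnd' := hTW ▸ hT.1
  have hndB : (eventsBefore J T b ++ B').Nodup := by rw [hB']; exact hT.1
  have hqj' : q (Sum.inl j') := by
    refine ⟨fun h => hq₀.1 (h.mono (hT.position_le hUe (by simp) ?_)), ?_, ?_⟩
    · intro h
      have h3 : Sum.inl j' ∈ U ++ Sum.inr j :: N₁ := by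
        rcases List.mem_append.1 h with h | h
        · simp [h]
        · simp at h
      exact (List.nodup_append.1 hnd').2.2 _ h3 _ List.mem_cons_self rfl
    · rw [← hT.mem_eventsBefore, ← hN, hN12]; simp
    · show c j' ∈ F
      rw [hcj']; exact hjF
  have hZ : ∀ e ∈ N₂ ++ B', ¬ q e := by
    intro e he hqe
    rcases List.mem_append.1 he with h | h
    · exact hN₂ e h hqe.2.2
    · exact (List.nodup_append.1 hndB).2.2 _ (hT.mem_eventsBefore.2 hqe.2.1) _ h rfl
  -- between the first and the last event, the common color of their intervals is on the stack
  have hmem : ∀ L, L <+: T → Sum.inr j ∈ L → Sum.inl j' ∉ L → c j ∈ st L := by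
    intro L hL h1 h2
    obtain ⟨N', rfl⟩ := prefix_of_mem hnd (hTU ▸ hL) h1
    have h3 : U ++ [Sum.inr j] ++ N' <+: U ++ [Sum.inr j] ++ N₁ := by
      have h4 := prefix_of_notMem (hTW ▸ hL) h2
      rwa [show U ++ Sum.inr j :: N₁ = U ++ [Sum.inr j] ++ N₁ by simp] at h4
    exact hdeep N' ((List.prefix_append_right_inj _).1 h3)
  refine ⟨j, j', he₀, ?_, hjF, hcj', ?_, ?_⟩
  · rw [hE, hTW, List.filter_append, List.filter_cons_of_pos (by simpa using hqj'),
      (List.filter_eq_nil_iff (l := N₂ ++ B')).2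
        (fun e he => by simpa only [decide_eq_true_eq] using hZ e he)]
    simp
  · rintro i ⟨x, hxi, hax, hxb⟩ hij
    by_cases hia : a ∈ (J i).pts
    · exact Or.inl (inj_at a i j hia hja hij)
    refine Or.inr ?_
    have hqi : q (Sum.inl i) := by
      refine ⟨fun h => hia ?_, Event.before_inl.2 ⟨x, hxi, hxb⟩, by
        show c i ∈ F
        rw [hij]; exact hjF⟩
      rw [Event.mem_pts_iff]
      exact ⟨h, fun h1 => (Event.before_inr.1 h1 x hxi).not_ge hax⟩
    by_contra hne
    obtain ⟨L', R, hLR⟩ := List.append_of_mem (hT.2.1 (Sum.inl i))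
    have hL1 : L' ++ [Sum.inl i] <+: T := ⟨R, by rw [hLR]; simp⟩
    have h1 : Sum.inr j ∈ L' ++ [Sum.inl i] := by
      by_contra h
      exact hU _ ((prefix_of_notMem (hTU ▸ hL1) h).subset (by simp)) hqi
    have h2 : Sum.inl j' ∉ L' ++ [Sum.inl i] := by
      intro h
      rcases List.prefix_concat_iff.1 (prefix_of_mem hnd' (hTW ▸ hL1) h) with h3 | ⟨K, hK⟩
      · have := (List.append_inj' h3 rfl).2
        simp at this
        exact hne this.symm
      · have h4 : (U ++ Sum.inr j :: N₁) ++ Sum.inl j' :: (N₂ ++ B') =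
            (U ++ Sum.inr j :: N₁) ++ Sum.inl j' :: (K ++ Sum.inl i :: R) := by
          rw [← hTW, hLR, ← hK]; simp
        have h5 := List.append_cancel_left h4
        rw [List.cons.injEq] at h5
        exact hZ (Sum.inl i) (by rw [h5.2]; simp) hqi
    refine hS.notMem _ hL1 i ⟨by simp, fun h => ?_⟩ (hij ▸ hmem _ hL1 h1 h2)
    have h3 : Sum.inl i ∈ L' :=
      hT.inl_mem_of_inr ((List.prefix_append _ _).trans hL1) (by simpa using h)
    exact (List.nodup_append.1 (hLR ▸ hT.1)).2.2 _ h3 _ List.mem_cons_self rfl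
  · intro x hax hxb hx i hxi hij
    have hX := hT.eventsBefore_prefix x
    have hX1 : eventsBefore J T x <+: U ++ Sum.inr j :: V := by rw [← hTU]; exact hX
    have hX2 : eventsBefore J T x <+: (U ++ Sum.inr j :: N₁) ++ Sum.inl j' :: (N₂ ++ B') := by
      rw [← hTW]; exact hX
    refine hS.notMem _ hX i (hT.openAt_eventsBefore.2 hxi) (hij ▸ hmem _ hX ?_ ?_)
    · by_contra h
      obtain ⟨e, h1, h2, h3⟩ := hcountA x hax hxb hx
      exact hU e ((prefix_of_notMem hX1 h).subset (hT.mem_eventsBefore.2 h1))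
        ⟨h2, h1.trans_le hxb, h3⟩
    · intro h
      obtain ⟨e, h1, h2, h3⟩ := hcountB x hax hxb hx
      have hqe : q e := ⟨fun h4 => h1 (h4.trans_le hax), h2, h3⟩
      have heT := hT.2.1 e
      rw [hTW] at heT
      have hpre := prefix_of_mem hnd' hX2 h
      rcases List.mem_append.1 heT with h4 | h4
      · exact h1 (hT.mem_eventsBefore.1 (hpre.subset (by simp at h4 ⊢; tauto)))
      · rcases List.mem_cons.1 h4 with h4 | h4
        · exact h1 (hT.mem_eventsBefore.1 (h4 ▸ h))
        · exact hZ e h4 hqe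

/-! ### Creation of chains -/

/-- The chains of the region partition the intervals with property `A` into independent sets. -/
structure ChainFamily (K : κ → RealInterval) (R : Region ι κ) (A : κ → Prop) : Prop where
  mem_iff : ∀ k, A k ↔ ∃ l ∈ R.labels, k ∈ R.chain l
  disjoint : ∀ l ∈ R.labels, ∀ l' ∈ R.labels, ∀ k, k ∈ R.chain l → k ∈ R.chain l' → l = l'
  indep : ∀ l ∈ R.labels, ∀ k ∈ R.chain l, ∀ k' ∈ R.chain l, ¬ (overlapGraph K).Adj k k'

open scoped Classical in
/-- A crossover transposes the two labels for the intervals to the right of `q`. -/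
theorem mem_crossover_chain {K : κ → RealInterval} {R : Region ι κ} {a b : ℕ} {q : ℝ}
    (hab : a ≠ b) {l : ℕ} {k : κ} : k ∈ (crossover K R a b q).chain l ↔
      k ∈ R.chain (if ∀ x ∈ (K k).pts, q < x then Equiv.swap a b l else l) := by
  by_cases hr : ∀ x ∈ (K k).pts, q < x
  · have hn : ¬ ∃ x ∈ (K k).pts, x ≤ q := by push Not; exact hr
    rw [if_pos hr]
    by_cases hlb : l = b
    · subst hlb
      simp [crossover]
      exact ⟨fun h => h.elim (fun h => absurd (h.2 h.1) hn) And.left, fun h => Or.inr ⟨h, hr⟩⟩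
    · by_cases hla : l = a
      · subst hla
        simp [crossover, hab]
        exact ⟨fun h => h.elim (fun h => absurd (h.2 h.1) hn) And.left, fun h => Or.inr ⟨h, hr⟩⟩
      · simp [crossover, hla, hlb, Equiv.swap_apply_of_ne_of_ne]
  · rw [if_neg hr]
    by_cases hlb : l = b
    · subst hlb
      simp [crossover, hr]
    · by_cases hla : l = a
      · subst hla
        simp [crossover, hr, hab]
      · simp [crossover, hla, hlb]

theorem swap_mem {s : Finset ℕ} {a b l : ℕ} (ha : a ∈ s) (hb : b ∈ s) (hl : l ∈ s) :
    Equiv.swap a b l ∈ s := by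
  rw [Equiv.swap_apply_def]
  split_ifs <;> assumption

/-- A crossover at a point that both chains avoid preserves the partition into independent sets. -/
theorem ChainFamily.crossover {K : κ → RealInterval} {R : Region ι κ} {A : κ → Prop}
    (h : ChainFamily K R A) {a b : ℕ} {q : ℝ} (ha : a ∈ R.labels) (hb : b ∈ R.labels)
    (hab : a ≠ b) (hqa : ¬ Contains K (R.chain a) q) (hqb : ¬ Contains K (R.chain b) q) :
    ChainFamily K (crossover K R a b q) A := by
  have hlab : (BatchColoring.crossover K R a b q).labels = R.labels := rfl
  refine ⟨fun k => ?_, fun l hl l' hl' k hk hk' => ?_, fun l hl k hk k' hk' hadj => ?_⟩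
  · rw [h.mem_iff, hlab]
    simp only [mem_crossover_chain hab]
    split_ifs
    · constructor
      · rintro ⟨l, hl, hk⟩
        exact ⟨Equiv.swap a b l, swap_mem ha hb hl, by simpa using hk⟩
      · rintro ⟨l, hl, hk⟩
        exact ⟨Equiv.swap a b l, swap_mem ha hb hl, hk⟩
    · rfl
  · rw [hlab] at hl hl'
    rw [mem_crossover_chain hab] at hk hk'
    split_ifs at hk hk'
    · exact (Equiv.swap a b).injective
        (h.disjoint _ (swap_mem ha hb hl) _ (swap_mem ha hb hl') k hk hk')
    · exact h.disjoint _ hl _ hl' k hk hk'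
  · rw [hlab] at hl
    rw [mem_crossover_chain hab] at hk hk'
    -- an interval to the right of `q` does not overlap a member of a chain that avoids `q` and is
    -- not to the right of `q`
    have key : ∀ k k', k ∈ R.chain (Equiv.swap a b l) → k' ∈ R.chain l →
        (∀ x ∈ (K k).pts, q < x) → ¬ (∀ x ∈ (K k').pts, q < x) →
        ¬ (overlapGraph K).Adj k k' := by
      intro k k' hk hk' hr hr' hadj
      by_cases hl1 : l = a ∨ l = b
      · have hq : q ∉ (K k').pts := by
          intro hq
          rcases hl1 with h1 | h1
          · exact hqa ⟨k', h1 ▸ hk', hq⟩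
          · exact hqb ⟨k', h1 ▸ hk', hq⟩
        obtain ⟨x, hx, hx'⟩ := hadj.2
        exact hr' (RealInterval.forall_gt_of_notMem hq hx' (hr x hx))
      · push Not at hl1
        rw [Equiv.swap_apply_of_ne_of_ne hl1.1 hl1.2] at hk
        exact h.indep l hl k hk k' hk' hadj
    split_ifs at hk hk' with h1 h2 h2
    · exact h.indep _ (swap_mem ha hb hl) k hk k' hk' hadj
    · exact key k k' hk hk' h1 h2 hadj
    · exact key k' k hk' hk h2 h1 hadj.symm
    · exact h.indep _ hl k hk k' hk' hadj

section

variable [Fintype κ] {K : κ → RealInterval}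

open scoped Classical in
/-- One further interval raises the multiplicity up to which a point is covered by one. -/
theorem Covered.of_mem {i : ℕ} {D S : Finset κ} {x : ℝ} {k : κ} (hD : Covered K (i - 1) D x)
    (hDS : D ⊆ S) (hkS : k ∈ S) (hkD : k ∉ D) (hx : x ∈ (K k).pts) : Covered K i S x := by
  have h1 : insert k (D.filter fun k => x ∈ (K k).pts) ⊆ S.filter fun k => x ∈ (K k).pts := by
    intro j hj
    rcases Finset.mem_insert.1 hj with rfl | hj
    · exact Finset.mem_filter.2 ⟨hkS, hx⟩
    · exact Finset.mem_filter.2 ⟨hDS (Finset.mem_filter.1 hj).1, (Finset.mem_filter.1 hj).2⟩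
  have h2 := Finset.card_le_card h1
  rw [Finset.card_insert_of_notMem (fun h => hkD (Finset.mem_filter.1 h).1)] at h2
  unfold Covered at hD ⊢
  omega

open scoped Classical in
theorem Covered.mono {i : ℕ} {D S : Finset κ} {x : ℝ} (hD : Covered K i D x)
    (h : ∀ k ∈ D, x ∈ (K k).pts → k ∈ S) : Covered K i S x := by
  refine le_trans hD (Finset.card_le_card fun k hk => ?_)
  rw [Finset.mem_filter] at hk ⊢
  exact ⟨h k hk.1 hk.2, hk.2⟩

open scoped Classical in
/-- A point covered `i - 1` times by `D` is covered by `D` and two further chains iff it is covered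
by `D` or contained in one of the chains. -/
theorem covered_union_iff {i : ℕ} {D S₁ S₂ : Finset κ} {x : ℝ} (hD : Covered K (i - 1) D x)
    (h₁ : ∀ k ∈ S₁, k ∉ D) (h₂ : ∀ k ∈ S₂, k ∉ D) :
    Covered K i (D ∪ S₁ ∪ S₂) x ↔ Covered K i D x ∨ Contains K S₁ x ∨ Contains K S₂ x := by
  constructor
  · intro h
    by_contra! hcon
    refine hcon.1 (h.mono fun k hk hx => ?_)
    rcases Finset.mem_union.1 hk with hk | hk
    · rcases Finset.mem_union.1 hk with hk | hk
      · exact hk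
      · exact absurd ⟨k, hk, hx⟩ hcon.2.1
    · exact absurd ⟨k, hk, hx⟩ hcon.2.2
  · rintro (h | ⟨k, hk, hx⟩ | ⟨k, hk, hx⟩)
    · exact h.mono fun k hk _ => by simp [hk]
    · exact hD.of_mem (fun j hj => by simp [hj]) (by simp [hk]) (h₁ k hk) hx
    · exact hD.of_mem (fun j hj => by simp [hj]) (by simp [hk]) (h₂ k hk) hx

open scoped Classical in
theorem exists_notMem_of_not_covered {i : ℕ} {D : Finset κ} {x : ℝ} (h : ¬ Covered K i D x) :
    ∃ k, k ∉ D ∧ x ∈ (K k).pts := by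
  by_contra! hcon
  refine h (le_trans (min_le_left _ _) (Finset.card_le_card fun k hk => ?_))
  have hx := (Finset.mem_filter.1 hk).2
  exact Finset.mem_filter.2 ⟨by_contra fun hkD => hcon k hkD hx, hx⟩

end

/-- A loop with an invariant and a decreasing measure terminates, so that `whileDo` does not take
the value it is given for nonterminating loops. -/
theorem whileDo_spec {σ : Type} {guard : σ → Prop} {body : σ → σ} (I : σ → Prop) (m : σ → ℕ)
    (hstep : ∀ s, I s → guard s → I (body s) ∧ m (body s) < m s) {s : σ} (hs : I s) :
    I (whileDo guard body s) ∧ ¬ guard (whileDo guard body s) := by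
  classical
  have hex : ∃ n, ¬ guard (body^[n] s) := by
    by_contra! hcon
    have h : ∀ n, I (body^[n] s) ∧ m (body^[n] s) + n ≤ m s := by
      intro n
      induction n with
      | zero => exact ⟨hs, le_rfl⟩
      | succ n ih =>
        have := hstep _ ih.1 (hcon n)
        rw [Function.iterate_succ_apply']
        exact ⟨this.1, by omega⟩
    have := (h (m s + 1)).2
    omega
  have hfind := Nat.find_spec hex
  have hmin : ∀ n, n ≤ Nat.find hex → I (body^[n] s) := by
    intro n
    induction n with
    | zero => exact fun _ => hs
    | succ n ih =>
      intro hn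
      rw [Function.iterate_succ_apply']
      exact (hstep _ (ih (by omega)) (not_not.1 (Nat.find_min hex (by omega)))).1
  have hval : whileDo guard body s = body^[Nat.find hex] s := by
    unfold whileDo
    rw [dif_pos hex]
  rw [hval]
  exact ⟨hmin _ le_rfl, hfind⟩

/-- The invariant of the chain creation procedure in the region `R`, where `A` is the set of the
intervals in the chains of `R`. -/
structure ChainStateInvariant (K : κ → RealInterval) (R : Region ι κ) (A : κ → Prop)
    (s : ChainState ι κ) : Prop where
  lo_eq : s.region.lo = R.lo
  hi_eq : s.region.hi = R.hi
  labels_eq : s.region.labels = R.labels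
  unprocessed_eq : s.region.unprocessed = R.unprocessed
  c₁_mem : s.c₁ ∈ R.labels
  c₂_mem : s.c₂ ∈ R.labels
  ne : s.c₁ ≠ s.c₂
  family : ChainFamily K s.region A

theorem ChainStateInvariant.has_iff {K : κ → RealInterval} {R : Region ι κ} {A : κ → Prop}
    {s : ChainState ι κ} (hs : ChainStateInvariant K R A s) {x : ℝ} : s.region.Has x ↔ R.Has x := by
  simp only [Region.Has, hs.lo_eq, hs.hi_eq]

section

variable [Fintype κ] {J : ι → RealInterval} {K : κ → RealInterval} {w : ℕ}

theorem initialChainState_invariant (ch : SecondChoices J K w) (i : ℕ) {R : Region ι κ}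
    {A : κ → Prop} (hR : ChainFamily K R A) (hne : R.HasNonemptyChain) (hcard : 2 ≤ R.labels.card) :
    ChainStateInvariant K R A (initialChainState ch i R) := by
  classical
  have h1 : (initialChainState ch i R).c₁ ∈ R.labels := by
    have hS : (Finset.univ.filter A).Nonempty := by
      obtain ⟨l, hl, k, hk⟩ := hne
      exact ⟨k, by simpa using (hR.mem_iff k).2 ⟨l, hl, hk⟩⟩
    obtain ⟨k, hk, hmin⟩ := Finset.exists_min_image _ (fun k => (K k).lo) hS
    obtain ⟨l, hl, hkl⟩ := (hR.mem_iff k).1 (Finset.mem_filter.1 hk).2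
    refine (Finset.mem_filter.1 (ch.pick_mem i R [] _ ⟨l, Finset.mem_filter.2 ⟨hl, k, hkl, ?_⟩⟩)).1
    intro l' hl' k' hk'
    exact hmin k' (by simpa using (hR.mem_iff k').2 ⟨l', hl', hk'⟩)
  have h2 : (initialChainState ch i R).c₂ ∈ R.labels.erase (initialChainState ch i R).c₁ := by
    refine ch.pick_mem i R _ _ ?_
    rw [← Finset.card_pos]
    have := Finset.pred_card_le_card_erase (s := R.labels) (a := (initialChainState ch i R).c₁)
    have h3 : 0 < (R.labels.erase (initialChainState ch i R).c₁).card := by omega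
    exact h3
  exact ⟨rfl, rfl, rfl, rfl, h1, (Finset.mem_erase.1 h2).2, (Finset.mem_erase.1 h2).1.symm, hR⟩

/-- One step of the loop keeps the invariant, and after it all points up to the leftmost uncovered
point are covered. -/
theorem chainStep_spec (ch : SecondChoices J K w) (i : ℕ) {D : Finset κ} {R : Region ι κ}
    {A : κ → Prop} (hDA : ∀ k, A k → k ∉ D) (hall : ∀ k x, R.Has x → x ∈ (K k).pts → k ∉ D → A k)
    (hcov : ∀ x, R.Has x → Covered K (i - 1) D x) {s : ChainState ι κ}
    (hs : ChainStateInvariant K R A s) (h : (uncovered ch i D s).Nonempty) :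
    ChainStateInvariant K R A (chainStep ch i D s) ∧
      ∀ x ∈ uncovered ch i D (chainStep ch i D s), (uncovered ch i D s).min' h < x := by
  classical
  -- in any state, a point is covered iff it is covered by `D` or contained in a selected chain
  have hunc : ∀ s', ChainStateInvariant K R A s' → ∀ x, x ∈ uncovered ch i D s' ↔
      x ∈ regionPoints ch R ∧ ¬ (Covered K i D x ∨ Contains K (s'.region.chain s'.c₁) x ∨
        Contains K (s'.region.chain s'.c₂) x) := by
    intro s' hs' x
    have hreg : regionPoints ch s'.region = regionPoints ch R := by
      exact Finset.filter_congr fun x _ => hs'.has_iff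
    rw [uncovered, Finset.mem_filter, hreg]
    refine and_congr_right fun hx => not_congr ?_
    have hxR : R.Has x := (Finset.mem_filter.1 hx).2
    refine covered_union_iff (hcov x hxR) ?_ ?_
    · exact fun k hk => hDA k ((hs'.family.mem_iff k).2 ⟨_, hs'.labels_eq ▸ hs'.c₁_mem, hk⟩)
    · exact fun k hk => hDA k ((hs'.family.mem_iff k).2 ⟨_, hs'.labels_eq ▸ hs'.c₂_mem, hk⟩)
  have hreg : regionPoints ch s.region = regionPoints ch R := by
    exact Finset.filter_congr fun x _ => hs.has_iff
  set p := (uncovered ch i D s).min' h with hp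
  have hpmem : p ∈ uncovered ch i D s := Finset.min'_mem _ _
  have hp' := (hunc s hs p).1 hpmem
  have hlt : ∀ x ∈ regionPoints ch R, x < p → Covered K i D x ∨
      Contains K (s.region.chain s.c₁) x ∨ Contains K (s.region.chain s.c₂) x := by
    intro x hx hxp
    by_contra hcon
    exact ((uncovered ch i D s).min'_le x ((hunc s hs x).2 ⟨hx, hcon⟩)).not_gt hxp
  -- the third chain
  set c₃ := ch.pick i s.region [s.c₁, s.c₂]
    (s.region.labels.filter fun l => Contains K (s.region.chain l) p) with hc₃
  have hc₃mem : c₃ ∈ s.region.labels ∧ Contains K (s.region.chain c₃) p := by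
    refine Finset.mem_filter.1 (ch.pick_mem i s.region [s.c₁, s.c₂] _ ?_)
    have hnc : ¬ Covered K i D p := fun h => hp'.2 (Or.inl h)
    obtain ⟨k, hkD, hkp⟩ := exists_notMem_of_not_covered hnc
    obtain ⟨l, hl, hkl⟩ := (hs.family.mem_iff k).1
      (hall k p (Finset.mem_filter.1 hp'.1).2 hkp hkD)
    exact ⟨l, Finset.mem_filter.2 ⟨hl, k, hkl, hkp⟩⟩
  have hc₃1 : s.c₁ ≠ c₃ := by
    intro h; rw [← h] at hc₃mem; exact hp'.2 (Or.inr (Or.inl hc₃mem.2))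
  have hc₃2 : s.c₂ ≠ c₃ := by
    intro h; rw [← h] at hc₃mem; exact hp'.2 (Or.inr (Or.inr hc₃mem.2))
  set V := (regionPoints ch s.region).filter fun q => q < p ∧
      ¬ (Contains K (s.region.chain c₃) q ∨
        (Contains K (s.region.chain s.c₁) q ∧ Contains K (s.region.chain s.c₂) q)) with hV
  by_cases hv : V.Nonempty
  · -- there is a violating point, and a crossover is done
    set q := V.max' hv with hqdef
    set c := ch.pick i s.region [s.c₁, s.c₂, c₃]
        (({s.c₁, s.c₂} : Finset ℕ).filter fun l => ¬ Contains K (s.region.chain l) q) with hc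
    have hstep : chainStep ch i D s = { s with region := crossover K s.region c c₃ q } := by
      unfold chainStep
      rw [dif_pos h]
      exact dif_pos hv
    have hqV := Finset.mem_filter.1 (V.max'_mem hv)
    rw [← hqdef] at hqV
    obtain ⟨-, hqp, hq⟩ := hqV
    push Not at hq
    have hcmem : (c = s.c₁ ∨ c = s.c₂) ∧ ¬ Contains K (s.region.chain c) q := by
      have := Finset.mem_filter.1 (ch.pick_mem i s.region [s.c₁, s.c₂, c₃]
        (({s.c₁, s.c₂} : Finset ℕ).filter fun l => ¬ Contains K (s.region.chain l) q) (by
          by_cases h1 : Contains K (s.region.chain s.c₁) q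
          · exact ⟨s.c₂, Finset.mem_filter.2 ⟨by simp, hq.2 h1⟩⟩
          · exact ⟨s.c₁, Finset.mem_filter.2 ⟨by simp, h1⟩⟩))
      exact ⟨by simpa using this.1, this.2⟩
    have hcc₃ : c ≠ c₃ := by
      rcases hcmem.1 with h1 | h1
      · exact h1 ▸ hc₃1
      · exact h1 ▸ hc₃2
    have hclab : c ∈ s.region.labels := by
      rw [hs.labels_eq]
      rcases hcmem.1 with h1 | h1
      · exact h1 ▸ hs.c₁_mem
      · exact h1 ▸ hs.c₂_mem
    have hinv : ChainStateInvariant K R A (chainStep ch i D s) := by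
      rw [hstep]
      exact ⟨hs.lo_eq, hs.hi_eq, hs.labels_eq, hs.unprocessed_eq, hs.c₁_mem, hs.c₂_mem, hs.ne,
        hs.family.crossover hclab hc₃mem.1 hcc₃ hcmem.2 hq.1⟩
    refine ⟨hinv, fun x hx => ?_⟩
    rw [hunc _ hinv, hstep] at hx
    obtain ⟨hxR, hx⟩ := hx
    push Not at hx
    obtain ⟨hx0, hx1, hx2⟩ := hx
    simp only at hx1 hx2
    by_contra! hxp
    -- chains other than the third one
    have hold : ∀ l, l ≠ c₃ → (l ≠ c ∨ x ≤ q) → Contains K (s.region.chain l) x →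
        Contains K ((crossover K s.region c c₃ q).chain l) x := by
      rintro l hl1 hl2 ⟨k, hk, hkx⟩
      refine ⟨k, ?_, hkx⟩
      rw [mem_crossover_chain hcc₃]
      split_ifs with hr
      · have hlc : l ≠ c := hl2.resolve_right (not_le.2 (hr x hkx))
        rwa [Equiv.swap_apply_of_ne_of_ne hlc hl1]
      · exact hk
    rcases le_or_gt x q with hxq | hxq
    · rcases hlt x hxR (hxq.trans_lt hqp) with h1 | h1 | h1
      · exact hx0 h1
      · exact hx1 (hold _ hc₃1 (Or.inr hxq) h1)
      · exact hx2 (hold _ hc₃2 (Or.inr hxq) h1)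
    · -- the new chain `c` contains the part of the third chain to the right of `q`
      have hnew : ¬ Contains K (s.region.chain c₃) x := by
        rintro ⟨k, hk, hkx⟩
        have hqk : q ∉ (K k).pts := fun h => hq.1 ⟨k, hk, h⟩
        have h3 : Contains K ((crossover K s.region c c₃ q).chain c) x := by
          refine ⟨k, ?_, hkx⟩
          rw [mem_crossover_chain hcc₃,
            if_pos (RealInterval.forall_gt_of_notMem hqk hkx hxq), Equiv.swap_apply_left]
          exact hk
        rcases hcmem.1 with h1 | h1
        · exact hx1 (h1 ▸ h3)
        · exact hx2 (h1 ▸ h3)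
      rcases hxp.lt_or_eq with hxp | hxp
      · have hxV : x ∉ V := fun hxV => (V.le_max' x hxV).not_gt hxq
        rw [hV, Finset.mem_filter, hreg] at hxV
        push Not at hxV
        rcases hxV hxR hxp with h1 | ⟨h1, h2⟩
        · exact hnew h1
        · rcases hcmem.1 with h3 | h3
          · exact hx2 (hold _ hc₃2 (Or.inl (by rw [h3]; exact hs.ne.symm)) h2)
          · exact hx1 (hold _ hc₃1 (Or.inl (by rw [h3]; exact hs.ne)) h1)
      · exact hnew (hxp ▸ hc₃mem.2)
  · -- the third chain replaces the second one
    have hstep : chainStep ch i D s = { s with c₂ := c₃ } := by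
      unfold chainStep
      rw [dif_pos h]
      exact dif_neg hv
    have hinv : ChainStateInvariant K R A (chainStep ch i D s) := by
      rw [hstep]
      exact ⟨hs.lo_eq, hs.hi_eq, hs.labels_eq, hs.unprocessed_eq, hs.c₁_mem,
        hs.labels_eq ▸ hc₃mem.1, hc₃1, hs.family⟩
    refine ⟨hinv, fun x hx => ?_⟩
    rw [hunc _ hinv, hstep] at hx
    obtain ⟨hxR, hx⟩ := hx
    push Not at hx
    obtain ⟨hx0, hx1, hx2⟩ := hx
    simp only at hx1 hx2
    by_contra! hxp
    rcases hxp.lt_or_eq with hxp | hxp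
    · have hxV : x ∉ V := fun hxV => hv ⟨x, hxV⟩
      rw [hV, Finset.mem_filter, hreg] at hxV
      push Not at hxV
      rcases hxV hxR hxp with h1 | h1
      · exact hx2 h1
      · exact hx1 h1.1
    · exact hx2 (hxp ▸ hc₃mem.2)

/-- The chain creation procedure terminates, and the points of the region are then covered by the
colored intervals and the two selected chains. -/
theorem createChains_spec (ch : SecondChoices J K w) (i : ℕ) {D : Finset κ} {R : Region ι κ}
    {A : κ → Prop} (hR : ChainFamily K R A) (hne : R.HasNonemptyChain) (hcard : 2 ≤ R.labels.card)
    (hDA : ∀ k, A k → k ∉ D) (hall : ∀ k x, R.Has x → x ∈ (K k).pts → k ∉ D → A k)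
    (hcov : ∀ x, R.Has x → Covered K (i - 1) D x) :
    ChainStateInvariant K R A (createChains ch i D R) ∧
      uncovered ch i D (createChains ch i D R) = ∅ := by
  classical
  -- the measure is the number of representative points from the leftmost uncovered one on
  have h := whileDo_spec (guard := fun s => (uncovered ch i D s).Nonempty)
    (body := chainStep ch i D) (ChainStateInvariant K R A)
    (fun s => ((regionPoints ch R).filter fun x => ∃ u ∈ uncovered ch i D s, u ≤ x).card)
    (by
      intro s hs hg
      obtain ⟨h1, h2⟩ := chainStep_spec ch i hDA hall hcov hs hg
      refine ⟨h1, Finset.card_lt_card ?_⟩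
      have hmin := Finset.min'_mem _ hg
      rw [Finset.ssubset_iff_of_subset]
      · refine ⟨(uncovered ch i D s).min' hg, Finset.mem_filter.2 ⟨?_, _, hmin, le_rfl⟩, ?_⟩
        · have := (Finset.mem_filter.1 hmin).1
          simpa [regionPoints, Region.Has, hs.lo_eq, hs.hi_eq] using this
        · intro hcon
          obtain ⟨-, u, hu, hle⟩ := Finset.mem_filter.1 hcon
          exact (h2 u hu).not_ge hle
      · intro x hx
        obtain ⟨hxR, u, hu, hle⟩ := Finset.mem_filter.1 hx
        exact Finset.mem_filter.2 ⟨hxR, _, hmin, (h2 u hu).le.trans hle⟩)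
    (initialChainState_invariant ch i hR hne hcard)
  exact ⟨h.1, Finset.not_nonempty_iff_eq_empty.1 h.2⟩

theorem SameSide.mem_iff {I : RealInterval} {x y : ℝ} (h : SameSide I x y) :
    x ∈ I.pts ↔ y ∈ I.pts := by
  rcases h with h | h | h
  · simp [h]
  · exact ⟨fun hx => absurd (h x hx).1 (lt_irrefl _), fun hy => absurd (h y hy).2 (lt_irrefl _)⟩
  · exact ⟨fun hx => absurd (h x hx).1 (lt_irrefl _), fun hy => absurd (h y hy).2 (lt_irrefl _)⟩

/-- The boundary of the region consists of clique points. -/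
def Region.HasCliqueBoundary (ch : SecondChoices J K w) (R : Region ι κ) : Prop :=
  (R.lo = ⊥ ∨ ∃ C, IsMaximalClique J C ∧ R.lo = (ch.cliquePoint C : EReal)) ∧
  (R.hi = ⊤ ∨ ∃ C, IsMaximalClique J C ∧ R.hi = (ch.cliquePoint C : EReal))

/-- All points of a region are covered if the representative points are. -/
theorem covered_of_regionPoints (ch : SecondChoices J K w) {R : Region ι κ}
    (hR : R.HasCliqueBoundary ch) {i : ℕ} {S : Finset κ}
    (h : ∀ x ∈ regionPoints ch R, Covered K i S x) {x : ℝ} (hx : R.Has x) : Covered K i S x := by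
  classical
  obtain ⟨p, ⟨hp, hxp⟩, -⟩ := ch.representatives_spec x
  have hpR : R.Has p := by
    refine ⟨?_, ?_⟩
    · rcases hR.1 with h1 | ⟨C, hC, h1⟩
      · rw [h1]; exact bot_le
      · have h2 := hx.1
        rw [h1, EReal.coe_le_coe_iff] at h2 ⊢
        exact not_lt.1 fun h3 => ((hxp.1 C hC).1.2 h3).not_ge h2
    · rcases hR.2 with h1 | ⟨C, hC, h1⟩
      · rw [h1]; exact le_top
      · have h2 := hx.2
        rw [h1, EReal.coe_le_coe_iff] at h2 ⊢
        exact not_lt.1 fun h3 => ((hxp.1 C hC).2.2 h3).not_ge h2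
  have h1 := h p (Finset.mem_filter.2 ⟨hp, hpR⟩)
  have h2 : ∀ k, x ∈ (K k).pts ↔ p ∈ (K k).pts := fun k => (hxp.2.2 k).mem_iff
  unfold Covered at h1 ⊢
  simpa only [h2] using h1

end

/-! ### Regions -/

/-- The interval has a point in the region. -/
def Region.Meets (R : Region ι κ) (I : RealInterval) : Prop := ∃ x ∈ I.pts, R.Has x

/-- The interval lies strictly between the boundary points of the region. -/
def Region.Inside (R : Region ι κ) (I : RealInterval) : Prop :=
  ∀ x ∈ I.pts, R.lo < (x : EReal) ∧ (x : EReal) < R.hi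

/-- Consecutive regions are ordered from left to right, and the regions cover the line. -/
structure RegionsPartition (Rs : List (Region ι κ)) : Prop where
  le : ∀ R ∈ Rs, R.lo ≤ R.hi
  pairwise : Rs.Pairwise fun R R' => R.hi ≤ R'.lo
  cover : ∀ x : ℝ, ∃ R ∈ Rs, R.Has x

/-- Splitting the part of a region to the right of `lo` at the increasing sequence `as`. -/
theorem splitAt_spec (K : κ → RealInterval) (R : Region ι κ) (as : List ℝ) : ∀ lo : EReal,
    lo ≤ R.hi → as.Pairwise (· < ·) → (∀ a ∈ as, lo < (a : EReal) ∧ (a : EReal) < R.hi) →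
    (∀ R' ∈ R.splitAt K lo as, ∃ lo' hi', R' = R.restrict K lo' hi' ∧
      (lo' = lo ∨ ∃ a ∈ as, lo' = (a : EReal)) ∧ (hi' = R.hi ∨ ∃ a ∈ as, hi' = (a : EReal)) ∧
      lo ≤ lo' ∧ lo' ≤ hi' ∧ hi' ≤ R.hi ∧ ∀ a ∈ as, ¬ (lo' < (a : EReal) ∧ (a : EReal) < hi')) ∧
    (R.splitAt K lo as).Pairwise (fun R R' => R.hi ≤ R'.lo) ∧
    ∀ x : ℝ, lo ≤ x → (x : EReal) ≤ R.hi → ∃ R' ∈ R.splitAt K lo as, R'.Has x := by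
  induction as with
  | nil =>
    intro lo hlo _ _
    refine ⟨?_, ?_, ?_⟩
    · intro R' hR'
      rw [Region.splitAt, List.mem_singleton] at hR'
      exact ⟨lo, R.hi, hR', Or.inl rfl, Or.inl rfl, le_rfl, hlo, le_rfl, by simp⟩
    · simp [Region.splitAt]
    · intro x h1 h2
      exact ⟨_, List.mem_singleton_self _, h1, h2⟩
  | cons a as ih =>
    intro lo hlo hsort has
    rw [List.pairwise_cons] at hsort
    have hloa := (has a List.mem_cons_self).1
    obtain ⟨h1, h2, h3⟩ := ih (a : EReal) (has a List.mem_cons_self).2.le hsort.2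
      (fun b hb => ⟨EReal.coe_lt_coe_iff.2 (hsort.1 b hb), (has b (List.mem_cons_of_mem _ hb)).2⟩)
    refine ⟨?_, ?_, ?_⟩
    · intro R' hR'
      rw [Region.splitAt] at hR'
      rcases List.mem_cons.1 hR' with rfl | hR'
      · refine ⟨lo, a, rfl, Or.inl rfl, Or.inr ⟨a, List.mem_cons_self, rfl⟩, le_rfl, hloa.le,
          (has a List.mem_cons_self).2.le, ?_⟩
        rintro b hb ⟨-, hb2⟩
        rcases List.mem_cons.1 hb with rfl | hb
        · exact lt_irrefl _ hb2
        · exact (EReal.coe_lt_coe_iff.1 hb2).not_gt (hsort.1 b hb)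
      · obtain ⟨lo', hi', h4, h5, h6, h7, h7', h8, h9⟩ := h1 R' hR'
        refine ⟨lo', hi', h4, Or.inr ?_, ?_, hloa.le.trans h7, h7', h8, ?_⟩
        · rcases h5 with h5 | ⟨b, hb, h5⟩
          · exact ⟨a, List.mem_cons_self, h5⟩
          · exact ⟨b, List.mem_cons_of_mem _ hb, h5⟩
        · rcases h6 with h6 | ⟨b, hb, h6⟩
          · exact Or.inl h6
          · exact Or.inr ⟨b, List.mem_cons_of_mem _ hb, h6⟩
        · intro b hb hlt
          rcases List.mem_cons.1 hb with rfl | hb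
          · exact hlt.1.not_ge h7
          · exact h9 b hb hlt
    · rw [Region.splitAt, List.pairwise_cons]
      refine ⟨fun R' hR' => ?_, h2⟩
      obtain ⟨lo', hi', rfl, -, -, h7, -⟩ := h1 R' hR'
      exact h7
    · intro x hx1 hx2
      rw [Region.splitAt]
      rcases le_total (x : EReal) a with h | h
      · exact ⟨_, List.mem_cons_self, hx1, h⟩
      · obtain ⟨R', hR', h'⟩ := h3 x h hx2
        exact ⟨R', List.mem_cons_of_mem _ hR', h'⟩

open scoped Classical in
/-- Splitting regions at clique points: the resulting regions are restrictions of the given ones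
to parts that are bounded by active clique points and contain none in their interior. -/
theorem splitRegions_spec [Fintype ι] [Fintype κ] {J : ι → RealInterval} {K : κ → RealInterval}
    {w : ℕ} (ch : SecondChoices J K w) (i : ℕ) {Rs : List (Region ι κ)}
    (hRs : RegionsPartition Rs) :
    RegionsPartition (splitRegions ch i Rs) ∧
    ∀ R' ∈ splitRegions ch i Rs, ∃ R ∈ Rs, ∃ lo hi, R' = R.restrict K lo hi ∧
      (lo = R.lo ∨ ∃ a ∈ activePoints ch i, lo = (a : EReal) ∧ R.lo < a ∧ a < R.hi) ∧
      (hi = R.hi ∨ ∃ a ∈ activePoints ch i, hi = (a : EReal) ∧ R.lo < a ∧ a < R.hi) ∧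
      R.lo ≤ lo ∧ hi ≤ R.hi ∧
      ∀ a ∈ activePoints ch i, ¬ (lo < (a : EReal) ∧ (a : EReal) < hi) := by
  set as : Region ι κ → List ℝ := fun R =>
    ((activePoints ch i).filter fun a : ℝ => R.lo < (a : EReal) ∧ (a : EReal) < R.hi).sort
      (· ≤ ·) with has
  have hmem : ∀ R a, a ∈ as R ↔ a ∈ activePoints ch i ∧ R.lo < (a : EReal) ∧ (a : EReal) < R.hi :=
    fun R a => by rw [has, Finset.mem_sort, Finset.mem_filter]
  have key : ∀ R ∈ Rs, _ := fun R hR => splitAt_spec K R (as R) R.lo (hRs.le R hR)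
    (Finset.sortedLT_sort _).pairwise (fun a ha => ((hmem R a).1 ha).2)
  have hsplit : ∀ R', R' ∈ splitRegions ch i Rs ↔ ∃ R ∈ Rs, R' ∈ R.splitAt K R.lo (as R) :=
    fun R' => List.mem_flatMap
  refine ⟨⟨?_, ?_, ?_⟩, ?_⟩
  · intro R' hR'
    obtain ⟨R, hR, hR'⟩ := (hsplit R').1 hR'
    obtain ⟨lo, hi, rfl, -, -, -, h, -⟩ := (key R hR).1 R' hR'
    exact h
  · refine List.pairwise_flatMap.2 ⟨fun R hR => (key R hR).2.1, ?_⟩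
    refine List.Pairwise.imp_of_mem ?_ hRs.pairwise
    intro R₁ R₂ hR₁ hR₂ h12 R₁' hR₁' R₂' hR₂'
    obtain ⟨lo₁, hi₁, rfl, -, -, -, -, h1, -⟩ := (key R₁ hR₁).1 R₁' hR₁'
    obtain ⟨lo₂, hi₂, rfl, -, -, h2, -⟩ := (key R₂ hR₂).1 R₂' hR₂'
    exact h1.trans (h12.trans h2)
  · intro x
    obtain ⟨R, hR, hx⟩ := hRs.cover x
    obtain ⟨R', hR', h⟩ := (key R hR).2.2 x hx.1 hx.2
    exact ⟨R', (hsplit R').2 ⟨R, hR, hR'⟩, h⟩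
  · intro R' hR'
    obtain ⟨R, hR, hR'⟩ := (hsplit R').1 hR'
    obtain ⟨lo, hi, h1, h2, h3, h4, -, h6, h7⟩ := (key R hR).1 R' hR'
    refine ⟨R, hR, lo, hi, h1, ?_, ?_, h4, h6, ?_⟩
    · rcases h2 with h2 | ⟨a, ha, h2⟩
      · exact Or.inl h2
      · exact Or.inr ⟨a, ((hmem R a).1 ha).1, h2, ((hmem R a).1 ha).2⟩
    · rcases h3 with h3 | ⟨a, ha, h3⟩
      · exact Or.inl h3
      · exact Or.inr ⟨a, ((hmem R a).1 ha).1, h3, ((hmem R a).1 ha).2⟩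
    · rintro a ha ⟨h8, h9⟩
      exact h7 a ((hmem R a).2 ⟨ha, h4.trans_lt h8, h9.trans_le h6⟩) ⟨h8, h9⟩

/-- The loop over the regions: a property `Q` of a region that only depends on the colors of the
intervals meeting the region becomes a property `Q'` of the same kind, and a global property `G` is
kept, if each execution of the body, which colors only intervals inside its region, does so. -/
theorem forRegions_spec {K : κ → RealInterval}
    {body : Region ι κ → (κ → Option ℕ) → Region ι κ × (κ → Option ℕ)}
    {Q Q' : Region ι κ → (κ → Option ℕ) → Prop} {G : (κ → Option ℕ) → Prop}
    (hQ : ∀ R col col', Q R col → (∀ k, R.Meets (K k) → col' k = col k) → Q R col')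
    (hQ' : ∀ R col col', Q' R col → (∀ k, R.Meets (K k) → col' k = col k) → Q' R col')
    (hbody : ∀ R col, Q R col → G col → (body R col).1.lo = R.lo ∧ (body R col).1.hi = R.hi ∧
      Q' (body R col).1 (body R col).2 ∧ G (body R col).2 ∧
      ∀ k, (body R col).2 k ≠ col k → R.Inside (K k)) {Rs : List (Region ι κ)} :
    ∀ {col : κ → Option ℕ}, Rs.Pairwise (fun R R' => R.hi ≤ R'.lo) →
      (∀ R ∈ Rs, Q R col) → G col →
      (∀ R ∈ (forRegions body Rs col).1, Q' R (forRegions body Rs col).2) ∧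
      G (forRegions body Rs col).2 ∧
      List.Forall₂ (fun R R' => R.lo = R'.lo ∧ R.hi = R'.hi) (forRegions body Rs col).1 Rs ∧
      ∀ k, (forRegions body Rs col).2 k ≠ col k → ∃ R ∈ Rs, R.Inside (K k) := by
  induction Rs with
  | nil =>
    intro col _ _ hG
    exact ⟨by simp [forRegions], hG, by simp [forRegions], by simp [forRegions]⟩
  | cons R Rs ih =>
    intro col hp hall hG
    rw [List.pairwise_cons] at hp
    obtain ⟨hlo, hhi, hq, hg, hch⟩ := hbody R col (hall R List.mem_cons_self) hG
    set r := body R col with hr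
    obtain ⟨h1, h2, h3, h4⟩ := ih (col := r.2) hp.2 (by
      intro R' hR'
      refine hQ R' col _ (hall R' (List.mem_cons_of_mem _ hR')) fun k hk => ?_
      by_contra hne
      obtain ⟨x, hx, hxR'⟩ := hk
      exact ((hch k hne x hx).2.trans_le (hp.1 R' hR')).not_ge hxR'.1) hg
    have hval : forRegions body (R :: Rs) col =
      (r.1 :: (forRegions body Rs r.2).1, (forRegions body Rs r.2).2) := rfl
    rw [hval]
    refine ⟨?_, h2, List.Forall₂.cons ⟨hlo, hhi⟩ h3, ?_⟩
    · intro R' hR'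
      rcases List.mem_cons.1 hR' with rfl | hR'
      · refine hQ' _ _ _ hq fun k hk => ?_
        by_contra hne
        obtain ⟨R', hR', hin⟩ := h4 k hne
        obtain ⟨x, hx, hxR⟩ := hk
        refine ((hin x hx).1.trans_le hxR.2).not_ge ?_
        rw [hhi]
        exact hp.1 R' hR'
      · exact h1 R' hR'
    · intro k hk
      by_cases hk' : (forRegions body Rs r.2).2 k = r.2 k
      · exact ⟨R, List.mem_cons_self, hch k (hk' ▸ hk)⟩
      · obtain ⟨R', hR', hin⟩ := h4 k hk'
        exact ⟨R', List.mem_cons_of_mem _ hR', hin⟩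

/-- The partition depends on the boundary points of the regions only. -/
theorem RegionsPartition.of_forall₂ {Rs Rs' : List (Region ι κ)}
    (h : List.Forall₂ (fun R R' : Region ι κ => R.lo = R'.lo ∧ R.hi = R'.hi) Rs' Rs)
    (hRs : RegionsPartition Rs) : RegionsPartition Rs' := by
  have hmem : ∀ {Rs Rs' : List (Region ι κ)},
      List.Forall₂ (fun R R' : Region ι κ => R.lo = R'.lo ∧ R.hi = R'.hi) Rs' Rs →
      (∀ R' ∈ Rs', ∃ R ∈ Rs, R'.lo = R.lo ∧ R'.hi = R.hi) ∧
      ∀ R ∈ Rs, ∃ R' ∈ Rs', R'.lo = R.lo ∧ R'.hi = R.hi := by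
    intro Rs Rs' h
    induction h with
    | nil => simp
    | cons h _ ih =>
      refine ⟨?_, ?_⟩
      · intro R' hR'
        rcases List.mem_cons.1 hR' with rfl | hR'
        · exact ⟨_, List.mem_cons_self, h⟩
        · obtain ⟨R, hR, h'⟩ := ih.1 R' hR'
          exact ⟨R, List.mem_cons_of_mem _ hR, h'⟩
      · intro R hR
        rcases List.mem_cons.1 hR with rfl | hR
        · exact ⟨_, List.mem_cons_self, h⟩
        · obtain ⟨R', hR', h'⟩ := ih.2 R hR
          exact ⟨R', List.mem_cons_of_mem _ hR', h'⟩
  refine ⟨?_, ?_, ?_⟩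
  · intro R' hR'
    obtain ⟨R, hR, h1, h2⟩ := (hmem h).1 R' hR'
    rw [h1, h2]
    exact hRs.le R hR
  · have hp := hRs.pairwise
    clear hRs
    induction h with
    | nil => exact List.Pairwise.nil
    | cons h1 h2 ih =>
      rw [List.pairwise_cons] at hp ⊢
      refine ⟨fun R' hR' => ?_, ih hp.2⟩
      obtain ⟨R, hR, h3, -⟩ := (hmem h2).1 R' hR'
      rw [h1.2, h3]
      exact hp.1 R hR
  · intro x
    obtain ⟨R, hR, hx⟩ := hRs.cover x
    obtain ⟨R', hR', h1, h2⟩ := (hmem h).2 R hR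
    refine ⟨R', hR', ?_⟩
    rw [Region.Has, h1, h2]
    exact hx

/-! ### Invariants of the main loop -/

open scoped Classical in
/-- What the coloring of the second batch presupposes: `T` is an event order of the first batch `J`,
no point is in more than `w` intervals of both batches, and there are maximal cliques of size `w` in
the first batch on both sides of the second batch. -/
structure Admissible [Fintype ι] [Fintype κ] (J : ι → RealInterval) (K : κ → RealInterval) (w : ℕ)
    (T : List (Event ι)) : Prop where
  order : IsEventOrder J T
  depth_le : ∀ x : ℝ, (Finset.univ.filter fun i => x ∈ (J i).pts).card +
    (Finset.univ.filter fun k => x ∈ (K k).pts).card ≤ w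
  exists_left : ∀ k, ∃ C, IsMaximalClique J C ∧ w ≤ C.card ∧
    ∀ y, (∀ i ∈ C, y ∈ (J i).pts) → ∀ x ∈ (K k).pts, y < x
  exists_right : ∀ k, ∃ C, IsMaximalClique J C ∧ w ≤ C.card ∧
    ∀ y, (∀ i ∈ C, y ∈ (J i).pts) → ∀ x ∈ (K k).pts, x < y

/-- `P` is the set of the colors of the first-batch intervals that have been processed in `R` in the
first `n` iterations.  Second-batch intervals meeting `R` have colors of `P` or additional ones, all
other colors `1, …, w` are in use by the first batch at the boundary points of `R`, and those of `P`
are not used by maximal cliques with clique point in the interior of `R`. -/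
structure ProcessedColors {J : ι → RealInterval} {K : κ → RealInterval} {w : ℕ}
    (ch : SecondChoices J K w) (c : ι → ℕ) (n : ℕ) (R : Region ι κ) (col : κ → Option ℕ)
    (P : Finset ℕ) : Prop where
  card_eq : P.card = n
  range : ∀ f ∈ P, 1 ≤ f ∧ f ≤ w
  unprocessed_iff : ∀ i, R.Meets (J i) → (i ∈ R.unprocessed ↔ c i ∉ P)
  used : ∀ k f, col k = some f → R.Meets (K k) → f ∈ P ∨ (w < f ∧ f ≤ w + n)
  at_lo : ∀ a : ℝ, R.lo = a → ∀ f, 1 ≤ f → f ≤ w → f ∉ P → ∃ i, c i = f ∧ a ∈ (J i).pts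
  at_hi : ∀ a : ℝ, R.hi = a → ∀ f, 1 ≤ f → f ≤ w → f ∉ P → ∃ i, c i = f ∧ a ∈ (J i).pts
  clique : ∀ C, IsMaximalClique J C → R.lo < (ch.cliquePoint C : EReal) →
    (ch.cliquePoint C : EReal) < R.hi → ∀ i ∈ C, c i ∉ P

section

variable [Fintype κ] {J : ι → RealInterval} {K : κ → RealInterval} {w : ℕ}

open scoped Classical in
/-- The second-batch intervals that have a color. -/
noncomputable def coloredSet (col : κ → Option ℕ) : Finset κ :=
  Finset.univ.filter fun k => (col k).isSome = true

theorem mem_coloredSet {col : κ → Option ℕ} {k : κ} : k ∈ coloredSet col ↔ col k ≠ none := by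
  simp [coloredSet, Option.isSome_iff_ne_none]

/-- The state of a region after `n` iterations: the chains consist of the uncolored intervals that
meet the region, all of which lie in its interior, and each point is covered `n` times.  If a chain
is nonempty, then there are `w - 2 * n` chains, since each iteration removed two of them. -/
structure RegionInvariant (ch : SecondChoices J K w) (c : ι → ℕ) (n : ℕ) (R : Region ι κ)
    (col : κ → Option ℕ) : Prop where
  boundary : R.HasCliqueBoundary ch
  family : ChainFamily K R fun k => col k = none ∧ R.Meets (K k)
  inside : ∀ k, col k = none → R.Meets (K k) → R.Inside (K k)
  covered : ∀ x, R.Has x → Covered K n (coloredSet col) x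
  labels : R.HasNonemptyChain → R.labels.card + 2 * n = w
  processed : R.HasNonemptyChain → ∃ P, ProcessedColors ch c n R col P

/-- No maximal clique that is active in iteration `n + 1` has its clique point strictly between the
boundary points of the region. -/
def Region.NoActive (ch : SecondChoices J K w) (n : ℕ) (R : Region ι κ) : Prop :=
  ∀ C, IsMaximalClique J C → w ≤ C.card + n →
    ¬ (R.lo < (ch.cliquePoint C : EReal) ∧ (ch.cliquePoint C : EReal) < R.hi)

/-- The colors given to second-batch intervals so far are among `1, …, w + ⌊w / 2⌋` and do not
conflict with each other or with the colors `c` of the first batch. -/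
structure PartialProper (J : ι → RealInterval) (K : κ → RealInterval) (w : ℕ) (c : ι → ℕ)
    (col : κ → Option ℕ) : Prop where
  proper : ∀ k k' f, col k = some f → col k' = some f → ¬ (overlapGraph K).Adj k k'
  first : ∀ k f i, col k = some f → ((J i).pts ∩ (K k).pts).Nonempty → c i ≠ f
  range : ∀ k f, col k = some f → 1 ≤ f ∧ f ≤ w + w / 2

/-- The invariant of a region depends only on the colors of the intervals meeting it. -/
theorem RegionInvariant.congr {ch : SecondChoices J K w} {c : ι → ℕ} {n : ℕ} {R : Region ι κ}
    {col col' : κ → Option ℕ} (h : RegionInvariant ch c n R col)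
    (hcol : ∀ k, R.Meets (K k) → col' k = col k) : RegionInvariant ch c n R col' := by
  refine ⟨h.boundary, ⟨fun k => ?_, h.family.disjoint, h.family.indep⟩, fun k hk hm => ?_,
    fun x hx => ?_, h.labels, fun hne => ?_⟩
  · rw [← h.family.mem_iff]
    exact and_congr_left fun hm => by rw [hcol k hm]
  · exact h.inside k (hcol k hm ▸ hk) hm
  · refine (h.covered x hx).mono fun k hk hkx => ?_
    rw [mem_coloredSet] at hk ⊢
    rwa [hcol k ⟨x, hkx, hx⟩]
  · obtain ⟨P, hP⟩ := h.processed hne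
    exact ⟨P, hP.card_eq, hP.range, hP.unprocessed_iff,
      fun k f hk hm => hP.used k f (hcol k hm ▸ hk) hm, hP.at_lo, hP.at_hi, hP.clique⟩

end

theorem mem_activePoints [Fintype ι] {J : ι → RealInterval} {K : κ → RealInterval} {w : ℕ}
    {ch : SecondChoices J K w} {i : ℕ}
    {a : ℝ} :
    a ∈ activePoints ch i ↔
      ∃ C, (IsMaximalClique J C ∧ w + 1 ≤ C.card + i) ∧ ch.cliquePoint C = a := by
  simp [activePoints]

theorem restrict_hasNonemptyChain {K : κ → RealInterval} {R : Region ι κ} {lo hi : EReal}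
    (h : (R.restrict K lo hi).HasNonemptyChain) : R.HasNonemptyChain := by
  classical
  obtain ⟨l, hl, k, hk⟩ := h
  exact ⟨l, hl, k, (Finset.mem_filter.1 hk).1⟩

section

variable [Fintype ι] [Fintype κ] {J : ι → RealInterval} {K : κ → RealInterval} {w : ℕ}
  {T : List (Event ι)}

theorem Admissible.clique_card_le (hA : Admissible J K w T) {s : Finset ι}
    (hs : (overlapGraph J).IsClique (s : Set ι)) : s.card ≤ w := by
  classical
  obtain ⟨x, hx⟩ := exists_common_point hs
  refine le_trans (Finset.card_le_card fun i hi => ?_)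
    ((Nat.le_add_right _ _).trans (hA.depth_le x))
  exact Finset.mem_filter.2 ⟨Finset.mem_univ _, hx i hi⟩

theorem Admissible.stackRun (hA : Admissible J K w T) :
    StackRun T w (stackColoring T w) fun L => (stackState w L).1 :=
  BatchColoring.stackRun hA.order fun _ hs => hA.clique_card_le hs

/-- The coloring of the first batch is proper. -/
theorem Admissible.eq_of_color_eq (hA : Admissible J K w T) {x : ℝ} {i j : ι}
    (hi : x ∈ (J i).pts) (hj : x ∈ (J j).pts)
    (h : stackColoring T w i = stackColoring T w j) : i = j :=
  hA.stackRun.inj _ (hA.order.eventsBefore_prefix x) i j (hA.order.openAt_eventsBefore.2 hi)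
    (hA.order.openAt_eventsBefore.2 hj) h

open scoped Classical in
theorem Admissible.clique_add_le (hA : Admissible J K w T) {C : Finset ι} {x : ℝ}
    (hx : ∀ i ∈ C, x ∈ (J i).pts) :
    C.card + (Finset.univ.filter fun k => x ∈ (K k).pts).card ≤ w := by
  refine le_trans (Nat.add_le_add_right (Finset.card_le_card fun i hi => ?_) _) (hA.depth_le x)
  exact Finset.mem_filter.2 ⟨Finset.mem_univ _, hx i hi⟩

/-- Uncolored intervals avoid the clique points of active maximal cliques, since a point of such an
interval is in more than `n` second-batch intervals. -/
theorem RegionInvariant.cliquePoint_notMem (hA : Admissible J K w T) {ch : SecondChoices J K w}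
    {c : ι → ℕ} {n : ℕ} {R : Region ι κ} {col : κ → Option ℕ} (h : RegionInvariant ch c n R col)
    {C : Finset ι} (hC : IsMaximalClique J C) (hn : w ≤ C.card + n)
    (hR : R.Has (ch.cliquePoint C)) {k : κ} (hk : col k = none) : ch.cliquePoint C ∉ (K k).pts := by
  classical
  intro hx
  have h1 := h.covered _ hR
  have h2 := hA.clique_add_le (ch.cliquePoint_mem C hC)
  have h3 : ((coloredSet col).filter fun k => ch.cliquePoint C ∈ (K k).pts) ⊂
      (Finset.univ.filter fun k => ch.cliquePoint C ∈ (K k).pts) := by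
    rw [Finset.ssubset_iff_of_subset (Finset.filter_subset_filter _ (Finset.subset_univ _))]
    refine ⟨k, by simpa using hx, fun hcon => ?_⟩
    exact mem_coloredSet.1 (Finset.mem_filter.1 hcon).1 hk
  have h4 := Finset.card_lt_card h3
  unfold Covered at h1
  omega

open scoped Classical in
/-- A point of an uncolored interval is in less than `w - n` first-batch intervals. -/
theorem RegionInvariant.depth_lt (hA : Admissible J K w T) {ch : SecondChoices J K w}
    {c : ι → ℕ} {n : ℕ} {R : Region ι κ} {col : κ → Option ℕ} (h : RegionInvariant ch c n R col)
    {x : ℝ} (hR : R.Has x) {k : κ} (hk : col k = none) (hx : x ∈ (K k).pts) :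
    (Finset.univ.filter fun i => x ∈ (J i).pts).card < w - n := by
  have h1 := h.covered _ hR
  have h2 := hA.depth_le x
  have h3 : ((coloredSet col).filter fun k => x ∈ (K k).pts) ⊂
      (Finset.univ.filter fun k => x ∈ (K k).pts) := by
    rw [Finset.ssubset_iff_of_subset (Finset.filter_subset_filter _ (Finset.subset_univ _))]
    refine ⟨k, by simpa using hx, fun hcon => ?_⟩
    exact mem_coloredSet.1 (Finset.mem_filter.1 hcon).1 hk
  have h4 := Finset.card_lt_card h3
  unfold Covered at h1
  omega

/-- The invariant is inherited by the parts into which a region is split. -/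
theorem RegionInvariant.restrict (hA : Admissible J K w T) {ch : SecondChoices J K w} {n : ℕ}
    {R : Region ι κ} {col : κ → Option ℕ} (h : RegionInvariant ch (stackColoring T w) n R col)
    {lo hi : EReal}
    (hlo : lo = R.lo ∨ ∃ a ∈ activePoints ch (n + 1), lo = (a : EReal) ∧ R.lo < a ∧ a < R.hi)
    (hhi : hi = R.hi ∨ ∃ a ∈ activePoints ch (n + 1), hi = (a : EReal) ∧ R.lo < a ∧ a < R.hi)
    (hlo' : R.lo ≤ lo) (hhi' : hi ≤ R.hi) :
    RegionInvariant ch (stackColoring T w) n (R.restrict K lo hi) col := by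
  classical
  have hsub : ∀ x, (R.restrict K lo hi).Has x → R.Has x :=
    fun x hx => ⟨hlo'.trans hx.1, hx.2.trans hhi'⟩
  have hmeets : ∀ I, (R.restrict K lo hi).Meets I → R.Meets I :=
    fun I ⟨x, hx, hxR⟩ => ⟨x, hx, hsub x hxR⟩
  have hact : ∀ a : ℝ, a ∈ activePoints ch (n + 1) → R.lo < (a : EReal) → (a : EReal) < R.hi →
      ∃ C, IsMaximalClique J C ∧ w ≤ C.card + n ∧ ch.cliquePoint C = a ∧
        ∀ k, col k = none → a ∉ (K k).pts := by
    intro a ha h1 h2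
    obtain ⟨C, ⟨hC, hcard⟩, rfl⟩ := mem_activePoints.1 ha
    have hcard' : w ≤ C.card + n := by omega
    exact ⟨C, hC, hcard', rfl, fun k hk => h.cliquePoint_notMem hA hC hcard' ⟨h1.le, h2.le⟩ hk⟩
  -- at an active clique point all colors that are not processed are in use: the clique has at least
  -- `w - n` members, which have distinct colors outside the set `P` of size `n`
  have hfull : ∀ P, ProcessedColors ch (stackColoring T w) n R col P →
      ∀ a : ℝ, a ∈ activePoints ch (n + 1) → R.lo < (a : EReal) → (a : EReal) < R.hi →
      ∀ f, 1 ≤ f → f ≤ w → f ∉ P → ∃ i, stackColoring T w i = f ∧ a ∈ (J i).pts := by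
    intro P hP a ha h1 h2 f hf1 hf2 hfP
    obtain ⟨C, hC, hcard, rfl, -⟩ := hact a ha h1 h2
    have himg : C.image (stackColoring T w) = Finset.Icc 1 w \ P := by
      apply Finset.eq_of_subset_of_card_le
      · intro g hg
        obtain ⟨i, hi, rfl⟩ := Finset.mem_image.1 hg
        rw [Finset.mem_sdiff, Finset.mem_Icc]
        exact ⟨hA.stackRun.color_range i, hP.clique C hC h1 h2 i hi⟩
      · rw [Finset.card_image_of_injOn, Finset.card_sdiff_of_subset, Nat.card_Icc, hP.card_eq]
        · omega
        · exact fun g hg => Finset.mem_Icc.2 (hP.range g hg)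
        · exact fun i hi j hj hij => hA.eq_of_color_eq (ch.cliquePoint_mem C hC i hi)
            (ch.cliquePoint_mem C hC j hj) hij
    have hmem : f ∈ C.image (stackColoring T w) := by
      rw [himg, Finset.mem_sdiff, Finset.mem_Icc]
      exact ⟨⟨hf1, hf2⟩, hfP⟩
    obtain ⟨i, hi, hif⟩ := Finset.mem_image.1 hmem
    exact ⟨i, hif, ch.cliquePoint_mem C hC i hi⟩
  refine ⟨⟨?_, ?_⟩, ⟨?_, ?_, ?_⟩, ?_, ?_, ?_, ?_⟩
  · rcases hlo with h1 | ⟨a, ha, h1, h2, h3⟩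
    · show lo = ⊥ ∨ _
      rw [h1]
      rcases h.boundary.1 with h2 | ⟨C, hC, h2⟩
      · exact Or.inl h2
      · exact Or.inr ⟨C, hC, h2⟩
    · obtain ⟨C, hC, -, h4, -⟩ := hact a ha h2 h3
      exact Or.inr ⟨C, hC, by rw [h4]; exact h1⟩
  · rcases hhi with h1 | ⟨a, ha, h1, h2, h3⟩
    · show hi = ⊤ ∨ _
      rw [h1]
      rcases h.boundary.2 with h2 | ⟨C, hC, h2⟩
      · exact Or.inl h2
      · exact Or.inr ⟨C, hC, h2⟩
    · obtain ⟨C, hC, -, h4, -⟩ := hact a ha h2 h3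
      exact Or.inr ⟨C, hC, by rw [h4]; exact h1⟩
  · intro k
    constructor
    · rintro ⟨hk, hm⟩
      obtain ⟨l, hl, hkl⟩ := (h.family.mem_iff k).1 ⟨hk, hmeets _ hm⟩
      exact ⟨l, hl, Finset.mem_filter.2 ⟨hkl, hm⟩⟩
    · rintro ⟨l, hl, hkl⟩
      have hkl := Finset.mem_filter.1 hkl
      exact ⟨((h.family.mem_iff k).2 ⟨l, hl, hkl.1⟩).1, hkl.2⟩
  · exact fun l hl l' hl' k hk hk' => h.family.disjoint l hl l' hl' k (Finset.mem_filter.1 hk).1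
      (Finset.mem_filter.1 hk').1
  · exact fun l hl k hk k' hk' => h.family.indep l hl k (Finset.mem_filter.1 hk).1 k'
      (Finset.mem_filter.1 hk').1
  · intro k hk hm
    have hin := h.inside k hk (hmeets _ hm)
    obtain ⟨y, hy, hyR⟩ := hm
    intro x hx
    constructor
    · show lo < (x : EReal)
      rcases hlo with h1 | ⟨a, ha, h1, h2, h3⟩
      · rw [h1]; exact (hin x hx).1
      · obtain ⟨-, -, -, -, h4⟩ := hact a ha h2 h3
        have hay : a ≤ y := by
          have : lo ≤ (y : EReal) := hyR.1
          rwa [h1, EReal.coe_le_coe_iff] at this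
        rw [h1, EReal.coe_lt_coe_iff]
        refine RealInterval.forall_gt_of_notMem (h4 k hk) hy (lt_of_le_of_ne hay ?_) x hx
        rintro rfl
        exact h4 k hk hy
    · show (x : EReal) < hi
      rcases hhi with h1 | ⟨a, ha, h1, h2, h3⟩
      · rw [h1]; exact (hin x hx).2
      · obtain ⟨-, -, -, -, h4⟩ := hact a ha h2 h3
        have hay : y ≤ a := by
          have : (y : EReal) ≤ hi := hyR.2
          rwa [h1, EReal.coe_le_coe_iff] at this
        rw [h1, EReal.coe_lt_coe_iff]
        refine RealInterval.forall_lt_of_notMem (h4 k hk) hy (lt_of_le_of_ne hay ?_) x hx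
        rintro rfl
        exact h4 k hk hy
  · exact fun x hx => h.covered x (hsub x hx)
  · exact fun hne => h.labels (restrict_hasNonemptyChain hne)
  · intro hne
    obtain ⟨P, hP⟩ := h.processed (restrict_hasNonemptyChain hne)
    refine ⟨P, hP.card_eq, hP.range, fun i hi => hP.unprocessed_iff i (hmeets _ hi),
      fun k f hk hm => hP.used k f hk (hmeets _ hm), ?_, ?_, ?_⟩
    · intro a ha
      have ha : lo = (a : EReal) := ha
      rcases hlo with h1 | ⟨b, hb, h1, h2, h3⟩
      · exact hP.at_lo a (h1 ▸ ha)
      · have : b = a := EReal.coe_eq_coe_iff.1 (h1 ▸ ha)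
        subst this
        exact hfull P hP b hb h2 h3
    · intro a ha
      have ha : hi = (a : EReal) := ha
      rcases hhi with h1 | ⟨b, hb, h1, h2, h3⟩
      · exact hP.at_hi a (h1 ▸ ha)
      · have : b = a := EReal.coe_eq_coe_iff.1 (h1 ▸ ha)
        subst this
        exact hfull P hP b hb h2 h3
    · exact fun C hC h1 h2 => hP.clique C hC (hlo'.trans_lt h1) (h2.trans_le hhi')

end

/-! ### One iteration -/

theorem hasEvent_iff {J : ι → RealInterval} {R : Region ι κ} {a b : ℝ} (ha : R.lo = a)
    (hb : R.hi = b) {e : Event ι} :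
    R.HasEvent J e ↔ ¬ Event.Before J a e ∧ Event.Before J b e := by
  rcases e with i | i
  · simp only [Region.HasEvent, ha, hb, EReal.coe_lt_coe_iff, EReal.coe_le_coe_iff,
      Event.before_inl]
    push Not
    rfl
  · simp only [Region.HasEvent, ha, hb, EReal.coe_lt_coe_iff, EReal.coe_le_coe_iff,
      Event.before_inr]
    push Not
    rfl

theorem HasEvent.meets {J : ι → RealInterval} {R : Region ι κ} {e : Event ι}
    (h : R.HasEvent J e) : R.Meets (J e.owner) := by
  rcases e with i | i
  · obtain ⟨h1, x, hx, h2⟩ := h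
    exact ⟨x, hx, (h1 x hx).le, h2⟩
  · obtain ⟨⟨x, hx, h1⟩, h2⟩ := h
    exact ⟨x, hx, h1, (h2 x hx).le⟩

theorem earliest_congr {J : ι → RealInterval} {T : List (Event ι)} {R R' : Region ι κ}
    (hlo : R'.lo = R.lo) (hhi : R'.hi = R.hi) (hun : R'.unprocessed = R.unprocessed) :
    earliest J T R' = earliest J T R ∧ latest J T R' = latest J T R := by
  have : unprocessedEvents J T R' = unprocessedEvents J T R := by
    rw [unprocessedEvents, unprocessedEvents]
    refine List.filter_congr fun e _ => ?_
    rw [decide_eq_decide, hun]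
    rcases e with i | i <;> simp only [Region.HasEvent, hlo, hhi]
  rw [earliest, latest, this]
  exact ⟨rfl, rfl⟩

/-- If the intervals of an independent set of uncolored intervals in a region get a new color, which
is neither used in the region by second-batch intervals nor by first-batch intervals overlapping an
interval of the set, then the coloring remains proper. -/
theorem PartialProper.update {J : ι → RealInterval} {K : κ → RealInterval} {w : ℕ}
    {c : ι → ℕ} {S : Finset κ} {f : ℕ} {col col' : κ → Option ℕ}
    (hG : PartialProper J K w c col)
    (hcol' : ∀ k, col' k = col k ∨ k ∈ S ∧ col' k = some f)
    (hS : ∀ k ∈ S, ∀ k' ∈ S, ¬ (overlapGraph K).Adj k k')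
    (hnew : ∀ k ∈ S, ∀ k', (overlapGraph K).Adj k k' → col k' ≠ some f)
    (hfirst : ∀ k ∈ S, ∀ i, ((J i).pts ∩ (K k).pts).Nonempty → c i ≠ f)
    (hf : 1 ≤ f ∧ f ≤ w + w / 2) : PartialProper J K w c col' := by
  refine ⟨fun k k' g hk hk' hadj => ?_, fun k g i hk hi => ?_, fun k g hk => ?_⟩
  · rcases hcol' k with h1 | ⟨h1, h1'⟩ <;> rcases hcol' k' with h2 | ⟨h2, h2'⟩
    · exact hG.proper k k' g (h1 ▸ hk) (h2 ▸ hk') hadj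
    · obtain rfl : f = g := Option.some_injective _ (h2'.symm.trans hk')
      exact hnew k' h2 k hadj.symm (h1 ▸ hk)
    · obtain rfl : f = g := Option.some_injective _ (h1'.symm.trans hk)
      exact hnew k h1 k' hadj (h2 ▸ hk')
    · exact hS k h1 k' h2 hadj
  · rcases hcol' k with h1 | ⟨h1, h1'⟩
    · exact hG.first k g i (h1 ▸ hk) hi
    · obtain rfl : f = g := Option.some_injective _ (h1'.symm.trans hk)
      exact hfirst k h1 i hi
  · rcases hcol' k with h1 | ⟨h1, h1'⟩
    · exact hG.range k g (h1 ▸ hk)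
    · obtain rfl : f = g := Option.some_injective _ (h1'.symm.trans hk)
      exact hf

section

variable [Fintype ι] [Fintype κ] {J : ι → RealInterval} {K : κ → RealInterval} {w : ℕ}
  {T : List (Event ι)} {ch : SecondChoices J K w} {n : ℕ} {R : Region ι κ} {col : κ → Option ℕ}

/-- A region with a nonempty chain is bounded, because of the cliques on both sides. -/
theorem RegionInvariant.exists_bounds (hA : Admissible J K w T) {c : ι → ℕ}
    (h : RegionInvariant ch c n R col) (hact : R.NoActive ch n) {k : κ} (hk : col k = none)
    (hm : R.Meets (K k)) : ∃ a b : ℝ, R.lo = a ∧ R.hi = b := by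
  obtain ⟨x, hx, hxR⟩ := hm
  have hin := h.inside k hk ⟨x, hx, hxR⟩ x hx
  have hlo : R.lo ≠ ⊥ := by
    intro hbot
    obtain ⟨C, hC, hw, hy⟩ := hA.exists_left k
    refine hact C hC (by omega) ⟨by rw [hbot]; exact EReal.bot_lt_coe _, lt_trans ?_ hin.2⟩
    exact EReal.coe_lt_coe_iff.2 (hy _ (ch.cliquePoint_mem C hC) x hx)
  have hhi : R.hi ≠ ⊤ := by
    intro htop
    obtain ⟨C, hC, hw, hy⟩ := hA.exists_right k
    refine hact C hC (by omega) ⟨lt_trans hin.1 ?_, by rw [htop]; exact EReal.coe_lt_top _⟩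
    exact EReal.coe_lt_coe_iff.2 (hy _ (ch.cliquePoint_mem C hC) x hx)
  exact ⟨R.lo.toReal, R.hi.toReal,
    (EReal.coe_toReal (hin.1.trans (EReal.coe_lt_top _)).ne hlo).symm,
    (EReal.coe_toReal hhi ((EReal.bot_lt_coe _).trans hin.2).ne').symm⟩

open scoped Classical in
/-- In a region with a nonempty chain, the earliest and the latest unprocessed first-batch intervals
exist and have the same color.  No other first-batch interval meeting the region has this color, and
no first-batch interval at a point of small depth does. -/
theorem RegionInvariant.exists_extreme (hA : Admissible J K w T)
    (h : RegionInvariant ch (stackColoring T w) n R col) (hact : R.NoActive ch n)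
    (hne : R.HasNonemptyChain) {P : Finset ℕ}
    (hP : ProcessedColors ch (stackColoring T w) n R col P) :
    ∃ j j', earliest J T R = some j ∧ latest J T R = some j' ∧ stackColoring T w j ∉ P ∧
      stackColoring T w j' = stackColoring T w j ∧
      (∀ i, R.Meets (J i) → stackColoring T w i = stackColoring T w j → i = j ∨ i = j') ∧
      ∀ x, R.Has x → (Finset.univ.filter fun i => x ∈ (J i).pts).card < w - n →
        ∀ i, x ∈ (J i).pts → stackColoring T w i ≠ stackColoring T w j := by
  obtain ⟨l, hl, k, hkl⟩ := hne
  obtain ⟨hk, hm⟩ := (h.family.mem_iff k).2 ⟨l, hl, hkl⟩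
  obtain ⟨a, b, ha, hb⟩ := h.exists_bounds hA hact hk hm
  obtain ⟨x₀, hx₀, hx₀R⟩ := hm
  -- the colors that have not been processed
  set F := Finset.Icc 1 w \ P with hF
  have hFmem : ∀ f, f ∈ F ↔ (1 ≤ f ∧ f ≤ w) ∧ f ∉ P := fun f => by
    rw [hF, Finset.mem_sdiff, Finset.mem_Icc]
  have hFcard : F.card = w - n := by
    rw [hF, Finset.card_sdiff_of_subset (fun g hg => Finset.mem_Icc.2 (hP.range g hg)),
      Nat.card_Icc, hP.card_eq, Nat.add_sub_cancel]
  have hhas : ∀ x : ℝ, R.Has x ↔ a ≤ x ∧ x ≤ b := fun x => by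
    rw [Region.Has, ha, hb, EReal.coe_le_coe_iff, EReal.coe_le_coe_iff]
  obtain ⟨j, j', h1, h2, h3, h4, h5, h6⟩ := exists_extreme_intervals hA.order hA.stackRun
    (cp := ch.cliquePoint) ch.cliquePoint_mem (F := F) (a := a) (b := b) (x₀ := x₀)
    (fun f hf => ((hFmem f).1 hf).1) ((hhas x₀).1 hx₀R).1 ((hhas x₀).1 hx₀R).2
    (by rw [hFcard]; exact h.depth_lt hA hx₀R hk hx₀)
    (fun f hf => hP.at_lo a ha f ((hFmem f).1 hf).1.1 ((hFmem f).1 hf).1.2 ((hFmem f).1 hf).2)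
    (fun f hf => hP.at_hi b hb f ((hFmem f).1 hf).1.1 ((hFmem f).1 hf).1.2 ((hFmem f).1 hf).2)
    (by
      intro C hC hcard
      have := hact C hC (by omega)
      rw [ha, hb, EReal.coe_lt_coe_iff, EReal.coe_lt_coe_iff] at this
      by_contra! hcon
      exact this hcon)
    (E := unprocessedEvents J T R) (by
      rw [unprocessedEvents]
      refine List.filter_congr fun e _ => ?_
      rw [decide_eq_decide, hasEvent_iff ha hb, and_assoc]
      refine and_congr_right fun h1 => and_congr_right fun h2 => ?_
      rw [hP.unprocessed_iff _ (HasEvent.meets ((hasEvent_iff ha hb).2 ⟨h1, h2⟩)), hFmem]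
      exact ⟨fun h => ⟨hA.stackRun.color_range _, h⟩, And.right⟩)
  refine ⟨j, j', ?_, ?_, ((hFmem _).1 h3).2, h4, ?_, ?_⟩
  · rw [earliest, h1]; rfl
  · rw [latest, h2]; rfl
  · rintro i ⟨x, hx, hxR⟩
    exact h5 i ⟨x, hx, (hhas x).1 hxR⟩
  · intro x hxR hx
    exact h6 x ((hhas x).1 hxR).1 ((hhas x).1 hxR).2 (by rw [hFcard]; exact hx)

/-- An iteration in one region keeps the invariants.  The common color of the earliest and the
latest unprocessed interval becomes processed; it may be given to the first chain, since the
points of uncolored intervals have small depth, so that no first-batch interval containing them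
has it. -/
theorem colorTwoChains_spec (hA : Admissible J K w T) (hn : 2 * (n + 1) ≤ w)
    (h : RegionInvariant ch (stackColoring T w) n R col) (hact : R.NoActive ch n)
    (hG : PartialProper J K w (stackColoring T w) col) :
    (colorTwoChains ch T (stackColoring T w) (n + 1) R col).1.lo = R.lo ∧
    (colorTwoChains ch T (stackColoring T w) (n + 1) R col).1.hi = R.hi ∧
    RegionInvariant ch (stackColoring T w) (n + 1)
      (colorTwoChains ch T (stackColoring T w) (n + 1) R col).1
      (colorTwoChains ch T (stackColoring T w) (n + 1) R col).2 ∧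
    PartialProper J K w (stackColoring T w)
      (colorTwoChains ch T (stackColoring T w) (n + 1) R col).2 ∧
    ∀ k, (colorTwoChains ch T (stackColoring T w) (n + 1) R col).2 k ≠ col k →
      R.Inside (K k) := by
  classical
  set c := stackColoring T w with hc
  have hcrange : ∀ i, 1 ≤ c i ∧ c i ≤ w := hA.stackRun.color_range
  by_cases hne : R.HasNonemptyChain
  swap
  · have hval : colorTwoChains ch T c (n + 1) R col = (R, col) := if_neg hne
    rw [hval]
    refine ⟨rfl, rfl, ⟨h.boundary, h.family, h.inside, fun x hx => ?_, fun h' => absurd h' hne,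
      fun h' => absurd h' hne⟩, hG, fun k hk => absurd rfl hk⟩
    -- all intervals meeting the region are colored, so that each point is covered fully
    refine le_trans (min_le_left _ _) (Finset.card_le_card fun k hk => ?_)
    have hkx := (Finset.mem_filter.1 hk).2
    refine Finset.mem_filter.2 ⟨mem_coloredSet.2 fun hnone => hne ?_, hkx⟩
    obtain ⟨l, hl, hkl⟩ := (h.family.mem_iff k).1 ⟨hnone, x, hkx, hx⟩
    exact ⟨l, hl, k, hkl⟩
  obtain ⟨P, hP⟩ := h.processed hne
  obtain ⟨j, j', hj, hj', hjP, hcj', honly, havoid⟩ := h.exists_extreme hA hact hne hP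
  set s := createChains ch (n + 1) (coloredSet col) R with hs
  have hlabels := h.labels hne
  obtain ⟨hinv, hunc⟩ := createChains_spec ch (n + 1) (D := coloredSet col) h.family hne
    (by omega) (fun k hk hkD => mem_coloredSet.1 hkD hk.1)
    (fun k x hxR hx hkD => ⟨by_contra fun h => hkD (mem_coloredSet.2 h), x, hx, hxR⟩)
    (fun x hx => h.covered x hx)
  rw [← hs] at hinv hunc
  have hcov : ∀ x, R.Has x → Covered K (n + 1)
      (coloredSet col ∪ s.region.chain s.c₁ ∪ s.region.chain s.c₂) x := by
    intro x hx
    refine covered_of_regionPoints ch h.boundary (fun y hy => ?_) hx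
    by_contra hcon
    have : y ∈ uncovered ch (n + 1) (coloredSet col) s := by
      refine Finset.mem_filter.2 ⟨?_, hcon⟩
      have hy := Finset.mem_filter.1 hy
      exact Finset.mem_filter.2 ⟨hy.1, hinv.has_iff.2 hy.2⟩
    rw [hunc] at this
    simp at this
  obtain ⟨he, hl⟩ := earliest_congr (J := J) (T := T) hinv.lo_eq hinv.hi_eq hinv.unprocessed_eq
  set R' : Region ι κ := { s.region with
        labels := (s.region.labels.erase s.c₁).erase s.c₂
        unprocessed := s.region.unprocessed.filter fun i => some j ≠ some i ∧ some j' ≠ some i }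
    with hR'
  set col' : κ → Option ℕ := fun k =>
        if k ∈ s.region.chain s.c₁ then some (c j)
        else if k ∈ s.region.chain s.c₂ then some (w + (n + 1))
        else col k with hcol'
  have hval : colorTwoChains ch T c (n + 1) R col = (R', col') := by
    rw [colorTwoChains, if_pos hne]
    have hD : (Finset.univ.filter fun k => (col k).isSome = true) = coloredSet col := by
      ext k; simp [coloredSet]
    simp only [hD, ← hs, he, hl, hj, hj']
    rfl
  have hlo : R'.lo = R.lo := hinv.lo_eq
  have hhi : R'.hi = R.hi := hinv.hi_eq
  have hhas : ∀ x, R'.Has x ↔ R.Has x := fun x => by simp only [Region.Has, hlo, hhi]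
  have hmeets : ∀ I, R'.Meets I ↔ R.Meets I := fun I => by simp only [Region.Meets, hhas]
  have hc₁ : s.c₁ ∈ s.region.labels := hinv.labels_eq ▸ hinv.c₁_mem
  have hc₂ : s.c₂ ∈ s.region.labels := hinv.labels_eq ▸ hinv.c₂_mem
  have hmem₁ : ∀ k ∈ s.region.chain s.c₁, col k = none ∧ R.Meets (K k) :=
    fun k hk => (hinv.family.mem_iff k).2 ⟨_, hc₁, hk⟩
  have hmem₂ : ∀ k ∈ s.region.chain s.c₂, col k = none ∧ R.Meets (K k) :=
    fun k hk => (hinv.family.mem_iff k).2 ⟨_, hc₂, hk⟩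
  have hcol'none : ∀ k, col' k = none ↔
      col k = none ∧ k ∉ s.region.chain s.c₁ ∧ k ∉ s.region.chain s.c₂ := by
    intro k
    simp only [hcol']
    split_ifs with h1 h2
    · simp [h1]
    · simp [h2]
    · simp [h1, h2]
  -- uncolored intervals lie inside the region, so that intervals overlapping them meet the region
  have hmeets_adj : ∀ k, col k = none → R.Meets (K k) → ∀ k', (overlapGraph K).Adj k k' →
      R.Meets (K k') := by
    intro k hk hm k' hadj
    obtain ⟨x, hx, hx'⟩ := hadj.2
    have := h.inside k hk hm x hx
    exact ⟨x, hx', this.1.le, this.2.le⟩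
  rw [hval]
  refine ⟨hlo, hhi, ⟨?_, ⟨?_, ?_, ?_⟩, ?_, ?_, ?_, ?_⟩, ?_, ?_⟩
  · unfold Region.HasCliqueBoundary
    rw [hlo, hhi]
    exact h.boundary
  · intro k
    rw [hcol'none, hmeets]
    constructor
    · rintro ⟨⟨hk, h1, h2⟩, hm⟩
      obtain ⟨l, hl, hkl⟩ := (hinv.family.mem_iff k).1 ⟨hk, hm⟩
      refine ⟨l, Finset.mem_erase.2 ⟨?_, Finset.mem_erase.2 ⟨?_, hl⟩⟩, hkl⟩
      · rintro rfl; exact h2 hkl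
      · rintro rfl; exact h1 hkl
    · rintro ⟨l, hl, hkl⟩
      have hl2 := Finset.mem_erase.1 hl
      have hl1 := Finset.mem_erase.1 hl2.2
      have hkl : k ∈ s.region.chain l := hkl
      obtain ⟨hk, hm⟩ := (hinv.family.mem_iff k).2 ⟨l, hl1.2, hkl⟩
      exact ⟨⟨hk, fun h1 => hl1.1 (hinv.family.disjoint l hl1.2 _ hc₁ k hkl h1),
        fun h1 => hl2.1 (hinv.family.disjoint l hl1.2 _ hc₂ k hkl h1)⟩, hm⟩
  · intro l hl l' hl' k hk hk'
    exact hinv.family.disjoint l (Finset.mem_of_mem_erase (Finset.mem_of_mem_erase hl)) l'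
      (Finset.mem_of_mem_erase (Finset.mem_of_mem_erase hl')) k hk hk'
  · intro l hl
    exact hinv.family.indep l (Finset.mem_of_mem_erase (Finset.mem_of_mem_erase hl))
  · intro k hk hm x hx
    rw [hlo, hhi]
    exact h.inside k ((hcol'none k).1 hk).1 ((hmeets _).1 hm) x hx
  · intro x hx
    refine (hcov x ((hhas x).1 hx)).mono fun k hk _ => ?_
    rw [mem_coloredSet, ne_eq, hcol'none]
    rintro ⟨h1, h2, h3⟩
    rcases Finset.mem_union.1 hk with hk | hk
    · rcases Finset.mem_union.1 hk with hk | hk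
      · exact mem_coloredSet.1 hk h1
      · exact h2 hk
    · exact h3 hk
  · intro _
    show ((s.region.labels.erase s.c₁).erase s.c₂).card + 2 * (n + 1) = w
    rw [Finset.card_erase_of_mem (Finset.mem_erase.2 ⟨hinv.ne.symm, hc₂⟩),
      Finset.card_erase_of_mem hc₁, hinv.labels_eq]
    omega
  · intro _
    refine ⟨insert (c j) P, ?_, ?_, ?_, ?_, ?_, ?_, ?_⟩
    · rw [Finset.card_insert_of_notMem hjP, hP.card_eq]
    · intro f hf
      rcases Finset.mem_insert.1 hf with rfl | hf
      · exact hcrange j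
      · exact hP.range f hf
    · intro i hi
      rw [hmeets] at hi
      have h1 := hP.unprocessed_iff i hi
      rw [Finset.mem_insert, not_or, ← h1, Finset.mem_filter, hinv.unprocessed_eq]
      constructor
      · rintro ⟨h2, h3, h4⟩
        refine ⟨fun h5 => ?_, h2⟩
        rcases honly i hi h5 with rfl | rfl
        · exact h3 rfl
        · exact h4 rfl
      · rintro ⟨h2, h3⟩
        refine ⟨h3, fun h4 => h2 ?_, fun h4 => h2 ?_⟩
        · rw [Option.some_injective _ h4]
        · exact (congrArg c (Option.some_injective _ h4)).symm.trans hcj'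
    · intro k f hk hm
      rw [hmeets] at hm
      simp only [hcol'] at hk
      split_ifs at hk with h1 h2
      · rw [Option.some.injEq] at hk
        exact Or.inl (by simp [hk])
      · rw [Option.some.injEq] at hk
        exact Or.inr (by omega)
      · rcases hP.used k f hk hm with h3 | h3
        · exact Or.inl (Finset.mem_insert_of_mem h3)
        · exact Or.inr (by omega)
    · intro a ha f h1 h2 h3
      exact hP.at_lo a (hlo ▸ ha) f h1 h2 fun h4 => h3 (Finset.mem_insert_of_mem h4)
    · intro a ha f h1 h2 h3
      exact hP.at_hi a (hhi ▸ ha) f h1 h2 fun h4 => h3 (Finset.mem_insert_of_mem h4)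
    · intro C hC h1 h2 i hi hmem
      rw [hlo] at h1
      rw [hhi] at h2
      rcases Finset.mem_insert.1 hmem with h3 | h3
      · -- the clique point is not active, so that it is a point of small depth
        refine havoid (ch.cliquePoint C) ⟨h1.le, h2.le⟩ ?_ i (ch.cliquePoint_mem C hC i hi) h3
        have h4 : (Finset.univ.filter fun i => ch.cliquePoint C ∈ (J i).pts) = C := by
          ext i
          rw [Finset.mem_filter, hC.mem_iff (ch.cliquePoint_mem C hC)]
          simp
        rw [h4]
        by_contra hcard
        exact hact C hC (by omega) ⟨h1, h2⟩
      · exact hP.clique C hC h1 h2 i hi h3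
  · -- the two chains are colored one after the other
    have hG₂ : PartialProper J K w c fun k =>
        if k ∈ s.region.chain s.c₂ then some (w + (n + 1)) else col k := by
      refine hG.update (S := s.region.chain s.c₂) (f := w + (n + 1)) ?_
        (hinv.family.indep _ hc₂) ?_ ?_ (by omega)
      · intro k
        by_cases h1 : k ∈ s.region.chain s.c₂
        · exact Or.inr ⟨h1, by simp [h1]⟩
        · exact Or.inl (by simp [h1])
      · intro k hk k' hadj hk'
        have hm := hmeets_adj k (hmem₂ k hk).1 (hmem₂ k hk).2 k' hadj
        rcases hP.used k' _ hk' hm with h1 | h1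
        · have := (hP.range _ h1).2
          omega
        · omega
      · intro k hk i _
        have := (hcrange i).2
        omega
    refine hG₂.update (S := s.region.chain s.c₁) (f := c j) ?_ (hinv.family.indep _ hc₁) ?_ ?_ ?_
    · intro k
      by_cases h1 : k ∈ s.region.chain s.c₁
      · exact Or.inr ⟨h1, by simp [hcol', h1]⟩
      · exact Or.inl (by simp [hcol', h1])
    · intro k hk k' hadj hk'
      have hm := hmeets_adj k (hmem₁ k hk).1 (hmem₁ k hk).2 k' hadj
      have := (hcrange j).2
      split_ifs at hk' with h1
      · rw [Option.some.injEq] at hk'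
        omega
      · rcases hP.used k' _ hk' hm with h1 | h1
        · exact hjP h1
        · omega
    · rintro k hk i ⟨x, hxi, hxk⟩
      obtain ⟨hkn, hkm⟩ := hmem₁ k hk
      have hxR := h.inside k hkn hkm x hxk
      exact havoid x ⟨hxR.1.le, hxR.2.le⟩
        (h.depth_lt hA ⟨hxR.1.le, hxR.2.le⟩ hkn hxk) i hxi
    · have := hcrange j
      omega
  · intro k hk
    have : k ∈ s.region.chain s.c₁ ∨ k ∈ s.region.chain s.c₂ := by
      by_contra! hcon
      exact hk (by simp [hcol', hcon.1, hcon.2])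
    rcases this with h1 | h1
    · exact h.inside k (hmem₁ k h1).1 (hmem₁ k h1).2
    · exact h.inside k (hmem₂ k h1).1 (hmem₂ k h1).2

/-- After the last step all intervals meeting the region are colored, since the region had at most
`w - 2 * (w / 2) ≤ 1` chains left. -/
theorem colorLastChain_spec (hA : Admissible J K w T)
    (h : RegionInvariant ch (stackColoring T w) (w / 2) R col) (hact : R.NoActive ch (w / 2))
    (hG : PartialProper J K w (stackColoring T w) col) (i : ℕ) :
    (colorLastChain ch T (stackColoring T w) i R col).1.lo = R.lo ∧
    (colorLastChain ch T (stackColoring T w) i R col).1.hi = R.hi ∧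
    (∀ k, (colorLastChain ch T (stackColoring T w) i R col).1.Meets (K k) →
      (colorLastChain ch T (stackColoring T w) i R col).2 k ≠ none) ∧
    PartialProper J K w (stackColoring T w)
      (colorLastChain ch T (stackColoring T w) i R col).2 ∧
    ∀ k, (colorLastChain ch T (stackColoring T w) i R col).2 k ≠ col k → R.Inside (K k) := by
  classical
  set c := stackColoring T w with hc
  have hcrange : ∀ i, 1 ≤ c i ∧ c i ≤ w := hA.stackRun.color_range
  by_cases hne : R.HasNonemptyChain
  swap
  · have hval : colorLastChain ch T c i R col = (R, col) := if_neg hne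
    rw [hval]
    refine ⟨rfl, rfl, fun k hm hk => hne ?_, hG, fun k hk => absurd rfl hk⟩
    obtain ⟨l, hl, hkl⟩ := (h.family.mem_iff k).1 ⟨hk, hm⟩
    exact ⟨l, hl, k, hkl⟩
  obtain ⟨P, hP⟩ := h.processed hne
  obtain ⟨j, j', hj, hj', hjP, hcj', honly, havoid⟩ := h.exists_extreme hA hact hne hP
  set l := ch.pick i R [] (R.labels.filter fun l => (R.chain l).Nonempty) with hl
  have hlmem : l ∈ R.labels := by
    obtain ⟨l', hl', hne'⟩ := hne
    exact (Finset.mem_filter.1 (ch.pick_mem i R [] _ ⟨l', Finset.mem_filter.2 ⟨hl', hne'⟩⟩)).1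
  have hone : ∀ l' ∈ R.labels, l' = l := by
    have h1 := h.labels hne
    have h2 : R.labels.card ≤ 1 := by omega
    exact fun l' hl' => Finset.card_le_one.1 h2 l' hl' l hlmem
  set col' : κ → Option ℕ := fun k => if k ∈ R.chain l then some (c j) else col k with hcol'
  have hval : colorLastChain ch T c i R col = (R, col') := by
    rw [colorLastChain, if_pos hne]
    simp only [hj]
    rfl
  have hmem : ∀ k ∈ R.chain l, col k = none ∧ R.Meets (K k) :=
    fun k hk => (h.family.mem_iff k).2 ⟨_, hlmem, hk⟩
  rw [hval]
  refine ⟨rfl, rfl, fun k hm hk => ?_, ?_, fun k hk => ?_⟩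
  · simp only [hcol'] at hk
    split_ifs at hk with h1
    obtain ⟨l', hl', hkl⟩ := (h.family.mem_iff k).1 ⟨hk, hm⟩
    exact h1 (hone l' hl' ▸ hkl)
  · refine hG.update (S := R.chain l) (f := c j) ?_ (h.family.indep _ hlmem) ?_ ?_ ?_
    · intro k
      by_cases h1 : k ∈ R.chain l
      · exact Or.inr ⟨h1, by simp [hcol', h1]⟩
      · exact Or.inl (by simp [hcol', h1])
    · intro k hk k' hadj hk'
      obtain ⟨x, hx, hx'⟩ := hadj.2
      have hin := h.inside k (hmem k hk).1 (hmem k hk).2 x hx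
      have := (hcrange j).2
      rcases hP.used k' _ hk' ⟨x, hx', hin.1.le, hin.2.le⟩ with h1 | h1
      · exact hjP h1
      · omega
    · rintro k hk i ⟨x, hxi, hxk⟩
      obtain ⟨hkn, hkm⟩ := hmem k hk
      have hxR := h.inside k hkn hkm x hxk
      exact havoid x ⟨hxR.1.le, hxR.2.le⟩
        (h.depth_lt hA ⟨hxR.1.le, hxR.2.le⟩ hkn hxk) i hxi
    · have := hcrange j
      omega
  · have h1 : k ∈ R.chain l := by
      by_contra hcon
      exact hk (by simp [hcol', hcon])
    exact h.inside k (hmem k h1).1 (hmem k h1).2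

end

/-! ### The coloring of the second batch -/

section

variable [Fintype ι] [Fintype κ] {J : ι → RealInterval} {K : κ → RealInterval} {w : ℕ}
  {T : List (Event ι)} {ch : SecondChoices J K w}

/-- The invariant of the main loop. -/
structure LoopInvariant (ch : SecondChoices J K w) (c : ι → ℕ) (n : ℕ)
    (st : List (Region ι κ) × (κ → Option ℕ)) : Prop where
  partition : RegionsPartition st.1
  region : ∀ R ∈ st.1, RegionInvariant ch c n R st.2
  proper : PartialProper J K w c st.2

theorem loopInvariant_initial (T : List (Event ι)) :
    LoopInvariant ch (stackColoring T w) 0 ([initialRegion ch], fun _ => none) := by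
  classical
  have hmeets : ∀ I, (initialRegion ch).Meets I := fun I => by
    obtain ⟨x, hx⟩ := I.pts_nonempty
    exact ⟨x, hx, bot_le, le_top⟩
  refine ⟨⟨?_, List.pairwise_singleton _ _, ?_⟩, ?_, ⟨?_, ?_, ?_⟩⟩
  · intro R hR
    rw [List.mem_singleton.1 hR]
    exact bot_le
  · exact fun x => ⟨_, List.mem_singleton_self _, bot_le, le_top⟩
  · intro R hR
    rw [List.mem_singleton.1 hR]
    refine ⟨⟨Or.inl rfl, Or.inl rfl⟩, ⟨?_, ?_, ?_⟩, ?_, ?_, ?_, ?_⟩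
    · intro k
      refine ⟨fun _ => ⟨ch.initialChain k, Finset.mem_range.2 (ch.initialChain_lt k), ?_⟩,
        fun _ => ⟨rfl, hmeets _⟩⟩
      simp [initialRegion]
    · intro l _ l' _ k hk hk'
      simp only [initialRegion, Finset.mem_filter, Finset.mem_univ, true_and] at hk hk'
      rw [← hk, hk']
    · intro l _ k hk k' hk' hadj
      simp only [initialRegion, Finset.mem_filter, Finset.mem_univ, true_and] at hk hk'
      exact ch.initialChain_proper k k' hadj (hk.trans hk'.symm)
    · exact fun k _ _ x _ => ⟨EReal.bot_lt_coe x, EReal.coe_lt_top x⟩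
    · intro x _
      simp [Covered]
    · intro _
      simp [initialRegion]
    · intro _
      refine ⟨∅, rfl, by simp, ?_, by simp, ?_, ?_, by simp⟩
      · intro i _
        simp [initialRegion]
      · intro a ha
        exact absurd ha (EReal.bot_lt_coe a).ne
      · intro a ha
        exact absurd ha (EReal.coe_lt_top a).ne'
  all_goals intros; simp_all

/-- The state after the splitting of the regions. -/
theorem LoopInvariant.split (hA : Admissible J K w T) {n : ℕ}
    {st : List (Region ι κ) × (κ → Option ℕ)} (h : LoopInvariant ch (stackColoring T w) n st) :
    RegionsPartition (splitRegions ch (n + 1) st.1) ∧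
      ∀ R ∈ splitRegions ch (n + 1) st.1,
        RegionInvariant ch (stackColoring T w) n R st.2 ∧ R.NoActive ch n := by
  obtain ⟨h1, h2⟩ := splitRegions_spec ch (n + 1) h.partition
  refine ⟨h1, fun R' hR' => ?_⟩
  obtain ⟨R, hR, lo, hi, rfl, hlo, hhi, hlo', hhi', hno⟩ := h2 R' hR'
  refine ⟨(h.region R hR).restrict hA hlo hhi hlo' hhi', fun C hC hcard hlt => ?_⟩
  exact hno _ (mem_activePoints.2 ⟨C, ⟨hC, by omega⟩, rfl⟩) hlt

theorem LoopInvariant.iteration (hA : Admissible J K w T) {n : ℕ} (hn : 2 * (n + 1) ≤ w)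
    {st : List (Region ι κ) × (κ → Option ℕ)} (h : LoopInvariant ch (stackColoring T w) n st) :
    LoopInvariant ch (stackColoring T w) (n + 1)
      (iteration ch T (stackColoring T w) st (n + 1)) := by
  obtain ⟨h1, h2⟩ := h.split hA
  obtain ⟨h3, h4, h5, -⟩ := forRegions_spec (K := K)
    (body := colorTwoChains ch T (stackColoring T w) (n + 1))
    (Q := fun R col => RegionInvariant ch (stackColoring T w) n R col ∧ R.NoActive ch n)
    (Q' := RegionInvariant ch (stackColoring T w) (n + 1))
    (G := PartialProper J K w (stackColoring T w))
    (fun R col col' hQ hcol => ⟨hQ.1.congr hcol, hQ.2⟩) (fun R col col' hQ hcol => hQ.congr hcol)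
    (fun R col hQ hG => colorTwoChains_spec hA hn hQ.1 hQ.2 hG) h1.pairwise h2 h.proper
  exact ⟨h1.of_forall₂ h5, h3, h4⟩

/-- The second-batch algorithm produces a coloring that is proper, also with respect to the first
batch, and uses colors among `1, …, w + ⌊w / 2⌋`. -/
theorem secondColoring_spec (hA : Admissible J K w T) (ch : SecondChoices J K w) :
    (∀ k k', (overlapGraph K).Adj k k' →
      secondColoring ch T (stackColoring T w) k ≠ secondColoring ch T (stackColoring T w) k') ∧
    (∀ k i, ((J i).pts ∩ (K k).pts).Nonempty →
      stackColoring T w i ≠ secondColoring ch T (stackColoring T w) k) ∧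
    ∀ k, 1 ≤ secondColoring ch T (stackColoring T w) k ∧
      secondColoring ch T (stackColoring T w) k ≤ w + w / 2 := by
  have hloop : ∀ m, 2 * m ≤ w → LoopInvariant ch (stackColoring T w) m
      ((List.range' 1 m).foldl (iteration ch T (stackColoring T w))
        ([initialRegion ch], fun _ => none)) := by
    intro m
    induction m with
    | zero => exact fun _ => loopInvariant_initial T
    | succ m ih =>
      intro hm
      rw [List.range'_1_concat, List.foldl_append, List.foldl_cons, List.foldl_nil, add_comm 1 m]
      exact (ih (by omega)).iteration hA hm
  have h := hloop (w / 2) (by omega)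
  set st := (List.range' 1 (w / 2)).foldl (iteration ch T (stackColoring T w))
    ([initialRegion ch], fun _ => none) with hst
  obtain ⟨h1, h2⟩ := h.split hA
  obtain ⟨h3, h4, h5, -⟩ := forRegions_spec (K := K)
    (body := colorLastChain ch T (stackColoring T w) (w / 2 + 1))
    (Q := fun R col => RegionInvariant ch (stackColoring T w) (w / 2) R col ∧
      R.NoActive ch (w / 2))
    (Q' := fun R col => ∀ k, R.Meets (K k) → col k ≠ none)
    (G := PartialProper J K w (stackColoring T w))
    (fun R col col' hQ hcol => ⟨hQ.1.congr hcol, hQ.2⟩)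
    (fun R col col' hQ hcol k hk => by rw [hcol k hk]; exact hQ k hk)
    (fun R col hQ hG => colorLastChain_spec hA hQ.1 hQ.2 hG _) h1.pairwise h2 h.proper
  set fin := forRegions (colorLastChain ch T (stackColoring T w) (w / 2 + 1))
    (splitRegions ch (w / 2 + 1) st.1) st.2 with hfin
  have hcol : ∀ k, fin.2 k = some (secondColoring ch T (stackColoring T w) k) := by
    intro k
    obtain ⟨x, hx⟩ := (K k).pts_nonempty
    obtain ⟨R, hR, hxR⟩ := (h1.of_forall₂ h5).cover x
    obtain ⟨f, hf⟩ := Option.ne_none_iff_exists'.1 (h3 R hR k ⟨x, hx, hxR⟩)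
    have : secondColoring ch T (stackColoring T w) k = (fin.2 k).getD 0 := rfl
    rw [this, hf]
    rfl
  refine ⟨fun k k' hadj heq => ?_, fun k i hi => h4.first k _ i (hcol k) hi,
    fun k => h4.range k _ (hcol k)⟩
  exact h4.proper k k' _ (hcol k) (heq ▸ hcol k') hadj

end

/-! ### Dummy cliques -/

theorem mem_closedBall {a r x : ℝ} {hr : 0 ≤ r} :
    x ∈ (closedBall a r hr).pts ↔ a - r ≤ x ∧ x ≤ a + r := by
  simp [RealInterval.pts, closedBall, le_iff_lt_or_eq, eq_comm]

theorem IsEventOrder.append {ι₁ ι₂ : Type} {J₁ : ι₁ → RealInterval} {J₂ : ι₂ → RealInterval}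
    {T₁ : List (Event ι₁)} {T₂ : List (Event ι₂)} (h₁ : IsEventOrder J₁ T₁)
    (h₂ : IsEventOrder J₂ T₂)
    (h : ∀ (e₁ : Event ι₁) (e₂ : Event ι₂), e₁.position J₁ ≤ e₂.position J₂) :
    IsEventOrder (Sum.elim J₁ J₂)
      (T₁.map (Sum.map Sum.inl Sum.inl) ++ T₂.map (Sum.map Sum.inr Sum.inr)) := by
  have hp₁ : ∀ e : Event ι₁,
      Event.position (Sum.elim J₁ J₂) (Sum.map Sum.inl Sum.inl e) = e.position J₁ := by
    rintro (e | e) <;> rfl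
  have hp₂ : ∀ e : Event ι₂,
      Event.position (Sum.elim J₁ J₂) (Sum.map Sum.inr Sum.inr e) = e.position J₂ := by
    rintro (e | e) <;> rfl
  refine ⟨?_, ?_, ?_⟩
  · refine List.nodup_append.2 ⟨h₁.1.map (Sum.map_injective.2 ⟨Sum.inl_injective,
      Sum.inl_injective⟩), h₂.1.map (Sum.map_injective.2 ⟨Sum.inr_injective,
      Sum.inr_injective⟩), ?_⟩
    intro e he e' he'
    obtain ⟨d, -, rfl⟩ := List.mem_map.1 he
    obtain ⟨d', -, rfl⟩ := List.mem_map.1 he'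
    rcases d with d | d <;> rcases d' with d' | d' <;> simp
  · rintro ((i | i) | (i | i)) <;> rw [List.mem_append]
    · exact Or.inl (List.mem_map.2 ⟨Sum.inl i, h₁.2.1 _, rfl⟩)
    · exact Or.inr (List.mem_map.2 ⟨Sum.inl i, h₂.2.1 _, rfl⟩)
    · exact Or.inl (List.mem_map.2 ⟨Sum.inr i, h₁.2.1 _, rfl⟩)
    · exact Or.inr (List.mem_map.2 ⟨Sum.inr i, h₂.2.1 _, rfl⟩)
  · refine List.pairwise_append.2 ⟨?_, ?_, ?_⟩
    · rw [List.pairwise_map]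
      simpa only [hp₁] using h₁.2.2
    · rw [List.pairwise_map]
      simpa only [hp₂] using h₂.2.2
    · intro e he e' he'
      obtain ⟨d, -, rfl⟩ := List.mem_map.1 he
      obtain ⟨d', -, rfl⟩ := List.mem_map.1 he'
      rw [hp₁, hp₂]
      exact h d d'

theorem isEventOrder_nestedEvents (w : ℕ) (a : ℝ)
    (h : ∀ k : Fin w, (0 : ℝ) ≤ (w : ℝ) - (k : ℕ)) :
    IsEventOrder (fun k : Fin w => closedBall a ((w : ℝ) - (k : ℕ)) (h k)) (nestedEvents w) := by
  have hlt := List.pairwise_lt_finRange w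
  refine ⟨?_, ?_, ?_⟩
  · refine List.nodup_append.2 ⟨(List.nodup_finRange w).map Sum.inl_injective,
      (List.nodup_reverse.2 (List.nodup_finRange w)).map Sum.inr_injective, ?_⟩
    intro e he e' he'
    obtain ⟨d, -, rfl⟩ := List.mem_map.1 he
    obtain ⟨d', -, rfl⟩ := List.mem_map.1 he'
    simp
  · rintro (k | k) <;> simp [nestedEvents]
  · refine List.pairwise_append.2 ⟨?_, ?_, ?_⟩
    · rw [List.pairwise_map]
      refine hlt.imp fun {j k} hjk => ?_
      have : ((j : ℕ) : ℝ) < (k : ℕ) := by exact_mod_cast hjk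
      exact Prod.Lex.toLex_le_toLex.2 (Or.inl (by simp only [closedBall]; linarith))
    · rw [List.pairwise_map, List.pairwise_reverse]
      refine hlt.imp fun {j k} hjk => ?_
      have : ((j : ℕ) : ℝ) < (k : ℕ) := by exact_mod_cast hjk
      exact Prod.Lex.toLex_le_toLex.2 (Or.inl (by simp only [closedBall]; linarith))
    · intro e he e' he'
      obtain ⟨j, -, rfl⟩ := List.mem_map.1 he
      obtain ⟨k, -, rfl⟩ := List.mem_map.1 he'
      have hj := h j
      have hk := h k
      have hj' : ((j : ℕ) : ℝ) < w := by exact_mod_cast j.2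
      exact Prod.Lex.toLex_le_toLex.2 (Or.inl (by simp only [closedBall]; linarith))

theorem mem_Icc_of_mem_pts {I : RealInterval} {x : ℝ} (hx : x ∈ I.pts) :
    I.lo ≤ x ∧ x ≤ I.hi := by
  refine ⟨?_, ?_⟩
  · rcases hx.1 with h | h
    · exact h.le
    · exact h.1.ge
  · rcases hx.2 with h | h
    · exact h.le
    · exact h.1.le

section

variable (B₁ B₂ : Batch)

theorem one_le_bound : 1 ≤ bound B₁ B₂ := by
  unfold bound
  have : 0 ≤ ∑ v, (|(allIntervals B₁ B₂ v).lo| + |(allIntervals B₁ B₂ v).hi|) :=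
    Finset.sum_nonneg fun v _ => by positivity
  linarith

theorem endpoints_lt_bound (v : Fin B₁.size ⊕ Fin B₂.size) :
    -bound B₁ B₂ < (allIntervals B₁ B₂ v).lo ∧ (allIntervals B₁ B₂ v).lo < bound B₁ B₂ ∧
    -bound B₁ B₂ < (allIntervals B₁ B₂ v).hi ∧ (allIntervals B₁ B₂ v).hi < bound B₁ B₂ := by
  have h := Finset.single_le_sum
    (f := fun v => |(allIntervals B₁ B₂ v).lo| + |(allIntervals B₁ B₂ v).hi|)
    (fun v _ => by positivity) (Finset.mem_univ v)
  have h1 := abs_nonneg (allIntervals B₁ B₂ v).lo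
  have h2 := abs_nonneg (allIntervals B₁ B₂ v).hi
  have h3 := neg_abs_le (allIntervals B₁ B₂ v).lo
  have h4 := neg_abs_le (allIntervals B₁ B₂ v).hi
  have h5 := le_abs_self (allIntervals B₁ B₂ v).lo
  have h6 := le_abs_self (allIntervals B₁ B₂ v).hi
  simp only [bound] at *
  refine ⟨?_, ?_, ?_, ?_⟩ <;> linarith

variable {B₁ B₂}

theorem mem_lt_bound {v : Fin B₁.size ⊕ Fin B₂.size} {x : ℝ}
    (hx : x ∈ (allIntervals B₁ B₂ v).pts) : -bound B₁ B₂ < x ∧ x < bound B₁ B₂ := by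
  have h1 := mem_Icc_of_mem_pts hx
  have h2 := endpoints_lt_bound B₁ B₂ v
  exact ⟨h2.1.trans_le h1.1, h1.2.trans_lt h2.2.2.2⟩

theorem le_of_mem_leftDummy {k : Fin (omega B₁ B₂)} {x : ℝ}
    (hx : x ∈ (extended B₁ B₂ (Sum.inl k)).pts) : x ≤ -bound B₁ B₂ := by
  have h := ((mem_closedBall (hr := sub_nonneg.2 (Nat.cast_le.2 k.2.le))).1 hx).2
  have : (0 : ℝ) ≤ (k : ℕ) := Nat.cast_nonneg _
  linarith

theorem ge_of_mem_rightDummy {k : Fin (omega B₁ B₂)} {x : ℝ}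
    (hx : x ∈ (extended B₁ B₂ (Sum.inr (Sum.inr k))).pts) : bound B₁ B₂ ≤ x := by
  have h := ((mem_closedBall (hr := sub_nonneg.2 (Nat.cast_le.2 k.2.le))).1 hx).1
  have : (0 : ℝ) ≤ (k : ℕ) := Nat.cast_nonneg _
  linarith

theorem isEventOrder_extendedOrder {T : List (Event (Fin B₁.size))}
    (hT : IsEventOrder B₁.interval T) :
    IsEventOrder (extended B₁ B₂) (extendedOrder B₁ B₂ T) := by
  have hb := one_le_bound B₁ B₂
  have hk : ∀ k : Fin (omega B₁ B₂), (0 : ℝ) ≤ (omega B₁ B₂ : ℝ) - (k : ℕ) :=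
    fun k => sub_nonneg.2 (Nat.cast_le.2 k.2.le)
  have hw : (0 : ℝ) ≤ omega B₁ B₂ := Nat.cast_nonneg _
  have h2 := hT.append (isEventOrder_nestedEvents (omega B₁ B₂) (bound B₁ B₂ + omega B₁ B₂) hk) (by
    intro e₁ e₂
    have h1 : (ofLex (e₁.position B₁.interval)).1 < bound B₁ B₂ := by
      rcases e₁ with i | i
      · exact (endpoints_lt_bound B₁ B₂ (Sum.inl i)).2.1
      · exact (endpoints_lt_bound B₁ B₂ (Sum.inl i)).2.2.2
    refine Prod.Lex.le_iff.2 (Or.inl (h1.trans_le ?_))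
    rcases e₂ with k | k
    · have : (0 : ℝ) ≤ (k : ℕ) := Nat.cast_nonneg _
      show bound B₁ B₂ ≤ bound B₁ B₂ + omega B₁ B₂ - ((omega B₁ B₂ : ℝ) - (k : ℕ))
      linarith
    · have := hk k
      show bound B₁ B₂ ≤ bound B₁ B₂ + omega B₁ B₂ + ((omega B₁ B₂ : ℝ) - (k : ℕ))
      linarith)
  have h3 := (isEventOrder_nestedEvents (omega B₁ B₂) (-(bound B₁ B₂ + omega B₁ B₂)) hk).append
    h2 (by
      intro e₁ e₂
      have h1 : (ofLex (e₁.position (fun k : Fin (omega B₁ B₂) =>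
          closedBall (-(bound B₁ B₂ + omega B₁ B₂)) ((omega B₁ B₂ : ℝ) - (k : ℕ)) (hk k)))).1 ≤
          -bound B₁ B₂ := by
        rcases e₁ with k | k
        · have := hk k
          show -(bound B₁ B₂ + omega B₁ B₂) - ((omega B₁ B₂ : ℝ) - (k : ℕ)) ≤ _
          linarith
        · have : (0 : ℝ) ≤ (k : ℕ) := Nat.cast_nonneg _
          show -(bound B₁ B₂ + omega B₁ B₂) + ((omega B₁ B₂ : ℝ) - (k : ℕ)) ≤ _
          linarith
      refine Prod.Lex.le_iff.2 (Or.inl (h1.trans_lt ?_))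
      rcases e₂ with (i | k) | (i | k)
      · exact (endpoints_lt_bound B₁ B₂ (Sum.inl i)).1
      · have : (0 : ℝ) ≤ (k : ℕ) := Nat.cast_nonneg _
        show _ < bound B₁ B₂ + omega B₁ B₂ - ((omega B₁ B₂ : ℝ) - (k : ℕ))
        linarith
      · exact (endpoints_lt_bound B₁ B₂ (Sum.inl i)).2.2.1
      · have := hk k
        show _ < bound B₁ B₂ + omega B₁ B₂ + ((omega B₁ B₂ : ℝ) - (k : ℕ))
        linarith)
  have hlist : extendedOrder B₁ B₂ T =
      (nestedEvents (omega B₁ B₂)).map (Sum.map Sum.inl Sum.inl) ++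
      (T.map (Sum.map Sum.inl Sum.inl) ++
        (nestedEvents (omega B₁ B₂)).map (Sum.map Sum.inr Sum.inr)).map
          (Sum.map Sum.inr Sum.inr) := by
    simp only [extendedOrder, List.map_append, List.map_map, List.append_assoc, Sum.map_comp_map]
  rw [hlist]
  exact h3

theorem isClique_card_le_omega {s : Finset (Fin B₁.size ⊕ Fin B₂.size)}
    (hs : (overlapGraph (allIntervals B₁ B₂)).IsClique (s : Set _)) : s.card ≤ omega B₁ B₂ :=
  SimpleGraph.IsClique.card_le_cliqueNum (tc := hs)

/-- The dummy intervals `d` form a maximal clique if all of them contain the point `a`, and no other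
interval meets them. -/
theorem isMaximalClique_range {ι : Type} {w : ℕ} {J : ι → RealInterval} {d : Fin w → ι}
    {a : ℝ} (ha : ∀ k, a ∈ (J (d k)).pts) (k : Fin w)
    (hd : ∀ i, ((J i).pts ∩ (J (d k)).pts).Nonempty → i ∈ Set.range d) :
    ∃ C, IsMaximalClique J C ∧ (Function.Injective d → C.card = w) ∧ ∀ k, d k ∈ C := by
  classical
  refine ⟨Finset.univ.image d, ⟨?_, ?_⟩, fun hinj => ?_, fun k => by simp⟩
  · apply isClique_of_mem (x := a)
    intro i hi
    obtain ⟨k, -, rfl⟩ := Finset.mem_image.1 (Finset.mem_coe.1 hi)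
    exact ha k
  · intro t ht hle i hi
    rw [Finset.mem_image]
    have hk : d k ∈ t := hle (by simp)
    by_cases hik : i = d k
    · exact ⟨k, Finset.mem_univ _, hik.symm⟩
    · obtain ⟨k', hk'⟩ := hd i (ht hi hk hik).2
      exact ⟨k', Finset.mem_univ _, hk'⟩
  · rw [Finset.card_image_of_injective _ hinj, Finset.card_univ, Fintype.card_fin]

/-- A point is either in intervals of the input only or in intervals of one dummy clique only, so
that its depth is at most `omega B₁ B₂`. -/
theorem admissible_extended {T : List (Event (Fin B₁.size))} (hT : IsEventOrder B₁.interval T) :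
    Admissible (extended B₁ B₂) B₂.interval (omega B₁ B₂) (extendedOrder B₁ B₂ T) := by
  classical
  have hb := one_le_bound B₁ B₂
  have hkw : ∀ k : Fin (omega B₁ B₂), ((k : ℕ) : ℝ) ≤ omega B₁ B₂ := fun k => by
    exact_mod_cast k.2.le
  -- if there is an interval in the second batch, then the dummy cliques are nonempty
  have hw : Fin B₂.size → 0 < omega B₁ B₂ := by
    intro k
    have : ({Sum.inr k} : Finset (Fin B₁.size ⊕ Fin B₂.size)).card ≤ omega B₁ B₂ :=
      isClique_card_le_omega (by simp)
    exact this
  refine ⟨isEventOrder_extendedOrder hT, ?_, ?_, ?_⟩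
  · intro x
    have hL : (∑ k : Fin (omega B₁ B₂),
        if x ∈ (extended B₁ B₂ (Sum.inl k)).pts then 1 else 0) ≤ omega B₁ B₂ := by
      rw [← Finset.card_filter]
      exact (Finset.card_filter_le _ _).trans (by simp)
    have hR : (∑ k : Fin (omega B₁ B₂),
        if x ∈ (extended B₁ B₂ (Sum.inr (Sum.inr k))).pts then 1 else 0) ≤ omega B₁ B₂ := by
      rw [← Finset.card_filter]
      exact (Finset.card_filter_le _ _).trans (by simp)
    have hM : (∑ i, if x ∈ (B₁.interval i).pts then 1 else 0) +
        (∑ k, if x ∈ (B₂.interval k).pts then 1 else 0) ≤ omega B₁ B₂ := by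
      have h := isClique_card_le_omega (B₁ := B₁) (B₂ := B₂)
        (s := Finset.univ.filter fun v => x ∈ (allIntervals B₁ B₂ v).pts)
        (isClique_of_mem (x := x) (by simp))
      rw [Finset.card_filter, Fintype.sum_sum_type] at h
      exact h
    rw [Finset.card_filter, Finset.card_filter, Fintype.sum_sum_type, Fintype.sum_sum_type]
    have hM' : (∑ i : Fin B₁.size, if x ∈ (extended B₁ B₂ (Sum.inr (Sum.inl i))).pts then 1 else 0)
        = ∑ i, if x ∈ (B₁.interval i).pts then 1 else 0 := rfl
    rw [hM']
    have zero : ∀ {n : ℕ} {q : Fin n → Prop}, (∀ i, ¬ q i) →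
        (∑ i : Fin n, if q i then 1 else 0) = 0 :=
      fun {n q} hq => Finset.sum_eq_zero fun i _ => if_neg (hq i)
    -- three cases: the point is to the left of, between, or to the right of the bounds
    rcases le_or_gt x (-bound B₁ B₂) with h1 | h1
    · rw [zero (q := fun i => x ∈ (B₁.interval i).pts)
        (fun i hi => (mem_lt_bound (B₁ := B₁) (B₂ := B₂) (v := Sum.inl i) hi).1.not_ge h1),
        zero (q := fun i => x ∈ (B₂.interval i).pts)
        (fun i hi => (mem_lt_bound (B₁ := B₁) (B₂ := B₂) (v := Sum.inr i) hi).1.not_ge h1),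
        zero (q := fun k => x ∈ (extended B₁ B₂ (Sum.inr (Sum.inr k))).pts)
        (fun k hk => by have := ge_of_mem_rightDummy hk; linarith)]
      omega
    · rw [zero (q := fun k => x ∈ (extended B₁ B₂ (Sum.inl k)).pts)
        (fun k hk => by have := le_of_mem_leftDummy hk; linarith)]
      rcases le_or_gt (bound B₁ B₂) x with h2 | h2
      · rw [zero (q := fun i => x ∈ (B₁.interval i).pts)
          (fun i hi => (mem_lt_bound (B₁ := B₁) (B₂ := B₂) (v := Sum.inl i) hi).2.not_ge h2),
          zero (q := fun i => x ∈ (B₂.interval i).pts)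
          (fun i hi => (mem_lt_bound (B₁ := B₁) (B₂ := B₂) (v := Sum.inr i) hi).2.not_ge h2)]
        omega
      · rw [zero (q := fun k => x ∈ (extended B₁ B₂ (Sum.inr (Sum.inr k))).pts)
          (fun k hk => by have := ge_of_mem_rightDummy hk; linarith)]
        omega
  · intro k
    obtain ⟨C, hC, hcard, hmem⟩ := isMaximalClique_range (J := extended B₁ B₂)
      (d := fun k : Fin (omega B₁ B₂) => Sum.inl k) (a := -(bound B₁ B₂ + omega B₁ B₂))
      (fun k => (mem_closedBall (hr := sub_nonneg.2 (hkw k))).2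
        ⟨by linarith [hkw k], by linarith [hkw k]⟩) ⟨0, hw k⟩ (by
        rintro (i | (i | i)) ⟨x, hx, hx'⟩
        · exact ⟨i, rfl⟩
        · have h1 := le_of_mem_leftDummy hx'
          have h2 := (mem_lt_bound (B₁ := B₁) (B₂ := B₂) (v := Sum.inl i) hx).1
          linarith
        · have h1 := le_of_mem_leftDummy hx'
          have h2 := ge_of_mem_rightDummy hx
          linarith)
    refine ⟨C, hC, (hcard Sum.inl_injective).ge, fun y hy x hx => ?_⟩
    have h1 := le_of_mem_leftDummy (hy _ (hmem ⟨0, hw k⟩))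
    exact h1.trans_lt (mem_lt_bound (B₁ := B₁) (B₂ := B₂) (v := Sum.inr k) hx).1
  · intro k
    obtain ⟨C, hC, hcard, hmem⟩ := isMaximalClique_range (J := extended B₁ B₂)
      (d := fun k : Fin (omega B₁ B₂) => Sum.inr (Sum.inr k)) (a := bound B₁ B₂ + omega B₁ B₂)
      (fun k => (mem_closedBall (hr := sub_nonneg.2 (hkw k))).2
        ⟨by linarith [hkw k], by linarith [hkw k]⟩) ⟨0, hw k⟩ (by
        rintro (i | (i | i)) ⟨x, hx, hx'⟩
        · have h1 := ge_of_mem_rightDummy hx'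
          have h2 := le_of_mem_leftDummy hx
          linarith
        · have h1 := ge_of_mem_rightDummy hx'
          have h2 := (mem_lt_bound (B₁ := B₁) (B₂ := B₂) (v := Sum.inl i) hx).2
          linarith
        · exact ⟨i, rfl⟩)
    refine ⟨C, hC, (hcard (Sum.inr_injective.comp Sum.inr_injective)).ge, fun y hy x hx => ?_⟩
    have h1 := ge_of_mem_rightDummy (hy _ (hmem ⟨0, hw k⟩))
    exact (mem_lt_bound (B₁ := B₁) (B₂ := B₂) (v := Sum.inr k) hx).2.trans_le h1

/-! ### The first batch -/

/-- Processing nested intervals restores the stack. -/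
theorem foldl_stackStep_nested {ι : Type} (as : List ι) : ∀ s : List ℕ × (ι → ℕ), as.Nodup →
    as.length ≤ s.1.length →
    ((as.map Sum.inl ++ as.reverse.map Sum.inr).foldl stackStep s).1 = s.1 := by
  induction as with
  | nil => intro s _ _; rfl
  | cons a as ih =>
    intro s hnd hlen
    rw [List.nodup_cons] at hnd
    obtain ⟨f, S, hS⟩ : ∃ f S, s.1 = f :: S := by
      cases h : s.1 with
      | nil => rw [h] at hlen; simp at hlen
      | cons f S => exact ⟨f, S, rfl⟩
    have hlist : ((a :: as).map Sum.inl ++ (a :: as).reverse.map Sum.inr : List (Event ι)) =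
        Sum.inl a :: ((as.map Sum.inl ++ as.reverse.map Sum.inr) ++ [Sum.inr a]) := by simp
    rw [hlist, List.foldl_cons, List.foldl_append, List.foldl_cons, List.foldl_nil]
    have h1 := ih (stackStep s (Sum.inl a)) hnd.2 (by
      simp only [stackStep, hS, List.tail_cons]
      rw [hS] at hlen
      simpa using hlen)
    have h2 := foldl_stackStep_snd_of_notMem (as.map Sum.inl ++ as.reverse.map Sum.inr)
      (stackStep s (Sum.inl a)) (i := a) (by simpa using hnd.1)
    show _ :: _ = s.1
    rw [h1, h2]
    simp [stackStep, hS]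

/-- Additional colors below the initial stack do not change the coloring. -/
theorem stackState_map {ι ι' : Type} [Fintype ι] {J : ι → RealInterval} {T : List (Event ι)}
    (hT : IsEventOrder J T) {w : ℕ}
    (hw : ∀ s : Finset ι, (overlapGraph J).IsClique (s : Set ι) → s.card ≤ w) {f : ι → ι'}
    (hf : Function.Injective f) {s : List ℕ × (ι' → ℕ)} {Y : List ℕ}
    (hs : s.1 = List.range' 1 w ++ Y) {L : List (Event ι)} : L <+: T →
    ((L.map (Sum.map f f)).foldl stackStep s).1 = (stackState w L).1 ++ Y ∧
    ∀ i, Sum.inl i ∈ L → ((L.map (Sum.map f f)).foldl stackStep s).2 (f i) =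
      (stackState w L).2 i := by
  induction L using List.reverseRecOn with
  | nil => exact fun _ => ⟨hs, by simp⟩
  | append_singleton L e ih =>
    intro hL
    have hLT : L <+: T := (List.prefix_append _ _).trans hL
    obtain ⟨h1, h2⟩ := ih hLT
    rw [stackState_concat, List.map_append, List.foldl_append]
    simp only [List.map_cons, List.map_nil, List.foldl_cons, List.foldl_nil]
    rcases e with i | i
    · have hne := stack_ne_nil hT hw hL (stackInvariant_of_prefix hT hw hLT)
      obtain ⟨g, S, hS⟩ := List.exists_cons_of_ne_nil hne
      rw [hS] at h1
      refine ⟨by simp [stackStep, h1, hS], fun j hj => ?_⟩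
      by_cases hji : j = i
      · subst hji
        simp [stackStep, h1, hS]
      · have hj' : Sum.inl j ∈ L := by simpa [hji] using hj
        simp [stackStep, hji, hf.ne hji, h2 j hj']
    · have hil : Sum.inl i ∈ L := by
        have := hT.inl_mem_of_inr hL (i := i) (by simp)
        simpa using this
      refine ⟨by simp [stackStep, h1, h2 i hil], fun j hj => ?_⟩
      exact h2 j (by simpa using hj)

theorem cliqueNum_first_le (B₁ B₂ : Batch) :
    (overlapGraph B₁.interval).cliqueNum ≤ omega B₁ B₂ := by
  obtain ⟨s, hs⟩ := (overlapGraph B₁.interval).exists_isNClique_cliqueNum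
  rw [← hs.card_eq, ← Finset.card_map (Function.Embedding.inl (β := Fin B₂.size))]
  apply isClique_card_le_omega
  intro u hu v hv huv
  obtain ⟨i, hi, rfl⟩ := Finset.mem_map.1 (Finset.mem_coe.1 hu)
  obtain ⟨j, hj, rfl⟩ := Finset.mem_map.1 (Finset.mem_coe.1 hv)
  have hij : i ≠ j := by rintro rfl; exact huv rfl
  exact ⟨huv, (hs.isClique hi hj hij).2⟩

/-- The dummy cliques leave the colors of the first batch unchanged. -/
theorem stackColoring_extended {T : List (Event (Fin B₁.size))}
    (hT : IsEventOrder B₁.interval T) (i : Fin B₁.size) :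
    stackColoring (extendedOrder B₁ B₂ T) (omega B₁ B₂) (Sum.inr (Sum.inl i)) =
      stackColoring T (overlapGraph B₁.interval).cliqueNum i := by
  set w₁ := (overlapGraph B₁.interval).cliqueNum with hw₁
  obtain ⟨d, hd⟩ := Nat.exists_eq_add_of_le (cliqueNum_first_le B₁ B₂)
  have hnot : (Sum.inl (Sum.inr (Sum.inl i)) : Event (ExtIndex B₁ B₂)) ∉
      (nestedEvents (omega B₁ B₂)).map (Sum.map (Sum.inr ∘ Sum.inr) (Sum.inr ∘ Sum.inr)) := by
    simp [nestedEvents]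
  rw [stackColoring, extendedOrder, List.foldl_append, foldl_stackStep_snd_of_notMem _ _ hnot,
    List.foldl_append]
  set s := ((nestedEvents (omega B₁ B₂)).map (Sum.map Sum.inl Sum.inl)).foldl stackStep
    (List.range' 1 (omega B₁ B₂), fun _ : ExtIndex B₁ B₂ => 0) with hs
  have hs1 : s.1 = List.range' 1 w₁ ++ List.range' (1 + w₁) d := by
    have h := foldl_stackStep_nested
      ((List.finRange (omega B₁ B₂)).map (Sum.inl : _ → ExtIndex B₁ B₂))
      (List.range' 1 (omega B₁ B₂), fun _ => 0)
      ((List.nodup_finRange _).map Sum.inl_injective) (by simp)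
    rw [List.range'_append_1, ← hd, hs]
    refine Eq.trans ?_ h
    simp [nestedEvents, Function.comp_def]
  have h := (stackState_map hT (w := w₁)
    (fun t ht => SimpleGraph.IsClique.card_le_cliqueNum (tc := ht))
    (f := (Sum.inr ∘ Sum.inl : _ → ExtIndex B₁ B₂))
    (Sum.inr_injective.comp Sum.inl_injective) hs1 (List.prefix_refl T)).2 i (hT.2.1 _)
  exact h

end

/-! ### The algorithm -/

theorem twoBatches_isProper (ch : TwoBatchesChoices) : (twoBatches ch).IsProper := by
  intro B₁ B₂ u v huv
  have hT := ch.order_spec B₁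
  have hA := admissible_extended (B₂ := B₂) hT
  obtain ⟨h1, h2, -⟩ := secondColoring_spec hA (ch.second B₁ B₂)
  have hfirst : ∀ i, (twoBatches ch).first B₁ i = stackColoring
      (extendedOrder B₁ B₂ (ch.order B₁)) (omega B₁ B₂) (Sum.inr (Sum.inl i)) :=
    fun i => (stackColoring_extended hT i).symm
  obtain ⟨hne, x, hxu, hxv⟩ := huv
  rcases u with i | k <;> rcases v with j | l
  · show (twoBatches ch).first B₁ i ≠ (twoBatches ch).first B₁ j
    rw [hfirst, hfirst]
    intro heq
    have h3 := hA.eq_of_color_eq (x := x) (i := Sum.inr (Sum.inl i))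
      (j := Sum.inr (Sum.inl j)) hxu hxv heq
    simp only [Sum.inr.injEq, Sum.inl.injEq] at h3
    exact hne (congrArg _ h3)
  · show (twoBatches ch).first B₁ i ≠ _
    rw [hfirst]
    exact h2 l (Sum.inr (Sum.inl i)) ⟨x, hxu, hxv⟩
  · show _ ≠ (twoBatches ch).first B₁ j
    rw [hfirst]
    exact (h2 k (Sum.inr (Sum.inl j)) ⟨x, hxv, hxu⟩).symm
  · exact h1 k l ⟨fun h => hne (congrArg _ h), x, hxu, hxv⟩

theorem omega_le_opt (B₁ B₂ : Batch) : omega B₁ B₂ ≤ opt B₁ B₂ := by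
  have h := SimpleGraph.cliqueNum_le_chromaticNumber (G := overlapGraph (allIntervals B₁ B₂))
  have hne : (overlapGraph (allIntervals B₁ B₂)).chromaticNumber ≠ ⊤ :=
    SimpleGraph.chromaticNumber_ne_top_iff_exists.2 ⟨_, SimpleGraph.colorable_of_fintype _⟩
  unfold opt omega
  rw [← ENat.natCast_toNat hne] at h
  exact_mod_cast h

theorem twoBatches_cost_le (ch : TwoBatchesChoices) (B₁ B₂ : Batch) :
    (twoBatches ch).cost B₁ B₂ ≤ omega B₁ B₂ + omega B₁ B₂ / 2 := by
  have hT := ch.order_spec B₁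
  have hA := admissible_extended (B₂ := B₂) hT
  obtain ⟨-, -, h3⟩ := secondColoring_spec hA (ch.second B₁ B₂)
  have hsub : Finset.univ.image ((twoBatches ch).coloring B₁ B₂) ⊆
      Finset.Icc 1 (omega B₁ B₂ + omega B₁ B₂ / 2) := by
    intro f hf
    obtain ⟨v, -, rfl⟩ := Finset.mem_image.1 hf
    rw [Finset.mem_Icc]
    rcases v with i | k
    · have h1 : (twoBatches ch).coloring B₁ B₂ (Sum.inl i) = stackColoring
          (extendedOrder B₁ B₂ (ch.order B₁)) (omega B₁ B₂) (Sum.inr (Sum.inl i)) :=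
        (stackColoring_extended hT i).symm
      have h2 := hA.stackRun.color_range (Sum.inr (Sum.inl i))
      rw [h1]
      omega
    · exact h3 k
  have h := Finset.card_le_card hsub
  rwa [Nat.card_Icc, Nat.add_sub_cancel] at h

/-! ### Existence of the choices -/

theorem exists_isEventOrder {ι : Type} [Fintype ι] (J : ι → RealInterval) :
    ∃ T, IsEventOrder J T := by
  classical
  let r : Event ι → Event ι → Prop := fun e e' => e.position J ≤ e'.position J
  have : Std.Total r := ⟨fun e e' => le_total _ _⟩
  have : IsTrans (Event ι) r := ⟨fun _ _ _ h h' => le_trans h h'⟩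
  refine ⟨(Finset.univ : Finset (Event ι)).toList.insertionSort r, ?_, ?_, ?_⟩
  · exact (List.perm_insertionSort r _).nodup_iff.2 (Finset.nodup_toList _)
  · intro e
    rw [List.mem_insertionSort]
    simp
  · exact List.pairwise_insertionSort r _

/-- There is one representative point for each of the finitely many classes. -/
theorem exists_representatives {ι κ : Type} [Fintype ι] [Fintype κ] (J : ι → RealInterval)
    (K : κ → RealInterval) (cp : Finset ι → ℝ) :
    ∃ P : Finset ℝ, ∀ x : ℝ, ∃! p, p ∈ P ∧ PointEquiv J K cp x p := by
  classical
  have side : ∀ (I : RealInterval) (x y : ℝ), SameSide I x y ↔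
      (x ∈ I.pts ↔ y ∈ I.pts) ∧ ((∀ z ∈ I.pts, x < z) ↔ (∀ z ∈ I.pts, y < z)) := by
    intro I x y
    obtain ⟨z₀, hz₀⟩ := I.pts_nonempty
    constructor
    · rintro (h | h | h)
      · exact ⟨by simp [h], fun h' => absurd (h' x h.1) (lt_irrefl _),
          fun h' => absurd (h' y h.2) (lt_irrefl _)⟩
      · exact ⟨⟨fun h' => absurd (h x h').1 (lt_irrefl _), fun h' =>
          absurd (h y h').2 (lt_irrefl _)⟩, fun _ z hz => (h z hz).2, fun _ z hz => (h z hz).1⟩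
      · exact ⟨⟨fun h' => absurd (h x h').1 (lt_irrefl _), fun h' =>
          absurd (h y h').2 (lt_irrefl _)⟩, fun h' => absurd (h' z₀ hz₀) (h z₀ hz₀).1.not_gt,
          fun h' => absurd (h' z₀ hz₀) (h z₀ hz₀).2.not_gt⟩
    · rintro ⟨h1, h2⟩
      by_cases hx : x ∈ I.pts
      · exact Or.inl ⟨hx, h1.1 hx⟩
      · have hy : y ∉ I.pts := fun hy => hx (h1.2 hy)
        rcases RealInterval.forall_lt_or_forall_gt hx with h | h
        · exact Or.inr (Or.inl fun z hz => ⟨h z hz, h2.1 h z hz⟩)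
        · refine Or.inr (Or.inr fun z hz => ⟨h z hz, ?_⟩)
          rcases RealInterval.forall_lt_or_forall_gt hy with h' | h'
          · exact absurd (h2.2 h' z hz) (h z hz).not_gt
          · exact h' z hz
  -- the class of a point, encoded by finitely many truth values
  let F : ℝ → (Finset ι → Prop × Prop) × (ι → Prop × Prop) × (κ → Prop × Prop) := fun x =>
    (fun C => (IsMaximalClique J C → x < cp C, IsMaximalClique J C → cp C < x),
      fun i => (x ∈ (J i).pts, ∀ z ∈ (J i).pts, x < z),
      fun k => (x ∈ (K k).pts, ∀ z ∈ (K k).pts, x < z))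
  have hF : ∀ x y, PointEquiv J K cp x y ↔ F x = F y := by
    intro x y
    simp only [PointEquiv, side, F, Prod.mk.injEq, funext_iff, eq_iff_iff]
    refine and_congr (forall_congr' fun C => ?_) Iff.rfl
    by_cases hC : IsMaximalClique J C <;> simp [hC]
  have hfin : (Set.range F).Finite := Set.toFinite _
  let g : hfin.toFinset → ℝ := fun b => (hfin.mem_toFinset.1 b.2).choose
  have hg : ∀ b, F (g b) = b := fun b => (hfin.mem_toFinset.1 b.2).choose_spec
  refine ⟨Finset.univ.image g, fun x => ?_⟩
  let b : hfin.toFinset := ⟨F x, hfin.mem_toFinset.2 ⟨x, rfl⟩⟩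
  refine ⟨g b, ⟨by simp, (hF _ _).2 (hg b).symm⟩, ?_⟩
  rintro p ⟨hp, hxp⟩
  obtain ⟨b', -, rfl⟩ := Finset.mem_image.1 hp
  have : b' = b := Subtype.ext (by rw [← hg b', ← (hF _ _).1 hxp])
  rw [this]

/-- Clique points exist by Helly's theorem, and the stack algorithm applied to the second batch
gives a proper coloring with `w` colors, hence initial chains. -/
theorem nonempty_secondChoices {ι κ : Type} [Fintype ι] [Fintype κ] (J : ι → RealInterval)
    (K : κ → RealInterval) (w : ℕ)
    (hw : ∀ s : Finset κ, (overlapGraph K).IsClique (s : Set κ) → s.card ≤ w) :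
    Nonempty (SecondChoices J K w) := by
  classical
  obtain ⟨T, hT⟩ := exists_isEventOrder K
  have hrun := stackRun hT hw
  have hcp : ∀ C : Finset ι, ∃ x, IsMaximalClique J C → ∀ i ∈ C, x ∈ (J i).pts := by
    intro C
    by_cases hC : IsMaximalClique J C
    · obtain ⟨x, hx⟩ := exists_common_point hC.1
      exact ⟨x, fun _ => hx⟩
    · exact ⟨0, fun h => absurd h hC⟩
  choose cp hcp using hcp
  obtain ⟨P, hP⟩ := exists_representatives J K cp
  exact ⟨{
    cliquePoint := cp
    cliquePoint_mem := fun C hC => hcp C hC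
    representatives := P
    representatives_spec := hP
    -- chains are numbered from `0`, the colors on the stack from `1`
    initialChain := fun k => stackColoring T w k - 1
    initialChain_lt := fun k => by
      have := hrun.color_range k
      omega
    initialChain_proper := fun k k' hadj heq => by
      obtain ⟨hne, x, hx, hx'⟩ := hadj
      have h1 := hrun.color_range k
      have h2 := hrun.color_range k'
      exact hne (hrun.inj _ (hT.eventsBefore_prefix x) k k' (hT.openAt_eventsBefore.2 hx)
        (hT.openAt_eventsBefore.2 hx') (by omega))
    pick := fun _ _ _ s => if h : s.Nonempty then h.choose else 0
    pick_mem := fun _ _ _ s h => by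
      rw [dif_pos h]
      exact h.choose_spec }⟩

theorem exists_isTwoBatches : ∃ A, IsTwoBatches A := by
  choose order horder using fun B₁ : Batch => exists_isEventOrder B₁.interval
  have hsecond : ∀ B₁ B₂ : Batch,
      Nonempty (SecondChoices (extended B₁ B₂) B₂.interval (omega B₁ B₂)) := by
    intro B₁ B₂
    refine nonempty_secondChoices _ _ _ fun s hs => ?_
    rw [← Finset.card_map (Function.Embedding.inr (α := Fin B₁.size))]
    apply isClique_card_le_omega
    intro u hu v hv huv
    obtain ⟨i, hi, rfl⟩ := Finset.mem_map.1 (Finset.mem_coe.1 hu)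
    obtain ⟨j, hj, rfl⟩ := Finset.mem_map.1 (Finset.mem_coe.1 hv)
    have hij : i ≠ j := by rintro rfl; exact huv rfl
    exact ⟨huv, (hs hi hj hij).2⟩
  exact ⟨_, ⟨order, horder, fun B₁ B₂ => (hsecond B₁ B₂).some⟩, rfl⟩

/-! ### The lower bound -/

/-- The closed interval `[a, b]`. -/
def closedInterval (a b : ℝ) (h : a ≤ b) : RealInterval where
  lo := a
  hi := b
  loClosed := true
  hiClosed := true
  valid := h.lt_or_eq.imp_right fun h => ⟨h, rfl, rfl⟩

theorem mem_closedInterval {a b x : ℝ} {h : a ≤ b} :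
    x ∈ (closedInterval a b h).pts ↔ a ≤ x ∧ x ≤ b := by
  simp [RealInterval.pts, closedInterval, le_iff_lt_or_eq, eq_comm]

theorem add_half_le_of_lt {N : ℕ} {m m' : Fin N} (h : m < m') :
    ((m : ℕ) : ℝ) + 1 / 2 ≤ ((m' : ℕ) : ℝ) := by
  have : ((m : ℕ) : ℝ) + 1 ≤ ((m' : ℕ) : ℝ) := by exact_mod_cast h
  linarith

/-- The first batch of the adversary: each of the numbers `0, …, N - 1`, regarded as an interval
with a single point, occurs `n` times. -/
def pointCliques (N n : ℕ) : Batch where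
  size := N * n
  interval e := closedInterval ((finProdFinEquiv.symm e).1 : ℕ) ((finProdFinEquiv.symm e).1 : ℕ)
    le_rfl

/-- The second batch of the adversary: `n` copies of `[m, m + 1/2]` and `n` copies of
`[m + 1/2, m']`. -/
noncomputable def bridge (n : ℕ) {N : ℕ} {m m' : Fin N} (h : m < m') : Batch where
  size := n + n
  interval := Fin.append
    (fun _ : Fin n => closedInterval ((m : ℕ) : ℝ) ((m : ℕ) + 1 / 2) (by linarith))
    (fun _ : Fin n => closedInterval (((m : ℕ) : ℝ) + 1 / 2) (m' : ℕ) (add_half_le_of_lt h))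

theorem opt_le_of_coloring {B₁ B₂ : Batch} {k : ℕ} (f : Fin B₁.size ⊕ Fin B₂.size → Fin k)
    (hf : ∀ u v, (overlapGraph (allIntervals B₁ B₂)).Adj u v → f u ≠ f v) :
    opt B₁ B₂ ≤ k := by
  have h : (overlapGraph (allIntervals B₁ B₂)).Colorable k :=
    ⟨SimpleGraph.Coloring.mk f fun {u v} => hf u v⟩
  exact ENat.toNat_le_of_le_natCast h.chromaticNumber_le

/-- The first-batch cliques up to `m` and the right half of the bridge share `n` colors; the later
cliques and the left half of the bridge share `n` others. -/
theorem opt_bridge_le (n : ℕ) {N : ℕ} {m m' : Fin N} (h : m < m') :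
    opt (pointCliques N n) (bridge n h) ≤ n + n := by
  let f₁ : Fin (N * n) → Fin (n + n) := fun e =>
    if (finProdFinEquiv.symm e).1 ≤ m then Fin.castAdd n (finProdFinEquiv.symm e).2
    else Fin.natAdd n (finProdFinEquiv.symm e).2
  let f₂ : Fin (n + n) → Fin (n + n) := Fin.append (Fin.natAdd n) (Fin.castAdd n)
  have hne : ∀ r r' : Fin n, Fin.castAdd n r ≠ Fin.natAdd n r' := by
    intro r r' hr
    have := congrArg Fin.val hr
    simp only [Fin.val_castAdd, Fin.val_natAdd] at this
    have := r.2
    omega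
  have hl : ∀ r, f₂ (Fin.castAdd n r) = Fin.natAdd n r := fun r => Fin.append_left _ _ r
  have hr : ∀ r, f₂ (Fin.natAdd n r) = Fin.castAdd n r := fun r => Fin.append_right _ _ r
  have h₂₂ : Function.Injective f₂ := by
    intro e e' hee
    induction e using Fin.addCases with
    | left r =>
      induction e' using Fin.addCases with
      | left r' => rw [hl, hl, Fin.natAdd_inj] at hee; rw [hee]
      | right r' => rw [hl, hr] at hee; exact absurd hee.symm (hne r' r)
    | right r =>
      induction e' using Fin.addCases with
      | left r' => rw [hl, hr] at hee; exact absurd hee (hne r r')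
      | right r' => rw [hr, hr, Fin.castAdd_inj] at hee; rw [hee]
  have h₁₂ : ∀ (e : Fin (N * n)) (e' : Fin (n + n)),
      (((pointCliques N n).interval e).pts ∩ ((bridge n h).interval e').pts).Nonempty →
      f₁ e ≠ f₂ e' := by
    rintro e e' ⟨x, hx, hx'⟩
    have hx := (mem_closedInterval (h := le_rfl)).1 hx
    induction e' using Fin.addCases with
    | left r' =>
      simp only [bridge, Fin.append_left, mem_closedInterval] at hx'
      have hle : (finProdFinEquiv.symm e).1 ≤ m := by
        have : (((finProdFinEquiv.symm e).1 : ℕ) : ℝ) < (m : ℕ) + 1 := by linarith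
        have : ((finProdFinEquiv.symm e).1 : ℕ) < (m : ℕ) + 1 := by exact_mod_cast this
        exact Fin.le_def.2 (by omega)
      simp only [f₁, if_pos hle, hl]
      exact hne _ _
    | right r' =>
      simp only [bridge, Fin.append_right, mem_closedInterval] at hx'
      have hle : ¬ (finProdFinEquiv.symm e).1 ≤ m := by
        have : ((m : ℕ) : ℝ) < ((finProdFinEquiv.symm e).1 : ℕ) := by linarith
        have : (m : ℕ) < ((finProdFinEquiv.symm e).1 : ℕ) := by exact_mod_cast this
        exact not_le.2 (Fin.lt_def.2 this)
      simp only [f₁, if_neg hle, hr]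
      exact (hne _ _).symm
  refine opt_le_of_coloring (Sum.elim f₁ f₂) ?_
  rintro (e | e) (e' | e') ⟨hee, hmeet⟩ heq
  · obtain ⟨x, hx, hx'⟩ := hmeet
    have hx := (mem_closedInterval (h := le_rfl)).1 hx
    have hx' := (mem_closedInterval (h := le_rfl)).1 hx'
    have hdiv : (finProdFinEquiv.symm e).1 = (finProdFinEquiv.symm e').1 := by
      have : (((finProdFinEquiv.symm e).1 : ℕ) : ℝ) = ((finProdFinEquiv.symm e').1 : ℕ) := by
        linarith
      exact Fin.ext (by exact_mod_cast this)
    refine hee (congrArg Sum.inl (finProdFinEquiv.symm.injective (Prod.ext hdiv ?_)))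
    change f₁ e = f₁ e' at heq
    simp only [f₁, hdiv] at heq
    split_ifs at heq
    · exact Fin.castAdd_inj.1 heq
    · exact (Fin.natAdd_inj n).1 heq
  · exact h₁₂ e e' hmeet heq
  · exact h₁₂ e' e (by rwa [Set.inter_comm]) heq.symm
  · exact hee (congrArg Sum.inr (h₂₂ heq))

theorem mem_pointCliques {N n : ℕ} (k : Fin N) (r : Fin n) :
    ((k : ℕ) : ℝ) ∈ ((pointCliques N n).interval (finProdFinEquiv (k, r))).pts := by
  simp only [pointCliques, mem_closedInterval, Equiv.symm_apply_apply, le_refl, and_self]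

theorem first_injective {A : Algorithm} (hA : A.IsProper) {N n : ℕ} {m m' : Fin N} (h : m < m')
    (k : Fin N) : Function.Injective
      fun r : Fin n => A.first (pointCliques N n) (finProdFinEquiv (k, r)) := by
  intro r r' hr
  by_contra hne
  refine hA (pointCliques N n) (bridge n h) (Sum.inl (finProdFinEquiv (k, r)))
    (Sum.inl (finProdFinEquiv (k, r')))
    ⟨fun h => hne ?_, (k : ℕ), mem_pointCliques k r, mem_pointCliques k r'⟩ hr
  exact congrArg Prod.snd (finProdFinEquiv.injective (Sum.inl_injective h))

/-- If the cliques at `m` and `m'` have the same colors, then none of these can be used on the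
bridge between them: its left half meets the clique at `m`, its right half the clique at `m'`. -/
theorem le_cost_bridge {A : Algorithm} (hA : A.IsProper) {N n : ℕ} {m m' : Fin N} (h : m < m')
    (hcol : ∀ r : Fin n, ∃ r' : Fin n, A.first (pointCliques N n) (finProdFinEquiv (m, r)) =
      A.first (pointCliques N n) (finProdFinEquiv (m', r'))) :
    3 * n ≤ A.cost (pointCliques N n) (bridge n h) := by
  have hadj := hA (pointCliques N n) (bridge n h)
  have hleft : ∀ (x : ℝ) (r : Fin n), ((m : ℕ) : ℝ) ≤ x → x ≤ (m : ℕ) + 1 / 2 →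
      x ∈ ((bridge n h).interval (Fin.castAdd n r)).pts := fun x r h1 h2 => by
    simp only [bridge, Fin.append_left, mem_closedInterval]
    exact ⟨h1, h2⟩
  have hright : ∀ (x : ℝ) (r : Fin n), ((m : ℕ) : ℝ) + 1 / 2 ≤ x → x ≤ (m' : ℕ) →
      x ∈ ((bridge n h).interval (Fin.natAdd n r)).pts := fun x r h1 h2 => by
    simp only [bridge, Fin.append_right, mem_closedInterval]
    exact ⟨h1, h2⟩
  have hhalf := add_half_le_of_lt h
  have hmid : ∀ e : Fin (n + n), ((m : ℕ) : ℝ) + 1 / 2 ∈ ((bridge n h).interval e).pts := by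
    intro e
    induction e using Fin.addCases with
    | left r => exact hleft _ r (by linarith) le_rfl
    | right r => exact hright _ r le_rfl hhalf
  let g : Fin n ⊕ Fin (n + n) → Fin (N * n) ⊕ Fin (n + n) :=
    Sum.map (fun r => finProdFinEquiv (m, r)) id
  have hdisj : ∀ (r : Fin n) (e : Fin (n + n)), A.first (pointCliques N n)
      (finProdFinEquiv (m, r)) ≠ A.second (pointCliques N n) (bridge n h) e := by
    intro r e
    induction e using Fin.addCases with
    | left s =>
      exact hadj (Sum.inl _) (Sum.inr _)
        ⟨Sum.inl_ne_inr, _, mem_pointCliques m r, hleft _ s le_rfl (by linarith)⟩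
    | right s =>
      obtain ⟨r', hr'⟩ := hcol r
      rw [hr']
      exact hadj (Sum.inl _) (Sum.inr _)
        ⟨Sum.inl_ne_inr, _, mem_pointCliques m' r', hright _ s hhalf le_rfl⟩
  have hinj : Function.Injective (A.coloring (pointCliques N n) (bridge n h) ∘ g) := by
    rintro (r | e) (r' | e') heq
    · exact congrArg Sum.inl (first_injective hA h m heq)
    · exact absurd heq (hdisj r e')
    · exact absurd heq.symm (hdisj r' e)
    · by_contra hne
      exact hadj (Sum.inr e) (Sum.inr e')
        ⟨fun h => hne (congrArg Sum.inr (Sum.inr_injective h)), _, hmid e, hmid e'⟩ heq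
  have hcard := Finset.card_image_of_injective Finset.univ hinj
  have hsub : Finset.univ.image (A.coloring (pointCliques N n) (bridge n h) ∘ g) ⊆
      Finset.univ.image (A.coloring (pointCliques N n) (bridge n h)) := by
    intro c hc
    obtain ⟨u, -, rfl⟩ := Finset.mem_image.1 hc
    exact Finset.mem_image_of_mem _ (Finset.mem_univ (g u))
  have := Finset.card_le_card hsub
  rw [hcard] at this
  simp only [Finset.card_univ, Fintype.card_sum, Fintype.card_fin] at this
  unfold Algorithm.cost
  omega

/-- On the first batch either at least `3 * n` colors are used, or, by the pigeonhole principle, two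
of the many cliques have the same set of colors. -/
theorem exists_three_mul_le_cost {A : Algorithm} (hA : A.IsProper) (n : ℕ) :
    ∃ B₁ B₂ : Batch, 3 * n ≤ A.cost B₁ B₂ ∧ opt B₁ B₂ ≤ n + n := by
  -- more cliques than there are subsets of a set of less than `3 * n` colors
  set N := 2 ^ (3 * n) + 1 with hN
  have hN1 : 1 < N := by have := Nat.one_le_two_pow (n := 3 * n); omega
  set U := Finset.univ.image (A.first (pointCliques N n)) with hU
  rcases le_or_gt (3 * n) U.card with hcard | hcard
  · -- the second batch does not matter
    have h01 : (⟨0, by omega⟩ : Fin N) < ⟨1, hN1⟩ := Fin.mk_lt_mk.2 one_pos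
    refine ⟨pointCliques N n, bridge n h01, hcard.trans (Finset.card_le_card ?_),
      opt_bridge_le n h01⟩
    intro c hc
    obtain ⟨e, -, rfl⟩ := Finset.mem_image.1 hc
    exact Finset.mem_image.2 ⟨Sum.inl e, Finset.mem_univ _, rfl⟩
  · let X : Fin N → Finset ℕ := fun k => Finset.univ.image
      fun r : Fin n => A.first (pointCliques N n) (finProdFinEquiv (k, r))
    have hX : ∀ k ∈ (Finset.univ : Finset (Fin N)), X k ∈ U.powerset := by
      intro k _
      refine Finset.mem_powerset.2 fun c hc => ?_
      obtain ⟨r, -, rfl⟩ := Finset.mem_image.1 hc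
      exact Finset.mem_image_of_mem _ (Finset.mem_univ _)
    have hlt : U.powerset.card < (Finset.univ : Finset (Fin N)).card := by
      rw [Finset.card_powerset, Finset.card_univ, Fintype.card_fin]
      have := Nat.pow_le_pow_right (n := 2) two_pos hcard.le
      omega
    obtain ⟨k, -, k', -, hne, heq⟩ := Finset.exists_ne_map_eq_of_card_lt_of_maps_to hlt hX
    obtain ⟨m, m', h, heq⟩ : ∃ m m' : Fin N, m < m' ∧ X m = X m' := by
      rcases lt_or_gt_of_ne hne with h | h
      · exact ⟨k, k', h, heq⟩
      · exact ⟨k', k, h, heq.symm⟩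
    refine ⟨pointCliques N n, bridge n h, le_cost_bridge hA h fun r => ?_, opt_bridge_le n h⟩
    have hr : A.first (pointCliques N n) (finProdFinEquiv (m, r)) ∈ X m' :=
      heq ▸ Finset.mem_image_of_mem _ (Finset.mem_univ r)
    obtain ⟨r', -, hr'⟩ := Finset.mem_image.1 hr
    exact ⟨r', hr'.symm⟩

theorem Algorithm.IsCompetitive.three_halves_le {A : Algorithm} {ρ : ℝ} (hA : A.IsProper)
    (hρ : A.IsCompetitive ρ) : 3 / 2 ≤ ρ := by
  obtain ⟨b, hb⟩ := hρ
  by_contra! hlt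
  -- only for a nonnegative factor does the upper bound for `opt` give one for the product
  set σ := max ρ 0 with hσ
  have hσlt : 0 < 3 - 2 * σ := by
    have : σ < 3 / 2 := max_lt hlt (by norm_num)
    linarith
  obtain ⟨n, hn⟩ := exists_nat_gt (b / (3 - 2 * σ))
  obtain ⟨B₁, B₂, hcost, hopt⟩ := exists_three_mul_le_cost hA n
  have h1 : (3 : ℝ) * n ≤ A.cost B₁ B₂ := by exact_mod_cast hcost
  have h2 : (opt B₁ B₂ : ℝ) ≤ n + n := by exact_mod_cast hopt
  have h3 := hb B₁ B₂
  have h4 : ρ * (opt B₁ B₂ : ℝ) ≤ σ * (n + n) :=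
    (mul_le_mul_of_nonneg_right (le_max_left ρ 0) (Nat.cast_nonneg _)).trans
      (mul_le_mul_of_nonneg_left h2 (le_max_right ρ 0))
  rw [div_lt_iff₀ hσlt] at hn
  linarith

/-! ### Competitive ratios -/

theorem Algorithm.IsStrictlyCompetitive.isCompetitive {A : Algorithm} {ρ : ℝ}
    (h : A.IsStrictlyCompetitive ρ) : A.IsCompetitive ρ :=
  ⟨0, fun B₁ B₂ => by simpa using h B₁ B₂⟩

theorem Algorithm.le_competitiveRatio {A : Algorithm} (hA : A.IsProper) :
    ((3 / 2 : ℝ) : EReal) ≤ A.competitiveRatio := by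
  refine le_sInf ?_
  rintro _ ⟨ρ, hρ, rfl⟩
  exact EReal.coe_le_coe_iff.2 (Algorithm.IsCompetitive.three_halves_le hA hρ)

theorem Algorithm.competitiveRatio_le_strictCompetitiveRatio (A : Algorithm) :
    A.competitiveRatio ≤ A.strictCompetitiveRatio :=
  sInf_le_sInf (Set.image_mono fun _ h => Algorithm.IsStrictlyCompetitive.isCompetitive h)

theorem IsTwoBatches.isProper {A : Algorithm} (hA : IsTwoBatches A) : A.IsProper := by
  obtain ⟨ch, rfl⟩ := hA
  exact twoBatches_isProper ch

theorem IsTwoBatches.cost_le {A : Algorithm} (hA : IsTwoBatches A) (B₁ B₂ : Batch) :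
    A.cost B₁ B₂ ≤ opt B₁ B₂ + opt B₁ B₂ / 2 := by
  obtain ⟨ch, rfl⟩ := hA
  have h1 := twoBatches_cost_le ch B₁ B₂
  have h2 := omega_le_opt B₁ B₂
  omega

theorem IsTwoBatches.isStrictlyCompetitive {A : Algorithm} (hA : IsTwoBatches A) :
    A.IsStrictlyCompetitive (3 / 2) := by
  intro B₁ B₂
  have h1 : (A.cost B₁ B₂ : ℝ) ≤ opt B₁ B₂ + (opt B₁ B₂ / 2 : ℕ) := by
    exact_mod_cast hA.cost_le B₁ B₂
  have h2 : ((opt B₁ B₂ / 2 : ℕ) : ℝ) ≤ (opt B₁ B₂ : ℝ) / 2 := by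
    exact_mod_cast Nat.cast_div_le (α := ℝ)
  linarith

theorem IsTwoBatches.strictCompetitiveRatio_le {A : Algorithm} (hA : IsTwoBatches A) :
    A.strictCompetitiveRatio ≤ ((3 / 2 : ℝ) : EReal) :=
  sInf_le ⟨_, hA.isStrictlyCompetitive, rfl⟩

theorem IsTwoBatches.strictCompetitiveRatio_eq {A : Algorithm} (hA : IsTwoBatches A) :
    A.strictCompetitiveRatio = ((3 / 2 : ℝ) : EReal) :=
  hA.strictCompetitiveRatio_le.antisymm
    ((A.le_competitiveRatio hA.isProper).trans A.competitiveRatio_le_strictCompetitiveRatio)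

theorem IsTwoBatches.competitiveRatio_eq {A : Algorithm} (hA : IsTwoBatches A) :
    A.competitiveRatio = ((3 / 2 : ℝ) : EReal) :=
  (A.competitiveRatio_le_strictCompetitiveRatio.trans hA.strictCompetitiveRatio_le).antisymm
    (A.le_competitiveRatio hA.isProper)

theorem optimalCompetitiveRatio_eq : optimalCompetitiveRatio = ((3 / 2 : ℝ) : EReal) := by
  obtain ⟨A, hA⟩ := exists_isTwoBatches
  refine le_antisymm (sInf_le ⟨A, hA.isProper, hA.competitiveRatio_eq⟩) (le_sInf ?_)
  rintro _ ⟨A', hA', rfl⟩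
  exact A'.le_competitiveRatio hA'

theorem optimalStrictCompetitiveRatio_eq :
    optimalStrictCompetitiveRatio = ((3 / 2 : ℝ) : EReal) := by
  obtain ⟨A, hA⟩ := exists_isTwoBatches
  refine le_antisymm (sInf_le ⟨A, hA.isProper, hA.strictCompetitiveRatio_eq⟩) (le_sInf ?_)
  rintro _ ⟨A', hA', rfl⟩
  exact (A'.le_competitiveRatio hA').trans A'.competitiveRatio_le_strictCompetitiveRatio

end BatchColoring

theorem mainTheorem1 :
    (∃ A, BatchColoring.IsTwoBatches A) ∧
    (∀ A, BatchColoring.IsTwoBatches A →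
      A.IsProper ∧
      (∀ B₁ B₂ : BatchColoring.Batch,
        A.cost B₁ B₂ ≤ ⌊(3 / 2 : ℝ) * (BatchColoring.opt B₁ B₂ : ℝ)⌋₊) ∧
      A.strictCompetitiveRatio = ((3 / 2 : ℝ) : EReal) ∧
      A.competitiveRatio = ((3 / 2 : ℝ) : EReal)) ∧
    (∀ (A : BatchColoring.Algorithm) (ρ : ℝ),
      A.IsProper → A.IsCompetitive ρ → (3 / 2 : ℝ) ≤ ρ) ∧
    BatchColoring.optimalCompetitiveRatio = ((3 / 2 : ℝ) : EReal) ∧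
    BatchColoring.optimalStrictCompetitiveRatio = ((3 / 2 : ℝ) : EReal) :=
  ⟨BatchColoring.exists_isTwoBatches,
    fun _ hA => ⟨hA.isProper, fun B₁ B₂ => Nat.le_floor (hA.isStrictlyCompetitive B₁ B₂),
      hA.strictCompetitiveRatio_eq, hA.competitiveRatio_eq⟩,
    fun _ _ hA hρ => BatchColoring.Algorithm.IsCompetitive.three_halves_le hA hρ,
    BatchColoring.optimalCompetitiveRatio_eq, BatchColoring.optimalStrictCompetitiveRatio_eq⟩
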